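/- **Setting.** Let $(X,A,D,Y^*)\sim P$ with features $X\in\mathcal X$, attribute $A\in\{0,1\}$, decision $D\in\{0,1\}$ and outcome $Y^*\in[0,1]$, observed only if $D=1$. Assume *selection on observables*, $D\perp Y^*\mid X$, and *positivity*, $\mathbb P(D=1\mid X)>0$ almost surely. Let $\mu(x)=\mathbb E[Y^*\mid X=x]$. Let $l:[0,1]^2\to[0,1]$ be 1-Lipschitz for the $\ell_1$-norm, and let $\mathcal F$ be a nonempty class of functions $f:\mathcal X\to[0,1]$ (measurable, with the usual measurability of suprema over the class). For a discrete distribution $Q$ on $\mathcal F$ put $\operatorname{loss}(Q)=\sum_fQ(f)\,\mathbb E[l(Y^*,f(X))]$ and $\operatorname{loss}_\mu(Q)=\sum_fQ(f)\,\mathbb E[l(\mu(X),f(X))]$. For $a\in\{0,1\}$ let $\mathcal E_a=\{A\in S_a\}$ with $g_a(m)=1$, or $\mathcal E_a=\{A\in S_a,Y^*=1\}$ with $g_a(m)=m$, or $\mathcal E_a=\{A\in S_a,Y^*=0\}$ with $g_a(m)=1-m$, where $S_a\subseteq\{0,1\}$ (typically $S_a=\{a\}$). If one of the events involves $Y^*$,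 assume $Y^*\in\{0,1\}$ almost surely and $Y^*\perp A\mid X$ (for instance, $A$ is a function of $X$). Let $\beta_0,\beta_1\in\mathbb R$, with $\mathbb P(\mathcal E_a)>0$ whenever $\beta_a\ne0$, and let $\operatorname{disparity}(f)=\sum_a\beta_a\mathbb E[f(X)\mid\mathcal E_a]$, extended linearly to distributions $Q$. Fix a tolerance $\epsilon\ge0$ and call $Q$ *feasible* if $\operatorname{loss}_\mu(Q)\le\epsilon$. **Algorithm.** Given $n$ i.i.d. draws, the input data are the oracle triples $(X_i,A_i,\mu(X_i))$; $\hat{\mathbb E}$ is the sample mean. Let $\alpha=1/N$, let $Z$ be uniform on $\{\alpha,2\alpha,\dots,1\}$ and independent of the data, let $\underline\mu_i$ be the smallest point within $\alpha/2$ of $\mu(X_i)$ in a finite $\alpha/2$-cover of $[0,1]$ contained in $[0,1]$, and let $h_f(x,z)=1\{f(x)\ge z\}$. Put $c(y,z)=N\big(l(y,\min\{z+\tfrac\alpha2,1\})-l(y,z-\tfrac\alpha2)\big)$, $\widehat{\operatorname{cost}}(f)=\hat{\mathbb E}\,\mathbb E_Z[c(\underline\mu_i,Z)h_f(X_i,Z)]$,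 $\hat c_0=\hat{\mathbb E}[l(\underline\mu_i,\tfrac\alpha2)]$ and $$\widehat{\operatorname{disparity}}(f)=\sum_a\beta_a\frac{\hat{\mathbb E}\big[1\{A_i\in S_a\}g_a(\mu(X_i))\,\mathbb E_Z h_f(X_i,Z)\big]}{\hat{\mathbb E}\big[1\{A_i\in S_a\}g_a(\mu(X_i))\big]},$$ with linear extensions to $Q$; let $L(Q,\lambda)=\widehat{\operatorname{disparity}}(Q)+\lambda(\widehat{\operatorname{cost}}(Q)-\hat\epsilon)$. The exponentiated gradient algorithm starts from $\theta_1=0$; in iteration $t$ it sets $\lambda_t=B_\lambda e^{\theta_t}/(1+e^{\theta_t})$, lets $f_t$ be an exact minimizer of $L(\cdot,\lambda_t)$ over $\mathcal F$, and lets $\hat Q_t$, $\hat\lambda_t$ be the uniform averages of the iterates so far. It stops as soon as both $L(\hat Q_t,\hat\lambda_t)-\min_fL(f,\hat\lambda_t)$ and $\max_{0\le\lambda\le B_\lambda}L(\hat Q_t,\lambda)-L(\hat Q_t,\hat\lambda_t)$ are at most $\nu$; it then returns $\hat Q=\hat Q_t$ if $\widehat{\operatorname{cost}}(\hat Q_t)\le\hat\epsilon+(|\beta_0|+|\beta_1|+2\nu)/B_\lambda$,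 and null otherwise. If it does not stop, $\theta_{t+1}=\theta_t+\eta(\widehat{\operatorname{cost}}(f_t)-\hat\epsilon)$, where $\eta=\nu/(2\rho^2B_\lambda)$ and $\rho=\sup_f|\widehat{\operatorname{cost}}(f)-\hat\epsilon|$. **Conditions.** Let $\mathcal H=\{h_f:f\in\mathcal F\}$ on $\mathcal X\times[0,1]$. Its Rademacher complexity $R_n(\mathcal H)=\sup_{u_1,\dots,u_n}\mathbb E_\sigma\sup_{h\in\mathcal H}|\tfrac1n\sum_i\sigma_ih(u_i)|$ satisfies $R_n(\mathcal H)\le Cn^{-\phi}$ for all $n\ge1$, with $C>0$ and $0\le\phi\le\frac12$. Moreover $\hat\epsilon=\epsilon-\hat c_0+C'n^{-\phi}+C''n^{-1/2}$ with $C'\ge2C+2+\sqrt{2\ln(8N/\delta)}$ and $C''\ge\sqrt{\ln(8/\delta)/2}$, both at most a fixed multiple of these lower bounds; $\nu\propto n^{-\phi}$, $B_\lambda\propto n^\phi$, and $N\propto n^\phi$ up to fixed positive factors from below and above; $0<\delta<1$. **Theorem 2 (Selective Labels).** (i) *Identification:* if $\mathbb P(\mathcal E_a)>0$, then $\mathbb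 E[g_a(\mu(X))\mid A\in S_a]>0$ and, for all $f\in\mathcal F$, $\mathbb E[f(X)\mid\mathcal E_a]=\mathbb E[f(X)g_a(\mu(X))\mid A\in S_a]\,/\,\mathbb E[g_a(\mu(X))\mid A\in S_a]$. (ii) The algorithm terminates on every sample in at most $K(1+\ln\frac1\delta)\,n^{4\phi}$ iterations; for fixed $\delta$ this is $O(n^{4\phi})$. (iii) For all sufficiently large $n$, with probability at least $1-\delta$ one of the following holds: 1) $\hat Q\ne$ null, $\operatorname{loss}_\mu(\hat Q)\le\epsilon+\tilde O(n^{-\phi})$, and $\operatorname{disparity}(\hat Q)\le\operatorname{disparity}(\tilde Q)+\tilde O(n_0^{-\phi})+\tilde O(n_1^{-\phi})$ for every feasible $\tilde Q$, where $n_a$ is the number of samples with $A_i\in S_a$ (read as $1$ if there are none); or 2) $\hat Q=$ null and no $Q$ is feasible. (iv) If $l(\cdot,u)$ is convex for every $u$, then $\operatorname{loss}_\mu(Q)\le\operatorname{loss}(Q)$ for all $Q$, so the guarantees in (iii) then also hold with feasibility defined by $\operatorname{loss}(Q)\le\epsilon$. Here $\tilde O(r)$ means at most $K(1+\ln n+\ln\frac1\delta)^k\,r$.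 The constants $K$, $k$ and the threshold for $n$ depend only on $\beta_0,\beta_1,\phi,C,\epsilon$, the proportionality factors, and a positive lower bound for those $\mathbb P(\mathcal E_a)$ with $\beta_a\ne0$. -/

import Mathlib

open MeasureTheory ProbabilityTheory

/-! ### Population, selection, outcome regression -/

/-- One unit `(X, A, D, Y*)`: features, protected attribute, decision, outcome.
The outcome is observed exactly when `D = 1`. -/
abbrev Unit4 (𝒳 : Type*) := 𝒳 × Fin 2 × Fin 2 × ℝ

namespace Unit4

variable {𝒳 : Type*}

/-- The features `X`. -/
def feat (o : Unit4 𝒳) : 𝒳 := o.1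
/-- The protected attribute `A`. -/
def attr (o : Unit4 𝒳) : Fin 2 := o.2.1
/-- The decision `D`. -/
def dec (o : Unit4 𝒳) : Fin 2 := o.2.2.1
/-- The outcome `Y*`. -/
def out (o : Unit4 𝒳) : ℝ := o.2.2.2

end Unit4

/-- The σ-algebra `σ(X)` on the space of units. -/
@[reducible] def sigmaFeat (𝒳 : Type*) [MeasurableSpace 𝒳] : MeasurableSpace (Unit4 𝒳) :=
  MeasurableSpace.comap Unit4.feat inferInstance

/-- `U` and `V` are conditionally independent given the features `X` under `P`:
`P(U ∈ s, V ∈ t | X) = P(U ∈ s | X) P(V ∈ t | X)` almost surely, for all measurable `s`, `t`. -/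
def CondIndepGivenFeat {𝒳 : Type*} [MeasurableSpace 𝒳] (P : Measure (Unit4 𝒳))
    {S T : Type*} [MeasurableSpace S] [MeasurableSpace T]
    (U : Unit4 𝒳 → S) (V : Unit4 𝒳 → T) : Prop :=
  ∀ (s : Set S) (t : Set T), MeasurableSet s → MeasurableSet t →
    P⟦U ⁻¹' s ∩ V ⁻¹' t | sigmaFeat 𝒳⟧ =ᵐ[P]
      P⟦U ⁻¹' s | sigmaFeat 𝒳⟧ * P⟦V ⁻¹' t | sigmaFeat 𝒳⟧

/-- Selective labels with selection on observables and positivity; `μ` is (a `[0,1]`-valued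
version of) the outcome regression function `μ(x) = E[Y* | X = x]`. -/
structure SelectiveLabels {𝒳 : Type*} [MeasurableSpace 𝒳] (P : Measure (Unit4 𝒳))
    (μ : 𝒳 → ℝ) : Prop where
  out_mem : ∀ᵐ o ∂P, o.out ∈ Set.Icc (0 : ℝ) 1
  selection_on_observables : CondIndepGivenFeat P Unit4.dec Unit4.out
  positivity : ∀ᵐ o ∂P, 0 < (P⟦{o : Unit4 𝒳 | o.dec = 1} | sigmaFeat 𝒳⟧) o
  measurable_reg : Measurable μ
  reg_mem : ∀ x, μ x ∈ Set.Icc (0 : ℝ) 1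
  reg_eq : (fun o : Unit4 𝒳 => μ o.feat) =ᵐ[P] P[Unit4.out | sigmaFeat 𝒳]

/-! ### Conditioning events and disparities -/

/-- How a conditioning event restricts the outcome. -/
inductive LabelCond
  /-- no restriction -/
  | free
  /-- `Y* = 1` -/
  | pos
  /-- `Y* = 0` -/
  | neg

/-- The set of outcomes that satisfy the restriction. -/
def LabelCond.outcomes : LabelCond → Set ℝ
  | .free => Set.univ
  | .pos => {1}
  | .neg => {0}

/-- The weight `g` applied to the outcome regression: `g = 1`, `g(m) = m`, `g(m) = 1 - m`. -/
def LabelCond.weight : LabelCond → ℝ → ℝ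
  | .free, _ => 1
  | .pos, m => m
  | .neg, m => 1 - m

/-- A conditioning event `{A ∈ attrs, Y* satisfies label}`, e.g. `{A = a}`, `{Y* = 1, A = a}`. -/
structure GroupEvent where
  attrs : Finset (Fin 2)
  label : LabelCond

namespace GroupEvent

variable {𝒳 : Type*}

/-- The part `{A ∈ attrs}` of the event. -/
def attrSet (e : GroupEvent) : Set (Unit4 𝒳) := {o | o.attr ∈ e.attrs}

/-- The full event, as a set of units. -/
def toSet (e : GroupEvent) : Set (Unit4 𝒳) :=
  {o | o.attr ∈ e.attrs ∧ o.out ∈ e.label.outcomes}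

end GroupEvent

/-- `disparity(f) = β₀ E[f(X) | ℰ₀] + β₁ E[f(X) | ℰ₁]`. -/
noncomputable def disparity {𝒳 : Type*} [MeasurableSpace 𝒳] (P : Measure (Unit4 𝒳))
    (β : Fin 2 → ℝ) (ev : Fin 2 → GroupEvent) (f : 𝒳 → ℝ) : ℝ :=
  ∑ a, β a * ∫ o, f o.feat ∂(P[|(ev a).toSet])

/-! ### Losses, prediction functions, randomized prediction functions -/

/-- A loss `l : [0,1] × [0,1] → [0,1]`, 1-Lipschitz for the `ℓ₁` norm
(values outside the unit square are never used). -/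
structure IsLoss (l : ℝ → ℝ → ℝ) : Prop where
  mem : ∀ y ∈ Set.Icc (0 : ℝ) 1, ∀ u ∈ Set.Icc (0 : ℝ) 1, l y u ∈ Set.Icc (0 : ℝ) 1
  lipschitz : ∀ y ∈ Set.Icc (0 : ℝ) 1, ∀ u ∈ Set.Icc (0 : ℝ) 1,
    ∀ y' ∈ Set.Icc (0 : ℝ) 1, ∀ u' ∈ Set.Icc (0 : ℝ) 1,
      |l y u - l y' u'| ≤ |y - y'| + |u - u'|

/-- `loss(f) = E[l(Y*, f(X))]`. -/
noncomputable def loss {𝒳 : Type*} [MeasurableSpace 𝒳] (P : Measure (Unit4 𝒳))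
    (l : ℝ → ℝ → ℝ) (f : 𝒳 → ℝ) : ℝ := ∫ o, l o.out (f o.feat) ∂P

/-- `loss_μ(f) = E[l(μ(X), f(X))]`. -/
noncomputable def lossReg {𝒳 : Type*} [MeasurableSpace 𝒳] (P : Measure (Unit4 𝒳))
    (μ : 𝒳 → ℝ) (l : ℝ → ℝ → ℝ) (f : 𝒳 → ℝ) : ℝ := ∫ o, l (μ o.feat) (f o.feat) ∂P

/-- `v(Q) = ∑ᵢ Q(i) v(i)`, the average of `v` under a (discrete) distribution `Q`. -/
noncomputable def avg {ι : Type*} (Q : PMF ι) (v : ι → ℝ) : ℝ := ∑' i, (Q i).toReal * v i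

/-- The threshold classifier `h_f(x, z) = 1{f(x) ≥ z}`. -/
noncomputable def thr {𝒳 : Type*} (f : 𝒳 → ℝ) (x : 𝒳) (z : ℝ) : ℝ := if z ≤ f x then 1 else 0

/-- The class `ℋ` of threshold classifiers of functions in `F`, with cutoffs in `[0,1]`. -/
def thrClass {𝒳 : Type*} (F : Set (𝒳 → ℝ)) : Set (𝒳 × Set.Icc (0 : ℝ) 1 → ℝ) :=
  {h | ∃ f ∈ F, h = fun u => thr f u.1 u.2}

/-- The (worst-case) Rademacher complexity
`R_n(G) = sup_{u₁,…,u_n} E_σ sup_{g ∈ G} |n⁻¹ ∑ σᵢ g(uᵢ)|`, with `σ` uniform on `{-1,1}ⁿ`. -/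
noncomputable def rademacher {U : Type*} (G : Set (U → ℝ)) (n : ℕ) : ℝ :=
  ⨆ u : Fin n → U, (∑ σ : Fin n → Bool,
    ⨆ g : G, |(∑ i, (if σ i then (1 : ℝ) else -1) * (g : U → ℝ) (u i)) / n|) / 2 ^ n

/-- A nonempty class `F` of measurable functions `𝒳 → [0,1]` whose classes of threshold
classifiers are measurable for `P` in the usual sense of empirical process theory (weighted
suprema over the class are measurable for the completion of the sampling law). -/
structure IsPredictionClass {𝒳 : Type*} [MeasurableSpace 𝒳] (P : Measure (Unit4 𝒳))
    (F : Set (𝒳 → ℝ)) : Prop where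
  nonempty : F.Nonempty
  measurable : ∀ f ∈ F, Measurable f
  mem : ∀ f ∈ F, ∀ x, f x ∈ Set.Icc (0 : ℝ) 1
  measurable_sup : ∀ (m : ℕ) (w : Fin m → ℝ), ∀ z ∈ Set.Icc (0 : ℝ) 1,
    AEMeasurable (fun x : Fin m → 𝒳 => ⨆ f : F, |∑ i, w i * thr (f : 𝒳 → ℝ) (x i) z|)
      (Measure.pi fun _ : Fin m => P.map Unit4.feat)

/-! ### Discretization and sample analogues -/

/-- `T` is a finite `α/2`-cover of `[0,1]` by points of `[0,1]`, with `α = 1/N`. -/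
def IsHalfCover (N : ℕ) (T : Finset ℝ) : Prop :=
  (∀ t ∈ T, t ∈ Set.Icc (0 : ℝ) 1) ∧
    ∀ y ∈ Set.Icc (0 : ℝ) 1, ∃ t ∈ T, |y - t| ≤ 1 / (2 * (N : ℝ))

/-- The rounded outcome: the smallest point of the cover within `α/2` of `y`. -/
noncomputable def roundOut (N : ℕ) (T : Finset ℝ) (y : ℝ) : ℝ :=
  sInf {t : ℝ | t ∈ T ∧ |y - t| ≤ 1 / (2 * (N : ℝ))}

/-- `c(y, z) = N (l(y, z + α/2) - l(y, z - α/2))`; at `z = 1` the loss is extended beyond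
`[0,1]` by its value at the endpoint. -/
noncomputable def costFun (l : ℝ → ℝ → ℝ) (N : ℕ) (y z : ℝ) : ℝ :=
  N * (l y (min (z + 1 / (2 * (N : ℝ))) 1) - l y (z - 1 / (2 * (N : ℝ))))

/-- A data set of triples (features, attribute, (pseudo-)outcome). -/
abbrev Data (𝒳 : Type*) (n : ℕ) := Fin n → 𝒳 × Fin 2 × ℝ

section Empirical

variable {𝒳 : Type*} {n : ℕ}

/-- The oracle training data `(Xᵢ, Aᵢ, μ(Xᵢ))`. -/
def oracleData (μ : 𝒳 → ℝ) (s : Fin n → Unit4 𝒳) : Data 𝒳 n :=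
  fun i => ((s i).feat, (s i).attr, μ (s i).feat)

/-- The number of units of the sample in `{A ∈ attrs}`. -/
def groupCount (e : GroupEvent) (s : Fin n → Unit4 𝒳) : ℕ :=
  (Finset.univ.filter fun i => (s i).attr ∈ e.attrs).card

/-- `E_{Z_α} h_f(x, Z_α)`, the average over the grid `{1/N, …, N/N}`. -/
noncomputable def gridThr (N : ℕ) (f : 𝒳 → ℝ) (x : 𝒳) : ℝ :=
  (∑ j ∈ Finset.Icc 1 N, thr f x ((j : ℝ) / N)) / N

/-- The weight `1{Aᵢ ∈ attrs} g(yᵢ)`. -/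
def obsWeight (e : GroupEvent) (r : 𝒳 × Fin 2 × ℝ) : ℝ :=
  if r.2.1 ∈ e.attrs then e.label.weight r.2.2 else 0

/-- The empirical disparity of `h_f`:
`∑ₐ βₐ Ê[1{A ∈ attrsₐ} gₐ(y) h_f(X, Z_α)] / Ê[1{A ∈ attrsₐ} gₐ(y)]`. -/
noncomputable def empDisparity (β : Fin 2 → ℝ) (ev : Fin 2 → GroupEvent) (N : ℕ)
    (d : Data 𝒳 n) (f : 𝒳 → ℝ) : ℝ :=
  ∑ a, β a * ((∑ i, obsWeight (ev a) (d i) * gridThr N f (d i).1) / ∑ i, obsWeight (ev a) (d i))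

/-- The empirical cost of `h_f`: `Ê[c(y̲, Z_α) h_f(X, Z_α)]`. -/
noncomputable def empCost (l : ℝ → ℝ → ℝ) (N : ℕ) (T : Finset ℝ)
    (d : Data 𝒳 n) (f : 𝒳 → ℝ) : ℝ :=
  (∑ i, (∑ j ∈ Finset.Icc 1 N,
    costFun l N (roundOut N T (d i).2.2) ((j : ℝ) / N) * thr f (d i).1 ((j : ℝ) / N)) / N) / n

/-- `ĉ₀ = Ê[l(y̲, α/2)]`. -/
noncomputable def empConst (l : ℝ → ℝ → ℝ) (N : ℕ) (T : Finset ℝ) (d : Data 𝒳 n) : ℝ :=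
  (∑ i, l (roundOut N T (d i).2.2) (1 / (2 * (N : ℝ)))) / n

end Empirical

/-! ### The exponentiated gradient algorithm

Classifiers `h_f` are represented by the functions `f` they come from, so that distributions over
classifiers are directly distributions over prediction functions. -/

/-- The input of the algorithm: empirical disparity and cost of every classifier, empirical
tolerance `ε̂`, dual bound `B_λ`, accuracy `ν`, learning rate `η`, and the range
`|β₀| + |β₁|` of the disparity. -/
structure EGInput (ι : Type*) where
  disp : ι → ℝ
  cost : ι → ℝ
  tol : ℝ
  bound : ℝ
  acc : ℝ
  rate : ℝ
  range : ℝ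

namespace EGInput

variable {ι : Type*} (I : EGInput ι)

/-- The Lagrangian `L(Q, λ) = disp(Q) + λ (cost(Q) - ε̂)`. -/
noncomputable def lagrangian (Q : PMF ι) (lam : ℝ) : ℝ :=
  avg Q I.disp + lam * (avg Q I.cost - I.tol)

/-- `best` is an exact best response of the `Q`-player (a cost-sensitive classification oracle). -/
def IsBestResponse (best : ℝ → ι) : Prop :=
  ∀ lam ∈ Set.Icc 0 I.bound, ∀ i : ι,
    I.disp (best lam) + lam * (I.cost (best lam) - I.tol) ≤ I.disp i + lam * (I.cost i - I.tol)

/-- `λ = B_λ exp(θ) / (1 + exp(θ))`. -/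
noncomputable def dualOf (th : ℝ) : ℝ := I.bound * (Real.exp th / (1 + Real.exp th))

/-- The best response of the `λ`-player. -/
noncomputable def bestDual (Q : PMF ι) : ℝ :=
  if avg Q I.cost - I.tol ≤ 0 then 0 else I.bound

variable (best : ℝ → ι)

/-- `θ_{t+1}`, where `θ₁ = 0` and `θ_{t+1} = θ_t + η (cost(h_t) - ε̂)`. -/
noncomputable def theta : ℕ → ℝ
  | 0 => 0
  | t + 1 => theta t + I.rate * (I.cost (best (I.dualOf (theta t))) - I.tol)

/-- The dual iterate `λ_{t+1}`. -/
noncomputable def dual (t : ℕ) : ℝ := I.dualOf (I.theta best t)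

/-- The primal iterate `h_{t+1}`. -/
noncomputable def primal (t : ℕ) : ι := best (I.dual best t)

/-- The uniform distribution on the first `t + 1` primal iterates. -/
noncomputable def avgPrimal (t : ℕ) : PMF ι :=
  (PMF.uniformOfFintype (Fin (t + 1))).map fun s => I.primal best s

/-- The average of the first `t + 1` dual iterates. -/
noncomputable def avgDual (t : ℕ) : ℝ :=
  (∑ s ∈ Finset.range (t + 1), I.dual best s) / ((t : ℝ) + 1)

/-- The saddle point gap `ν_{t+1}`. -/
noncomputable def gap (t : ℕ) : ℝ :=
  max (I.lagrangian (I.avgPrimal best t) (I.avgDual best t)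
        - I.lagrangian (PMF.pure (best (I.avgDual best t))) (I.avgDual best t))
      (I.lagrangian (I.avgPrimal best t) (I.bestDual (I.avgPrimal best t))
        - I.lagrangian (I.avgPrimal best t) (I.avgDual best t))

/-- The algorithm stops in iteration `t + 1`: this is the first one whose gap is at most `ν`. -/
def StopsAt (t : ℕ) : Prop := IsLeast {t : ℕ | I.gap best t ≤ I.acc} t

open Classical in
/-- What the algorithm returns when it stops in iteration `t + 1`; `none` stands for `null`. -/
noncomputable def returned (t : ℕ) : Option (PMF ι) :=
  if avg (I.avgPrimal best t) I.cost ≤ I.tol + (I.range + 2 * I.acc) / I.bound then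
    some (I.avgPrimal best t)
  else none

end EGInput

/-- The algorithm's input for the data set `d`: empirical disparity and cost, tolerance
`ε̂ = ε - ĉ₀ + C' n^{-φ} + C'' n^{-1/2}`, dual bound `B`, accuracy `ν` and learning rate
`η = ν / (2 ρ² B)`, where `ρ = sup_f |ĉost(h_f) - ε̂|`. -/
noncomputable def egInput {𝒳 : Type*} {n : ℕ} (F : Set (𝒳 → ℝ)) (β : Fin 2 → ℝ)
    (ev : Fin 2 → GroupEvent) (l : ℝ → ℝ → ℝ) (N : ℕ) (T : Finset ℝ)
    (φ ε C' C'' B ν : ℝ) (d : Data 𝒳 n) : EGInput F :=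
  let tol := ε - empConst l N T d + C' * (n : ℝ) ^ (-φ) + C'' * (n : ℝ) ^ (-(1 / 2) : ℝ)
  { disp := fun f => empDisparity β ev N d f
    cost := fun f => empCost l N T d f
    tol := tol
    bound := B
    acc := ν
    rate := ν / (2 * (⨆ f : F, |empCost l N T d f - tol|) ^ 2 * B)
    range := |β 0| + |β 1| }

/-- The factor `K (1 + ln n + ln(1/δ))^k` that the notation `Õ` hides. -/
noncomputable def polylog (K : ℝ) (k n : ℕ) (δ : ℝ) : ℝ :=
  K * (1 + Real.log n + Real.log (1 / δ)) ^ k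

/-! ### Averages under discrete distributions -/

section Avg

variable {ι : Type*} (Q : PMF ι)

/-! The proof combines three ingredients: the empirical game is solved on every sample, it is
uniformly close to the population problem with high probability, and population disparities are
functionals of the outcome regression.

The game. The dual player runs exponential weights on the two vertices `0` and `B` of the dual
interval. The potential `log (1 + exp θ)` has the dual fraction as its derivative and dominates both
`0` and `θ`, so a single potential inequality (`softplus_add_le`, `EGInput.softplus_theta_le`)
controls the regret against both vertices, hence against the whole interval. Since the primal player
best-responds, the saddle point gap is at most this regret (`EGInput.gap_le_of_regret`), which falls
below `ν` after order `ρ² B² / ν²` rounds, that is, order `n ^ (4φ)` (`EGInput.exists_stopsAt`). At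
such a point the disparity exceeds that of any empirically feasible `Q` by at most `2ν`, and if such
a `Q` exists, the violation is at most `(|β₀| + |β₁| + 2ν) / B` (`EGInput.le_of_gap_le`). A larger
violation, the `null` case, therefore certifies infeasibility.

The sample. Costs are scaled increments of the loss along the grid, so they telescope: empirical
cost plus constant is the mean loss at rounded arguments, within `1/N` of the true loss pointwise
(`layered_loss`, `abs_midLoss_sub_le`). This loss, and the numerators and denominators of the group
means, are all averages over levels of `b + c h` with `h` a threshold classifier and `|c| ≤ 1`. One
deviation theorem covers them (`measure_exists_deviation_le`): a ghost sample and random signs bring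
in the Rademacher complexity, contraction removes `c`, McDiarmid's inequality on the doubled sample
gives exponential moments, and convexity of `exp` removes the average over levels without a union
bound over them. On the resulting event `GoodSample` the argument is deterministic
(`GoodSample.guarantee`): the slack in `ε̂` makes every feasible `Q` empirically feasible, and the
remaining deviations enter only the rates. That the slack suffices is where `n` must be large
(`exists_forall_deviation_le_tolerance`).

The population. Conditional independence and the tower property turn integrals over a conditioning
event into integrals weighted by `g(μ(X))` (`setIntegral_toSet`, `identification`). For convex
losses, conditional Jensen compares the two notions of loss after rounding the prediction to
finitely many values (`lossReg_le_loss`). -/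

lemma PMF.summable_toReal : Summable fun i => (Q i).toReal :=
  ENNReal.summable_toReal (by rw [Q.tsum_coe]; exact ENNReal.one_ne_top)

lemma PMF.tsum_toReal : ∑' i, (Q i).toReal = 1 := by
  rw [← ENNReal.tsum_toReal_eq (fun i => Q.apply_ne_top i), Q.tsum_coe, ENNReal.toReal_one]

lemma summable_avg {v : ι → ℝ} {b : ℝ} (hv : ∀ i, |v i| ≤ b) :
    Summable fun i => (Q i).toReal * v i := by
  refine Summable.of_norm_bounded (Q.summable_toReal.mul_right b) fun i => ?_
  rw [Real.norm_eq_abs, abs_mul, abs_of_nonneg ENNReal.toReal_nonneg]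
  exact mul_le_mul_of_nonneg_left (hv i) ENNReal.toReal_nonneg

lemma avg_const (c : ℝ) : avg Q (fun _ => c) = c := by
  rw [avg, tsum_mul_right, Q.tsum_toReal, one_mul]

lemma avg_mono {v w : ι → ℝ} {b b' : ℝ} (hv : ∀ i, |v i| ≤ b) (hw : ∀ i, |w i| ≤ b')
    (h : ∀ i, v i ≤ w i) : avg Q v ≤ avg Q w :=
  (summable_avg Q hv).tsum_le_tsum (fun i => mul_le_mul_of_nonneg_left (h i) ENNReal.toReal_nonneg)
    (summable_avg Q hw)

lemma avg_add {v w : ι → ℝ} {b b' : ℝ} (hv : ∀ i, |v i| ≤ b) (hw : ∀ i, |w i| ≤ b') :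
    avg Q (fun i => v i + w i) = avg Q v + avg Q w := by
  rw [avg, avg, avg, ← (summable_avg Q hv).tsum_add (summable_avg Q hw)]
  exact tsum_congr fun i => by ring

lemma avg_mul_left (c : ℝ) (v : ι → ℝ) : avg Q (fun i => c * v i) = c * avg Q v := by
  rw [avg, avg, ← tsum_mul_left]
  exact tsum_congr fun i => by ring

lemma avg_pure (i : ι) (v : ι → ℝ) : avg (PMF.pure i) v = v i := by
  rw [avg, tsum_eq_single i]
  · simp
  · intro j hj
    simp [PMF.pure_apply, hj]

/-- If `v ≤ w + c` pointwise, then the averages compare likewise. -/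
lemma avg_le_avg_add {v w : ι → ℝ} {b b' c : ℝ} (hv : ∀ i, |v i| ≤ b) (hw : ∀ i, |w i| ≤ b')
    (h : ∀ i, v i ≤ w i + c) : avg Q v ≤ avg Q w + c := by
  have hc : ∀ _ : ι, |c| ≤ |c| := fun _ => le_rfl
  rw [← avg_const Q c, ← avg_add Q hw hc]
  exact avg_mono Q hv (b' := b' + |c|) (fun i => (abs_add_le _ _).trans (add_le_add (hw i) le_rfl)) h

/-- As `g` may repeat values, the mass at `i` is written as a sum of indicators over `κ`; exchanging
this finite sum with the series leaves one term per element of `κ`. -/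
lemma avg_map_uniformOfFintype {κ : Type*} [Fintype κ] [Nonempty κ] (g : κ → ι) (v : ι → ℝ) :
    avg ((PMF.uniformOfFintype κ).map g) v = (∑ s, v (g s)) / Fintype.card κ := by
  classical
  have h : ∀ i, (((PMF.uniformOfFintype κ).map g) i).toReal
      = ∑ s, if i = g s then (Fintype.card κ : ℝ)⁻¹ else 0 := by
    intro i
    rw [PMF.map_apply, tsum_fintype, ENNReal.toReal_sum]
    · refine Finset.sum_congr rfl fun s _ => ?_
      split_ifs with hs
      · rw [PMF.uniformOfFintype_apply, ENNReal.toReal_inv, ENNReal.toReal_natCast]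
      · simp
    · intro s _
      split_ifs
      · exact PMF.apply_ne_top _ _
      · simp
  have h2 : ∀ i, (((PMF.uniformOfFintype κ).map g) i).toReal * v i
      = ∑ s, if i = g s then (Fintype.card κ : ℝ)⁻¹ * v (g s) else 0 := by
    intro i
    rw [h, Finset.sum_mul]
    refine Finset.sum_congr rfl fun s _ => ?_
    split_ifs with hs
    · rw [hs]
    · simp
  rw [avg, tsum_congr h2, Summable.tsum_finsetSum]
  · simp only [tsum_ite_eq]
    rw [← Finset.mul_sum, div_eq_inv_mul]
  · intro s _
    exact (hasSum_ite_eq (g s) _).summable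

end Avg

/-! ### The exponentiated gradient algorithm -/

/-- For `|x| ≤ 1` the Taylor remainder is at most `x²` and `1 + x² ≤ exp (x²)`. Otherwise `|x| ≤
x²`: this suffices directly for positive `x`, and for negative `x` because `exp x ≤ 1 ≤ x + 1 + x²`.
-/
lemma Real.exp_le_add_exp_sq (x : ℝ) : Real.exp x ≤ x + Real.exp (x ^ 2) := by
  have h2 := Real.add_one_le_exp (x ^ 2)
  rcases le_total |x| 1 with h | h
  · have := (abs_le.1 (Real.abs_exp_sub_one_sub_id_le h)).2
    linarith
  · rcases le_total 0 x with hx | hx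
    · rw [abs_of_nonneg hx] at h
      have : Real.exp x ≤ Real.exp (x ^ 2) := Real.exp_le_exp.2 (by nlinarith)
      linarith
    · rw [abs_of_nonpos hx] at h
      have : Real.exp x ≤ 1 := Real.exp_le_one_iff.2 hx
      nlinarith

/-- The softplus function grows at most like its tangent plus a quadratic. -/
lemma softplus_add_le (th x : ℝ) :
    Real.log (1 + Real.exp (th + x)) ≤
      Real.log (1 + Real.exp th) + Real.exp th / (1 + Real.exp th) * x + x ^ 2 := by
  set e := Real.exp th with he
  have hepos : 0 < e := Real.exp_pos th
  set p := e / (1 + e) with hp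
  have hp0 : 0 ≤ p := by positivity
  have hp1 : p ≤ 1 := by rw [hp, div_le_one (by positivity)]; linarith
  -- The left side is the moment generating function of a Bernoulli variable with mean `p`. After
  -- centring, the linear terms of the bounds at `(1 - p) x` and `-p x` cancel.
  have key : 1 - p + p * Real.exp x ≤ Real.exp (p * x + x ^ 2) := by
    have h1 := Real.exp_le_add_exp_sq ((1 - p) * x)
    have h2 := Real.exp_le_add_exp_sq (-p * x)
    have h3 : Real.exp (((1 - p) * x) ^ 2) ≤ Real.exp (x ^ 2) := by
      apply Real.exp_le_exp.2
      rw [mul_pow]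
      exact mul_le_of_le_one_left (sq_nonneg x) (by nlinarith)
    have h4 : Real.exp ((-p * x) ^ 2) ≤ Real.exp (x ^ 2) := by
      apply Real.exp_le_exp.2
      rw [mul_pow]
      exact mul_le_of_le_one_left (sq_nonneg x) (by nlinarith)
    have h5 : (1 - p) * Real.exp (-p * x) + p * Real.exp ((1 - p) * x) ≤ Real.exp (x ^ 2) := by
      nlinarith [mul_le_mul_of_nonneg_left (h1.trans (add_le_add le_rfl h3)) hp0,
        mul_le_mul_of_nonneg_left (h2.trans (add_le_add le_rfl h4)) (sub_nonneg.2 hp1)]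
    have h6 : 1 - p + p * Real.exp x
        = Real.exp (p * x) * ((1 - p) * Real.exp (-p * x) + p * Real.exp ((1 - p) * x)) := by
      have e1 : Real.exp (p * x) * Real.exp (-p * x) = 1 := by
        rw [← Real.exp_add]; simp
      have e2 : Real.exp (p * x) * Real.exp ((1 - p) * x) = Real.exp x := by
        rw [← Real.exp_add]; congr 1; ring
      linear_combination (-(1 - p)) * e1 - p * e2
    rw [h6, Real.exp_add]
    exact mul_le_mul_of_nonneg_left h5 (Real.exp_pos _).le
  have hsplit : 1 + Real.exp (th + x) = (1 + e) * (1 - p + p * Real.exp x) := by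
    rw [Real.exp_add, ← he, hp]
    field_simp
    ring
  have hpos : 0 < 1 - p + p * Real.exp x := by
    have : 0 < 1 + Real.exp (th + x) := by positivity
    rw [hsplit] at this
    exact pos_of_mul_pos_right this (by positivity)
  rw [hsplit, Real.log_mul (by positivity) hpos.ne', add_assoc]
  refine add_le_add le_rfl ?_
  rw [Real.log_le_iff_le_exp hpos]
  exact key

namespace EGInput

variable {ι : Type*} (I : EGInput ι) (best : ℝ → ι)

/-- The constraint violation of the `t`-th primal iterate. -/
noncomputable def slack (t : ℕ) : ℝ := I.cost (I.primal best t) - I.tol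

lemma theta_succ (t : ℕ) :
    I.theta best (t + 1) = I.theta best t + I.rate * I.slack best t := rfl

lemma theta_eq_sum (t : ℕ) :
    I.theta best t = I.rate * ∑ s ∈ Finset.range t, I.slack best s := by
  induction t with
  | zero => simp [theta]
  | succ t ih => rw [theta_succ, ih, Finset.sum_range_succ]; ring

/-- The dual iterate as a fraction of its bound. -/
noncomputable def dualFrac (t : ℕ) : ℝ :=
  Real.exp (I.theta best t) / (1 + Real.exp (I.theta best t))

lemma dual_eq (t : ℕ) : I.dual best t = I.bound * I.dualFrac best t := rfl

lemma dual_mem (hB : 0 ≤ I.bound) (t : ℕ) : I.dual best t ∈ Set.Icc 0 I.bound := by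
  have h0 : 0 ≤ I.dualFrac best t := by unfold dualFrac; positivity
  have h1 : I.dualFrac best t ≤ 1 := by
    unfold dualFrac
    rw [div_le_one (by positivity)]
    linarith
  rw [dual_eq]
  exact ⟨mul_nonneg hB h0, mul_le_of_le_one_right hB h1⟩

lemma avgDual_mem (hB : 0 ≤ I.bound) (t : ℕ) : I.avgDual best t ∈ Set.Icc 0 I.bound := by
  unfold avgDual
  have hpos : (0 : ℝ) < t + 1 := by positivity
  constructor
  · exact div_nonneg (Finset.sum_nonneg fun s _ => (I.dual_mem best hB s).1) hpos.le
  · rw [div_le_iff₀ hpos]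
    calc _ ≤ ∑ s ∈ Finset.range (t + 1), I.bound :=
          Finset.sum_le_sum fun s _ => (I.dual_mem best hB s).2
      _ = _ := by simp; ring

lemma avg_avgPrimal (v : ι → ℝ) (t : ℕ) :
    avg (I.avgPrimal best t) v
      = (∑ s ∈ Finset.range (t + 1), v (I.primal best s)) / ((t : ℝ) + 1) := by
  change avg (PMF.map (fun s : ℕ => I.primal best s)
    (PMF.map (fun a : Fin (t + 1) => (a : ℕ)) (PMF.uniformOfFintype (Fin (t + 1))))) v = _
  rw [PMF.map_comp, avg_map_uniformOfFintype, Finset.sum_range]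
  simp

lemma avg_avgPrimal_cost (t : ℕ) :
    avg (I.avgPrimal best t) I.cost - I.tol
      = (∑ s ∈ Finset.range (t + 1), I.slack best s) / ((t : ℝ) + 1) := by
  have hpos : (0 : ℝ) < t + 1 := by positivity
  rw [avg_avgPrimal]
  unfold slack
  rw [Finset.sum_sub_distrib]
  simp
  field_simp

/-- The potential inequality for the dual iterates. -/
lemma softplus_theta_le {r : ℝ} (hr : ∀ i, |I.cost i - I.tol| ≤ r) (t : ℕ) :
    Real.log (1 + Real.exp (I.theta best t)) ≤ Real.log 2
      + I.rate * ∑ s ∈ Finset.range t, I.dualFrac best s * I.slack best s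
      + t * (I.rate * r) ^ 2 := by
  induction t with
  | zero => simp [theta, one_add_one_eq_two]
  | succ t ih =>
    rw [theta_succ]
    refine (softplus_add_le _ _).trans ?_
    have h2 : (I.rate * I.slack best t) ^ 2 ≤ (I.rate * r) ^ 2 := by
      rw [mul_pow, mul_pow]
      exact mul_le_mul_of_nonneg_left (sq_le_sq' (abs_le.1 (hr _)).1 (abs_le.1 (hr _)).2)
        (sq_nonneg _)
    rw [Finset.sum_range_succ]
    have h3 : Real.exp (I.theta best t) / (1 + Real.exp (I.theta best t)) = I.dualFrac best t := rfl
    rw [h3]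
    push_cast
    nlinarith

/-- The value of the game played so far: `∑ L(f_s, λ_s)`. -/
noncomputable def payoff (t : ℕ) : ℝ :=
  (∑ s ∈ Finset.range (t + 1),
    (I.disp (I.primal best s) + I.dual best s * I.slack best s)) / ((t : ℝ) + 1)

lemma lagrangian_avgPrimal (t : ℕ) (lam : ℝ) :
    I.lagrangian (I.avgPrimal best t) lam
      = (∑ s ∈ Finset.range (t + 1), (I.disp (I.primal best s) + lam * I.slack best s))
        / ((t : ℝ) + 1) := by
  rw [lagrangian, avg_avgPrimal_cost, avg_avgPrimal, Finset.sum_add_distrib, ← Finset.mul_sum]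
  ring

variable {best}

/-- Each iterate is optimal against its own dual value, and the Lagrangian of a fixed `i` is affine
in the dual variable, so the average over rounds is its value at the average dual. -/
lemma payoff_le (hbest : I.IsBestResponse best) (hB : 0 ≤ I.bound) (t : ℕ) (i : ι) :
    I.payoff best t ≤ I.disp i + I.avgDual best t * (I.cost i - I.tol) := by
  have hpos : (0 : ℝ) < t + 1 := by positivity
  have : I.disp i + I.avgDual best t * (I.cost i - I.tol)
      = (∑ s ∈ Finset.range (t + 1), (I.disp i + I.dual best s * (I.cost i - I.tol)))
        / ((t : ℝ) + 1) := by
    rw [avgDual, Finset.sum_add_distrib, ← Finset.sum_mul]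
    simp
    field_simp
  rw [this, payoff]
  exact div_le_div_of_nonneg_right
    (Finset.sum_le_sum fun s _ => hbest _ (I.dual_mem best hB s) i) hpos.le

lemma payoff_le_lagrangian (hbest : I.IsBestResponse best) (hB : 0 ≤ I.bound) (t : ℕ) :
    I.payoff best t ≤ I.lagrangian (I.avgPrimal best t) (I.avgDual best t) := by
  have hpos : (0 : ℝ) < t + 1 := by positivity
  rw [lagrangian_avgPrimal, le_div_iff₀ hpos]
  calc _ = ∑ s ∈ Finset.range (t + 1), I.payoff best t := by simp; ring
    _ ≤ _ := Finset.sum_le_sum fun s _ => I.payoff_le hbest hB t _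

/-- The gap is at most the regret of the dual player. -/
lemma gap_le_of_regret (hbest : I.IsBestResponse best) (hB : 0 ≤ I.bound) {t : ℕ} {d : ℝ}
    (h0 : I.lagrangian (I.avgPrimal best t) 0 ≤ I.payoff best t + d)
    (h1 : I.lagrangian (I.avgPrimal best t) I.bound ≤ I.payoff best t + d) :
    I.gap best t ≤ d := by
  have hmem := I.avgDual_mem best hB t
  have hp := I.payoff_le hbest hB t (best (I.avgDual best t))
  have hl := I.payoff_le_lagrangian hbest hB t
  have hbd : I.lagrangian (I.avgPrimal best t) (I.bestDual (I.avgPrimal best t))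
      ≤ I.payoff best t + d := by
    unfold bestDual
    split_ifs <;> assumption
  -- The Lagrangian is affine in the dual variable, so its maximum over the interval sits at the
  -- vertex selected by the sign of the violation.
  have hle : I.lagrangian (I.avgPrimal best t) (I.avgDual best t)
      ≤ I.lagrangian (I.avgPrimal best t) (I.bestDual (I.avgPrimal best t)) := by
    unfold lagrangian bestDual
    split_ifs with h
    · nlinarith [hmem.1]
    · nlinarith [hmem.2]
  unfold gap
  refine max_le ?_ ?_
  · have : I.lagrangian (PMF.pure (best (I.avgDual best t))) (I.avgDual best t)
        = I.disp (best (I.avgDual best t))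
          + I.avgDual best t * (I.cost (best (I.avgDual best t)) - I.tol) := by
      rw [lagrangian, avg_pure, avg_pure]
    rw [this]
    linarith
  · linarith

/-- This covers `ρ = 0`, where the learning rate has a vanishing denominator: the dual variable is
then irrelevant to the payoff and there is no regret. -/
lemma gap_le_of_slack_eq_zero (hbest : I.IsBestResponse best) (hB : 0 ≤ I.bound)
    (h : ∀ i, I.cost i - I.tol = 0) (t : ℕ) : I.gap best t ≤ 0 := by
  refine I.gap_le_of_regret hbest hB ?_ ?_ <;>
  · rw [lagrangian_avgPrimal, payoff, add_zero]
    simp [slack, h]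

/-- The dual player's regret after sufficiently many iterations. -/
lemma gap_le_acc (hbest : I.IsBestResponse best) (hB : 0 < I.bound) (hν : 0 < I.acc) {r : ℝ}
    (hr0 : 0 < r) (hr : ∀ i, |I.cost i - I.tol| ≤ r)
    (hrate : I.rate = I.acc / (2 * r ^ 2 * I.bound)) {t : ℕ}
    (ht : 4 * r ^ 2 * I.bound ^ 2 / I.acc ^ 2 ≤ (t : ℝ) + 1) : I.gap best t ≤ I.acc := by
  have hpos : (0 : ℝ) < t + 1 := by positivity
  have hη : 0 < I.rate := by rw [hrate]; positivity
  have hsoft := I.softplus_theta_le best hr (t + 1)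
  have hlog2 : Real.log 2 ≤ 1 := by linarith [Real.log_two_lt_d9]
  have hbound : I.rate * r ^ 2 * I.bound = I.acc / 2 := by
    rw [hrate]; field_simp
  -- The threshold on `t` is chosen so that the initial potential `log 2 ≤ 1`, rescaled by `B / η`,
  -- uses half of the allowed regret; the quadratic terms use the other half by `hbound`.
  have hinit : I.bound / I.rate ≤ ((t : ℝ) + 1) * (I.acc / 2) := by
    have : I.bound / I.rate = 4 * r ^ 2 * I.bound ^ 2 / I.acc ^ 2 * (I.acc / 2) := by
      rw [hrate]; field_simp; ring
    rw [this]
    exact mul_le_mul_of_nonneg_right ht (by positivity)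
  set D := ∑ s ∈ Finset.range (t + 1), I.dualFrac best s * I.slack best s with hD
  have hpay : I.payoff best t
      = (∑ s ∈ Finset.range (t + 1), I.disp (I.primal best s) + I.bound * D) / ((t : ℝ) + 1) := by
    rw [payoff, Finset.sum_add_distrib, hD, Finset.mul_sum]
    congr 2
    exact Finset.sum_congr rfl fun s _ => by rw [dual_eq]; ring
  -- Used with `x = 0` for the vertex `0` and with `x = θ` for the vertex `B`, since `(B / η) θ` is
  -- `B` times the total violation.
  have hlower : ∀ x : ℝ, x ≤ Real.log (1 + Real.exp (I.theta best (t + 1))) →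
      I.bound / I.rate * x ≤ I.bound * D + ((t : ℝ) + 1) * I.acc := by
    intro x hx
    have h1 : x ≤ 1 + I.rate * D + ((t : ℝ) + 1) * (I.rate * r) ^ 2 := by
      have := hx.trans hsoft
      push_cast at this
      linarith
    have h2 : I.bound / I.rate * (1 + I.rate * D + ((t : ℝ) + 1) * (I.rate * r) ^ 2)
        = I.bound / I.rate + I.bound * D + ((t : ℝ) + 1) * (I.rate * r ^ 2 * I.bound) := by
      field_simp
    calc _ ≤ I.bound / I.rate * (1 + I.rate * D + ((t : ℝ) + 1) * (I.rate * r) ^ 2) :=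
          mul_le_mul_of_nonneg_left h1 (by positivity)
      _ ≤ _ := by rw [h2, hbound]; linarith
  refine I.gap_le_of_regret hbest hB.le ?_ ?_
  · have h := hlower 0 (Real.log_nonneg (by linarith [Real.exp_pos (I.theta best (t + 1))]))
    rw [lagrangian_avgPrimal, hpay, div_add' _ _ _ hpos.ne']
    refine div_le_div_of_nonneg_right ?_ hpos.le
    simp only [zero_mul, add_zero]
    linarith
  · have h := hlower (I.theta best (t + 1)) (by
      rw [Real.le_log_iff_exp_le (by positivity)]; linarith)
    rw [theta_eq_sum, ← mul_assoc, div_mul_cancel₀ _ hη.ne'] at h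
    rw [lagrangian_avgPrimal, hpay, div_add' _ _ _ hpos.ne', Finset.sum_add_distrib,
      ← Finset.mul_sum]
    refine div_le_div_of_nonneg_right ?_ hpos.le
    linarith

/-- The algorithm stops, with an explicit bound on the number of iterations. -/
lemma exists_stopsAt (hbest : I.IsBestResponse best) (hB : 0 < I.bound) (hν : 0 < I.acc) {r r' : ℝ}
    (hr0 : 0 ≤ r) (hr : ∀ i, |I.cost i - I.tol| ≤ r) (hrr : r ≤ r')
    (hrate : I.rate = I.acc / (2 * r ^ 2 * I.bound)) :
    ∃ t : ℕ, I.StopsAt best t ∧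
      (t : ℝ) + 1 ≤ 4 * r' ^ 2 * I.bound ^ 2 / I.acc ^ 2 + 2 := by
  classical
  have hex : ∃ t : ℕ, I.gap best t ≤ I.acc ∧
      (t : ℝ) + 1 ≤ 4 * r' ^ 2 * I.bound ^ 2 / I.acc ^ 2 + 2 := by
    -- If `ρ = 0` the first iteration already stops. Otherwise the round index is a ceiling;
    -- rounding up and counting from zero each cost one, whence `+ 2`.
    rcases hr0.eq_or_lt with h | h
    · refine ⟨0, (I.gap_le_of_slack_eq_zero hbest hB.le (fun i => ?_) 0).trans hν.le, ?_⟩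
      · exact abs_nonpos_iff.1 ((hr i).trans h.ge)
      · have : 0 ≤ 4 * r' ^ 2 * I.bound ^ 2 / I.acc ^ 2 := by positivity
        push_cast
        linarith
    · refine ⟨⌈4 * r ^ 2 * I.bound ^ 2 / I.acc ^ 2⌉₊, I.gap_le_acc hbest hB hν h hr hrate ?_, ?_⟩
      · linarith [Nat.le_ceil (4 * r ^ 2 * I.bound ^ 2 / I.acc ^ 2)]
      · have h1 : (⌈4 * r ^ 2 * I.bound ^ 2 / I.acc ^ 2⌉₊ : ℝ)
            < 4 * r ^ 2 * I.bound ^ 2 / I.acc ^ 2 + 1 := Nat.ceil_lt_add_one (by positivity)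
        have h2 : 4 * r ^ 2 * I.bound ^ 2 / I.acc ^ 2 ≤ 4 * r' ^ 2 * I.bound ^ 2 / I.acc ^ 2 := by
          gcongr
        linarith
  obtain ⟨t, ht, hle⟩ := hex
  have hne : ∃ t : ℕ, I.gap best t ≤ I.acc := ⟨t, ht⟩
  refine ⟨Nat.find hne, ⟨Nat.find_spec hne, fun s hs => Nat.find_min' hne hs⟩, ?_⟩
  have : ((Nat.find hne : ℕ) : ℝ) ≤ t := by exact_mod_cast Nat.find_min' hne ht
  linarith

/-- Comparison of the algorithm's iterate with an empirically feasible distribution. -/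
lemma le_of_gap_le (hbest : I.IsBestResponse best) (hB : 0 ≤ I.bound) {t : ℕ}
    (hgap : I.gap best t ≤ I.acc) {b b' : ℝ} (hdisp : ∀ i, |I.disp i| ≤ b)
    (hcost : ∀ i, |I.cost i| ≤ b') (Q : PMF ι) (hQ : avg Q I.cost ≤ I.tol) :
    avg (I.avgPrimal best t) I.disp ≤ avg Q I.disp + 2 * I.acc ∧
      avg (I.avgPrimal best t) I.disp + I.bound * (avg (I.avgPrimal best t) I.cost - I.tol)
        ≤ avg Q I.disp + 2 * I.acc := by
  have hmem := I.avgDual_mem best hB t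
  set lam := I.avgDual best t with hlam
  have h1 := (le_max_left _ _).trans hgap
  have h2 := (le_max_right _ _).trans hgap
  -- The best response beats `Q` on average at this dual value, and the penalty of an empirically
  -- feasible `Q` is nonpositive because `lam ≥ 0`.
  have h3 : I.lagrangian (PMF.pure (best lam)) lam ≤ avg Q I.disp := by
    have h4 : avg Q (fun _ : ι => I.lagrangian (PMF.pure (best lam)) lam)
        ≤ avg Q (fun i => I.disp i + lam * (I.cost i + -I.tol)) := by
      refine avg_mono Q (b := |I.lagrangian (PMF.pure (best lam)) lam|)
        (b' := b + |lam| * (b' + |I.tol|)) (fun _ => le_rfl) (fun i => ?_) fun i => ?_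
      · refine (abs_add_le _ _).trans (add_le_add (hdisp i) ?_)
        rw [abs_mul]
        refine mul_le_mul_of_nonneg_left ((abs_add_le _ _).trans ?_) (abs_nonneg _)
        rw [abs_neg]
        exact add_le_add (hcost i) le_rfl
      · rw [lagrangian, avg_pure, avg_pure]
        exact hbest lam hmem i
    have h5 : ∀ i, |I.cost i + -I.tol| ≤ b' + |I.tol| := fun i =>
      (abs_add_le _ _).trans (by rw [abs_neg]; exact add_le_add (hcost i) le_rfl)
    rw [avg_const, avg_add Q hdisp (b' := |lam| * (b' + |I.tol|))
      (fun i => by rw [abs_mul]; exact mul_le_mul_of_nonneg_left (h5 i) (abs_nonneg _)),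
      avg_mul_left, avg_add Q hcost (fun _ => le_rfl), avg_const] at h4
    nlinarith [hmem.1]
  rw [← hlam] at h1 h2
  have h6 : I.lagrangian (I.avgPrimal best t) (I.bestDual (I.avgPrimal best t))
      ≤ avg Q I.disp + 2 * I.acc := by linarith
  unfold lagrangian bestDual at h6
  -- One of the two claims is the bound itself; the other follows from it because the sign of the
  -- violation is known in each branch.
  split_ifs at h6 with h
  · exact ⟨by linarith, by nlinarith⟩
  · push Not at h
    exact ⟨by nlinarith, h6⟩

end EGInput

/-! ### McDiarmid's inequality -/

/-- A function with values within `c` of each other on a set of full measure has the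
moment generating function bound of Hoeffding's lemma. -/
lemma integral_exp_sub_mean_le {Ω : Type*} [MeasurableSpace Ω] (P : Measure Ω)
    [IsProbabilityMeasure P] {g : Ω → ℝ} {c : ℝ} (hg : AEMeasurable g P) {S : Set Ω}
    (hS : ∀ᵐ x ∂P, x ∈ S) (hosc : ∀ x ∈ S, ∀ y ∈ S, |g x - g y| ≤ c) (lam : ℝ) :
    ∫ x, Real.exp (lam * (g x - ∫ y, g y ∂P)) ∂P ≤ Real.exp (lam ^ 2 * c ^ 2 / 8) := by
  obtain ⟨x₀, hx₀⟩ := hS.exists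
  -- The interval for Hoeffding's lemma starts at the infimum over `S` alone; nothing is assumed
  -- about `g` off `S`.
  have hne : (g '' S).Nonempty := ⟨g x₀, x₀, hx₀, rfl⟩
  have hbdd : BddBelow (g '' S) := by
    refine ⟨g x₀ - c, ?_⟩
    rintro _ ⟨y, hy, rfl⟩
    linarith [(abs_le.1 (hosc x₀ hx₀ y hy)).2]
  have hmem : ∀ᵐ x ∂P, g x ∈ Set.Icc (sInf (g '' S)) (sInf (g '' S) + c) := by
    filter_upwards [hS] with x hx
    refine ⟨csInf_le hbdd ⟨x, hx, rfl⟩, ?_⟩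
    have : g x - c ≤ sInf (g '' S) := by
      refine le_csInf hne ?_
      rintro _ ⟨y, hy, rfl⟩
      linarith [(abs_le.1 (hosc x hx y hy)).2]
    linarith
  have h := (hasSubgaussianMGF_of_mem_Icc hg hmem).mgf_le lam
  refine (le_of_eq ?_).trans (h.trans (le_of_eq ?_))
  · rfl
  · congr 1
    simp only [add_sub_cancel_left, NNReal.coe_pow, NNReal.coe_div, coe_nnnorm, Real.norm_eq_abs,
      NNReal.coe_ofNat, div_pow, sq_abs]
    ring

/-- McDiarmid's inequality, as a bound on the moment generating function. The function need only
be almost everywhere measurable, but its differences are bounded everywhere. -/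
theorem integral_exp_sub_mean_le_of_bounded_differences {Ω : Type*} [MeasurableSpace Ω]
    (P : Measure Ω) [IsProbabilityMeasure P] (c lam : ℝ) :
    ∀ (m : ℕ) (f : (Fin m → Ω) → ℝ) (b : ℝ), (∀ s, |f s| ≤ b) →
      AEMeasurable f (Measure.pi fun _ => P) →
      (∀ s i x, |f (Function.update s i x) - f s| ≤ c) →
      ∫ s, Real.exp (lam * (f s - ∫ t, f t ∂(Measure.pi fun _ => P))) ∂(Measure.pi fun _ => P)
        ≤ Real.exp (m * (lam ^ 2 * c ^ 2 / 8)) := by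
  intro m
  induction m with
  | zero =>
    intro f b hb hf hd
    have h : ∀ s, f s = f default := fun s => congrArg f (Subsingleton.elim _ _)
    have h2 : ∫ t, f t ∂(Measure.pi fun _ : Fin 0 => P) = f default := by
      simp [h]
    rw [h2]
    simp [h]
  | succ m ih =>
    intro f b hb hf hd
    set π := Measure.pi fun _ : Fin m => P with hπ
    have hmp := (measurePreserving_piFinSuccAbove (fun _ : Fin (m + 1) => P) 0).symm
    set e := (MeasurableEquiv.piFinSuccAbove (fun _ : Fin (m + 1) => Ω) 0).symm with he
    have heval : ∀ (x : Ω) (s : Fin m → Ω), e (x, s) = Fin.cons x s := by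
      intro x s
      change Fin.insertNth (α := fun _ => Ω) 0 x s = _
      exact Fin.insertNth_zero' x s
    set G : Ω × (Fin m → Ω) → ℝ := fun q => f (e q) with hG
    have hGm : AEMeasurable G (P.prod π) := hf.comp_quasiMeasurePreserving hmp.quasiMeasurePreserving
    have hGb : ∀ q, |G q| ≤ b := fun q => hb _
    have hGint : Integrable G (P.prod π) :=
      Integrable.of_bound hGm.aestronglyMeasurable b (Filter.Eventually.of_forall hGb)
    -- The first coordinate is split off. The induction hypothesis treats the remaining coordinates
    -- with the first one frozen, and Hoeffding's lemma then treats the conditional mean `g`.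
    set g : Ω → ℝ := fun x => ∫ s, G (x, s) ∂π with hg
    have hgm : AEMeasurable g P := hGint.aestronglyMeasurable.integral_prod_right'.aemeasurable
    have hslice : ∀ᵐ x ∂P, AEStronglyMeasurable (fun s => G (x, s)) π :=
      hGint.aestronglyMeasurable.prodMk_left
    have hgb : ∀ x, |g x| ≤ b := fun x => by
      have := norm_integral_le_of_norm_le_const (μ := π) (f := fun s => G (x, s)) (C := b)
        (Filter.Eventually.of_forall fun s => hGb (x, s))
      simpa using this
    have htransfer : ∀ h : ℝ → ℝ, ∫ s, h (f s) ∂(Measure.pi fun _ : Fin (m + 1) => P)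
        = ∫ q, h (G q) ∂(P.prod π) := fun h => (hmp.integral_comp' (fun s => h (f s))).symm
    have hmean : ∫ t, f t ∂(Measure.pi fun _ : Fin (m + 1) => P) = ∫ x, g x ∂P := by
      rw [htransfer fun y => y, integral_prod _ hGint]
    rw [hmean, htransfer fun y => Real.exp (lam * (y - ∫ x, g x ∂P))]
    set E := ∫ x, g x ∂P with hE
    have hexpb : ∀ y z : ℝ, |y| ≤ b → |z| ≤ b →
        ‖Real.exp (lam * (y - z))‖ ≤ Real.exp (|lam| * (2 * b)) := by
      intro y z hy hz
      rw [Real.norm_eq_abs, Real.abs_exp]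
      apply Real.exp_le_exp.2
      refine (le_abs_self _).trans ?_
      rw [abs_mul]
      refine mul_le_mul_of_nonneg_left ((abs_sub _ _).trans ?_) (abs_nonneg _)
      linarith
    have hEb : |E| ≤ b := by
      have := norm_integral_le_of_norm_le_const (μ := P) (f := g) (C := b)
        (Filter.Eventually.of_forall hgb)
      simpa using this
    have hint : Integrable (fun q => Real.exp (lam * (G q - E))) (P.prod π) :=
      Integrable.of_bound (by fun_prop) _ (Filter.Eventually.of_forall fun q => hexpb _ _ (hGb q) hEb)
    rw [integral_prod _ hint]
    have hinner : ∀ᵐ x ∂P, ∫ s, Real.exp (lam * (G (x, s) - E)) ∂π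
        ≤ Real.exp (m * (lam ^ 2 * c ^ 2 / 8)) * Real.exp (lam * (g x - E)) := by
      filter_upwards [hslice] with x hx
      have h1 := ih (fun s => G (x, s)) b (fun s => hGb _) hx.aemeasurable (fun s i y => by
        have := hd (e (x, s)) i.succ y
        simp only [hG, heval] at this ⊢
        rwa [Fin.cons_update])
      have h2 : ∀ s, Real.exp (lam * (G (x, s) - E))
          = Real.exp (lam * (G (x, s) - g x)) * Real.exp (lam * (g x - E)) := fun s => by
        rw [← Real.exp_add]; congr 1; ring
      simp_rw [h2]
      rw [integral_mul_const]
      exact mul_le_mul_of_nonneg_right h1 (Real.exp_pos _).le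
    have hintg : Integrable (fun x => Real.exp (lam * (g x - E))) P :=
      Integrable.of_bound (by fun_prop) _ (Filter.Eventually.of_forall fun q => hexpb _ _ (hgb q) hEb)
    -- The set of full measure consists of the points whose slices are a.e. measurable. Elsewhere
    -- the integral defining `g` may take its default value, so the difference bound is not
    -- available there.
    have hosc : ∫ x, Real.exp (lam * (g x - E)) ∂P ≤ Real.exp (lam ^ 2 * c ^ 2 / 8) := by
      refine integral_exp_sub_mean_le P hgm hslice (fun x hx y hy => ?_) lam
      have hix : Integrable (fun s => G (x, s)) π :=
        Integrable.of_bound hx b (Filter.Eventually.of_forall fun s => hGb _)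
      have hiy : Integrable (fun s => G (y, s)) π :=
        Integrable.of_bound hy b (Filter.Eventually.of_forall fun s => hGb _)
      rw [hg, ← integral_sub hix hiy]
      have := norm_integral_le_of_norm_le_const (μ := π) (C := c)
        (f := fun s => G (x, s) - G (y, s)) (Filter.Eventually.of_forall fun s => by
          have := hd (e (y, s)) 0 x
          rw [heval, Fin.update_cons_zero] at this
          simpa only [hG, heval, Real.norm_eq_abs] using this)
      simpa using this
    calc _ ≤ ∫ x, Real.exp (m * (lam ^ 2 * c ^ 2 / 8)) * Real.exp (lam * (g x - E)) ∂P :=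
          integral_mono_ae hint.integral_prod_left (hintg.const_mul _) hinner
      _ = Real.exp (m * (lam ^ 2 * c ^ 2 / 8)) * ∫ x, Real.exp (lam * (g x - E)) ∂P :=
          integral_const_mul _ _
      _ ≤ Real.exp (m * (lam ^ 2 * c ^ 2 / 8)) * Real.exp (lam ^ 2 * c ^ 2 / 8) :=
          mul_le_mul_of_nonneg_left hosc (Real.exp_pos _).le
      _ = _ := by rw [← Real.exp_add]; congr 1; push_cast; ring

/-! ### Rademacher averages -/

/-- The sign `±1` encoded by a Boolean. -/
def boolSign (t : Bool) : ℝ := if t then 1 else -1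

lemma boolSign_not (t : Bool) : boolSign (!t) = -boolSign t := by cases t <;> simp [boolSign]

lemma abs_boolSign (t : Bool) : |boolSign t| = 1 := by cases t <;> simp [boolSign]

lemma sum_boolSign_mul {n : ℕ} (i : Fin n) : ∑ σ : Fin n → Bool, boolSign (σ i) = 0 := by
  classical
  have h := Equiv.sum_comp (Equiv.piCongrRight fun j : Fin n =>
    if j = i then Equiv.boolNot else Equiv.refl Bool) fun σ : Fin n → Bool => boolSign (σ i)
  simp only [Equiv.piCongrRight_apply, Pi.map_apply, if_true, Equiv.boolNot_apply, boolSign_not,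
    Finset.sum_neg_distrib] at h
  linarith

/-! ### Contraction for Rademacher averages -/

section Contraction

variable {κ : Type*} {n : ℕ} {H : κ → Fin n → ℝ}

lemma bddAbove_abs_sum (hH : ∀ q i, |H q i| ≤ 1) (w : Fin n → ℝ) :
    BddAbove (Set.range fun q => |∑ i, w i * H q i|) := by
  refine ⟨∑ i, |w i|, ?_⟩
  rintro _ ⟨q, rfl⟩
  refine (Finset.abs_sum_le_sum_abs _ _).trans (Finset.sum_le_sum fun i _ => ?_)
  rw [abs_mul]
  exact mul_le_of_le_one_right (abs_nonneg _) (hH q i)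

/-- The supremum is convex in the `k`-th weight, and `c k` is a convex combination of `1` and `-1`.
Flipping the `k`-th sign shows that both endpoints give the same sum over `σ`. -/
lemma sum_iSup_abs_update_le [Nonempty κ] (hH : ∀ q i, |H q i| ≤ 1) (c : Fin n → ℝ) (k : Fin n)
    (hk : |c k| ≤ 1) :
    ∑ σ : Fin n → Bool, ⨆ q, |∑ i, boolSign (σ i) * c i * H q i| ≤
      ∑ σ : Fin n → Bool, ⨆ q, |∑ i, boolSign (σ i) * Function.update c k 1 i * H q i| := by
  classical
  obtain ⟨hk1, hk2⟩ := abs_le.1 hk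
  have hflip : ∑ σ : Fin n → Bool, ⨆ q, |∑ i, boolSign (σ i) * Function.update c k (-1) i * H q i|
      = ∑ σ : Fin n → Bool, ⨆ q, |∑ i, boolSign (σ i) * Function.update c k 1 i * H q i| := by
    rw [← Equiv.sum_comp (Equiv.piCongrRight fun j : Fin n =>
      if j = k then Equiv.boolNot else Equiv.refl Bool)]
    refine Finset.sum_congr rfl fun σ _ => iSup_congr fun q => congrArg _ ?_
    refine Finset.sum_congr rfl fun i _ => ?_
    by_cases h : i = k
    · subst h
      simp [boolSign_not]
    · simp [h]
  have hconv : ∀ σ : Fin n → Bool, ⨆ q, |∑ i, boolSign (σ i) * c i * H q i| ≤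
      (1 + c k) / 2 * (⨆ q, |∑ i, boolSign (σ i) * Function.update c k 1 i * H q i|)
      + (1 - c k) / 2 * ⨆ q, |∑ i, boolSign (σ i) * Function.update c k (-1) i * H q i| := by
    intro σ
    refine ciSup_le fun q => ?_
    have h1 := le_ciSup (bddAbove_abs_sum hH fun i => boolSign (σ i) * Function.update c k 1 i) q
    have h2 := le_ciSup (bddAbove_abs_sum hH fun i => boolSign (σ i) * Function.update c k (-1) i) q
    have hsplit : ∑ i, boolSign (σ i) * c i * H q i
        = (1 + c k) / 2 * ∑ i, boolSign (σ i) * Function.update c k 1 i * H q i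
        + (1 - c k) / 2 * ∑ i, boolSign (σ i) * Function.update c k (-1) i * H q i := by
      rw [Finset.mul_sum, Finset.mul_sum, ← Finset.sum_add_distrib]
      refine Finset.sum_congr rfl fun i _ => ?_
      by_cases h : i = k
      · subst h
        simp only [Function.update_self]
        ring
      · simp only [Function.update_of_ne h]
        ring
    rw [hsplit]
    refine (abs_add_le _ _).trans (add_le_add ?_ ?_)
    · rw [abs_mul, abs_of_nonneg (by linarith)]
      exact mul_le_mul_of_nonneg_left h1 (by linarith)
    · rw [abs_mul, abs_of_nonneg (by linarith)]
      exact mul_le_mul_of_nonneg_left h2 (by linarith)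
  refine (Finset.sum_le_sum fun σ _ => hconv σ).trans (le_of_eq ?_)
  rw [Finset.sum_add_distrib, ← Finset.mul_sum, ← Finset.mul_sum, hflip]
  ring

/-- The contraction principle for multiplication by weights in `[-1,1]`. -/
lemma sum_iSup_abs_mul_le [Nonempty κ] (hH : ∀ q i, |H q i| ≤ 1) (c : Fin n → ℝ) (hc : ∀ i, |c i| ≤ 1) :
    ∑ σ : Fin n → Bool, ⨆ q, |∑ i, boolSign (σ i) * c i * H q i| ≤
      ∑ σ : Fin n → Bool, ⨆ q, |∑ i, boolSign (σ i) * H q i| := by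
  classical
  have key : ∀ S : Finset (Fin n),
      ∑ σ : Fin n → Bool, ⨆ q, |∑ i, boolSign (σ i) * c i * H q i| ≤
      ∑ σ : Fin n → Bool, ⨆ q, |∑ i, boolSign (σ i) * (S.piecewise 1 c) i * H q i| := by
    intro S
    induction S using Finset.induction_on with
    | empty => simp
    | insert k S hk ih =>
      refine ih.trans ((sum_iSup_abs_update_le hH _ k ?_).trans ?_)
      · simp [hk, hc]
      · rw [Finset.piecewise_insert]; rfl
  simpa using key Finset.univ

end Contraction

/-! ### Suprema over the class of threshold classifiers -/

section Layer

variable {𝒳 : Type*} (F : Set (𝒳 → ℝ)) (z : ℝ)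

/-- The threshold classifiers at level `z`, together with the zero classifier. -/
noncomputable def layerClass : Option F → 𝒳 → ℝ
  | none, _ => 0
  | some f, x => thr f x z

variable {F z}

lemma thr_eq_zero_or_one (f : 𝒳 → ℝ) (x : 𝒳) (z : ℝ) : thr f x z = 0 ∨ thr f x z = 1 := by
  unfold thr
  split_ifs <;> simp

lemma abs_thr_le_one (f : 𝒳 → ℝ) (x : 𝒳) (z : ℝ) : |thr f x z| ≤ 1 := by
  rcases thr_eq_zero_or_one f x z with h | h <;> simp [h]

lemma layerClass_eq_zero_or_one (q : Option F) (x : 𝒳) :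
    layerClass F z q x = 0 ∨ layerClass F z q x = 1 := by
  cases q with
  | none => exact Or.inl rfl
  | some f => exact thr_eq_zero_or_one _ _ _

lemma abs_layerClass_le_one (q : Option F) (x : 𝒳) : |layerClass F z q x| ≤ 1 := by
  rcases layerClass_eq_zero_or_one (z := z) q x with h | h <;> simp [h]

/-- The Rademacher average at level `z` is bounded by the Rademacher complexity. -/
lemma sum_iSup_thr_le_rademacher (hF : F.Nonempty) {n : ℕ} (hn : 1 ≤ n) (hz : z ∈ Set.Icc (0 : ℝ) 1)
    (x : Fin n → 𝒳) :
    ∑ σ : Fin n → Bool, ⨆ f : F, |∑ i, boolSign (σ i) * thr (f : 𝒳 → ℝ) (x i) z|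
      ≤ 2 ^ n * (n * rademacher (thrClass F) n) := by
  have hnpos : (0 : ℝ) < n := by exact_mod_cast hn
  have : Nonempty F := hF.to_subtype
  -- Uniform boundedness makes the real suprema genuine upper bounds; an unbounded family would have
  -- supremum `0` by default.
  have hbnd : ∀ (u : Fin n → 𝒳 × Set.Icc (0 : ℝ) 1) (σ : Fin n → Bool) (g : thrClass F),
      |(∑ i, (if σ i then (1 : ℝ) else -1) * (g : 𝒳 × Set.Icc (0 : ℝ) 1 → ℝ) (u i)) / n| ≤ 1 := by
    rintro u σ ⟨g, f, hf, rfl⟩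
    rw [abs_div, abs_of_pos hnpos, div_le_one hnpos]
    refine (Finset.abs_sum_le_sum_abs _ _).trans ?_
    calc _ ≤ ∑ _i : Fin n, (1 : ℝ) := Finset.sum_le_sum fun i _ => by
          rw [abs_mul]
          exact mul_le_one₀ (abs_boolSign (σ i)).le (abs_nonneg _) (abs_thr_le_one _ _ _)
      _ = n := by simp
  have : Nonempty (thrClass F) := ⟨⟨_, hF.some, hF.some_mem, rfl⟩⟩
  have hbdd : BddAbove (Set.range fun u : Fin n → 𝒳 × Set.Icc (0 : ℝ) 1 =>
      (∑ σ : Fin n → Bool, ⨆ g : thrClass F,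
        |(∑ i, (if σ i then (1 : ℝ) else -1) * (g : 𝒳 × Set.Icc (0 : ℝ) 1 → ℝ) (u i)) / n|)
        / 2 ^ n) := by
    refine ⟨1, ?_⟩
    rintro _ ⟨u, rfl⟩
    rw [div_le_one (by positivity)]
    calc _ ≤ ∑ _σ : Fin n → Bool, (1 : ℝ) :=
          Finset.sum_le_sum fun σ _ => ciSup_le fun g => hbnd u σ g
      _ = 2 ^ n := by simp
  have h1 := le_ciSup hbdd fun i => (x i, (⟨z, hz⟩ : Set.Icc (0 : ℝ) 1))
  change _ ≤ rademacher (thrClass F) n at h1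
  rw [div_le_iff₀ (by positivity)] at h1
  have h2 : ∑ σ : Fin n → Bool, ⨆ f : F, |∑ i, boolSign (σ i) * thr (f : 𝒳 → ℝ) (x i) z|
      ≤ n * ∑ σ : Fin n → Bool, ⨆ g : thrClass F,
        |(∑ i, (if σ i then (1 : ℝ) else -1) *
          (g : 𝒳 × Set.Icc (0 : ℝ) 1 → ℝ) (x i, ⟨z, hz⟩)) / n| := by
    rw [Finset.mul_sum]
    refine Finset.sum_le_sum fun σ _ => ciSup_le fun f => ?_
    have h3 := le_ciSup (f := fun g : thrClass F => |(∑ i, (if σ i then (1 : ℝ) else -1) *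
          (g : 𝒳 × Set.Icc (0 : ℝ) 1 → ℝ) (x i, ⟨z, hz⟩)) / n|)
      ⟨1, by rintro _ ⟨g, rfl⟩; exact hbnd _ σ g⟩ ⟨_, f, f.2, rfl⟩
    have h4 := mul_le_mul_of_nonneg_left h3 hnpos.le
    refine le_trans (le_of_eq ?_) h4
    dsimp only
    rw [abs_div, abs_of_pos hnpos, mul_div_cancel₀ _ hnpos.ne']
    rfl
  calc _ ≤ _ := h2
    _ ≤ n * (rademacher (thrClass F) n * 2 ^ n) := mul_le_mul_of_nonneg_left h1 hnpos.le
    _ = _ := by ring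

/-- One-sided, weighted version of `sum_iSup_thr_le_rademacher` that includes the zero classifier. -/
lemma sum_iSup_layerClass_le (hF : F.Nonempty) {n : ℕ} (hn : 1 ≤ n) (hz : z ∈ Set.Icc (0 : ℝ) 1)
    (x : Fin n → 𝒳) (c : Fin n → ℝ) (hc : ∀ i, |c i| ≤ 1) :
    ∑ σ : Fin n → Bool, ⨆ q : Option F, ∑ i, boolSign (σ i) * c i * layerClass F z q (x i)
      ≤ 2 ^ n * (n * rademacher (thrClass F) n) := by
  have : Nonempty F := hF.to_subtype
  have hH : ∀ (f : F) (i : Fin n), |thr (f : 𝒳 → ℝ) (x i) z| ≤ 1 := fun f i => abs_thr_le_one _ _ _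
  refine le_trans (Finset.sum_le_sum fun σ _ => ?_) ((sum_iSup_abs_mul_le
    (H := fun (f : F) i => thr (f : 𝒳 → ℝ) (x i) z) hH c hc).trans
    (sum_iSup_thr_le_rademacher hF hn hz x))
  have hle := le_ciSup (bddAbove_abs_sum hH fun i => boolSign (σ i) * c i)
  refine ciSup_le fun q => ?_
  cases q with
  -- The zero classifier is free: its sum is `0`, and the supremum of absolute values is
  -- nonnegative.
  | none =>
    refine le_trans ?_ ((abs_nonneg _).trans (hle (Classical.arbitrary F)))
    simp [layerClass]
  | some f => exact (le_abs_self _).trans (hle f)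

end Layer

/-! ### Transformations preserving the law of the sample -/

/-- Independent resampling of coordinates along a permutation preserves a product measure. -/
lemma measurePreserving_comp_perm {Ω : Type*} [MeasurableSpace Ω] (P : Measure Ω) [SigmaFinite P]
    {m : ℕ} (π : Equiv.Perm (Fin m)) :
    MeasurePreserving (fun s : Fin m → Ω => s ∘ π) (Measure.pi fun _ => P)
      (Measure.pi fun _ => P) := by
  have h := measurePreserving_piCongrLeft (fun _ : Fin m => P) π.symm
  convert h using 1
  funext s i
  have h2 := Equiv.piCongrLeft_apply_apply (fun _ : Fin m => Ω) π.symm s (π i)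
  rw [Equiv.symm_apply_apply] at h2
  exact h2.symm

/-- Joining two independent samples gives a sample of double size. -/
lemma measurePreserving_append {Ω : Type*} [MeasurableSpace Ω] (P : Measure Ω) [SigmaFinite P]
    (n : ℕ) :
    MeasurePreserving (fun q : (Fin n → Ω) × (Fin n → Ω) => (Fin.append q.1 q.2 : Fin (n + n) → Ω))
      ((Measure.pi fun _ => P).prod (Measure.pi fun _ => P)) (Measure.pi fun _ => P) := by
  have h1 := measurePreserving_sumPiEquivProdPi_symm (fun _ : Fin n ⊕ Fin n => P)
  have h2 := measurePreserving_piCongrLeft (fun _ : Fin (n + n) => P) finSumFinEquiv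
  have h3 := h2.comp h1
  convert h3 using 1
  funext q i
  refine Fin.addCases (fun j => ?_) (fun j => ?_) i
  · rw [Fin.append_left]
    exact (Equiv.piCongrLeft_apply_apply (fun _ : Fin (n + n) => Ω) finSumFinEquiv
      ((MeasurableEquiv.sumPiEquivProdPi fun _ : Fin n ⊕ Fin n => Ω).symm q) (Sum.inl j)).symm
  · rw [Fin.append_right]
    exact (Equiv.piCongrLeft_apply_apply (fun _ : Fin (n + n) => Ω) finSumFinEquiv
      ((MeasurableEquiv.sumPiEquivProdPi fun _ : Fin n ⊕ Fin n => Ω).symm q) (Sum.inr j)).symm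

/-! ### Weighted suprema: bounded differences and measurability -/

section LayerSup

variable {𝒳 : Type*} (F : Set (𝒳 → ℝ)) (z : ℝ)

/-- The supremum over classifiers `h` of level `z` of `∑ wᵢ (b + c h)(oᵢ)`. -/
noncomputable def layerSup (b c : Unit4 𝒳 → ℝ) {m : ℕ} (w : Fin m → ℝ) (s : Fin m → Unit4 𝒳) : ℝ :=
  ⨆ q : Option F, ∑ i, w i * (b (s i) + c (s i) * layerClass F z q (s i).feat)

variable {F z} {b c : Unit4 𝒳 → ℝ} {m : ℕ}

lemma abs_layer_sum_le {bd : ℝ} (hb : ∀ o, |b o| ≤ bd) (hc : ∀ o, |c o| ≤ 1) {w : Fin m → ℝ}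
    (hw : ∀ i, |w i| ≤ 1) (s : Fin m → Unit4 𝒳) (h : Fin m → ℝ) (hh : ∀ i, |h i| ≤ 1) :
    |∑ i, w i * (b (s i) + c (s i) * h i)| ≤ m * (bd + 1) := by
  refine (Finset.abs_sum_le_sum_abs _ _).trans ?_
  calc _ ≤ ∑ _i : Fin m, (bd + 1) := Finset.sum_le_sum fun i _ => by
        rw [abs_mul]
        refine (mul_le_of_le_one_left (abs_nonneg _) (hw i)).trans ((abs_add_le _ _).trans ?_)
        refine add_le_add (hb _) ?_
        rw [abs_mul]
        exact mul_le_one₀ (hc _) (abs_nonneg _) (hh i)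
    _ = _ := by rw [Finset.sum_const, Finset.card_univ, Fintype.card_fin, nsmul_eq_mul]

lemma bddAbove_layer {bd : ℝ} (hb : ∀ o, |b o| ≤ bd) (hc : ∀ o, |c o| ≤ 1) {w : Fin m → ℝ}
    (hw : ∀ i, |w i| ≤ 1) (s : Fin m → Unit4 𝒳) :
    BddAbove (Set.range fun q : Option F =>
      ∑ i, w i * (b (s i) + c (s i) * layerClass F z q (s i).feat)) := by
  refine ⟨m * (bd + 1), ?_⟩
  rintro _ ⟨q, rfl⟩
  exact (le_abs_self _).trans (abs_layer_sum_le hb hc hw s _ fun i => abs_layerClass_le_one _ _)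

lemma abs_layerSup_le {bd : ℝ} (hb : ∀ o, |b o| ≤ bd) (hc : ∀ o, |c o| ≤ 1) {w : Fin m → ℝ}
    (hw : ∀ i, |w i| ≤ 1) (s : Fin m → Unit4 𝒳) :
    |layerSup F z b c w s| ≤ m * (bd + 1) := by
  have h : ∀ q : Option F, |∑ i, w i * (b (s i) + c (s i) * layerClass F z q (s i).feat)|
      ≤ m * (bd + 1) := fun q => abs_layer_sum_le hb hc hw s _ fun i => abs_layerClass_le_one _ _
  rw [abs_le]
  exact ⟨(abs_le.1 (h none)).1.trans (le_ciSup (bddAbove_layer hb hc hw s) none),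
    ciSup_le fun q => (abs_le.1 (h q)).2⟩

/-- For each classifier only one summand changes, by at most `d`, and this is uniform in the
classifier. The classifier may take different values at the old and new units, hence the two values
`v`, `v'` in the hypothesis. -/
lemma layerSup_update_sub_le {bd d : ℝ} (hb : ∀ o, |b o| ≤ bd) (hc : ∀ o, |c o| ≤ 1)
    {w : Fin m → ℝ} (hw : ∀ i, |w i| ≤ 1)
    (hd : ∀ o o', ∀ v ∈ ({0, 1} : Set ℝ), ∀ v' ∈ ({0, 1} : Set ℝ),
      |(b o + c o * v) - (b o' + c o' * v')| ≤ d)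
    (s : Fin m → Unit4 𝒳) (i : Fin m) (x : Unit4 𝒳) :
    |layerSup F z b c w (Function.update s i x) - layerSup F z b c w s| ≤ d := by
  classical
  have key : ∀ s s' : Fin m → Unit4 𝒳, (∀ j, j ≠ i → s j = s' j) →
      layerSup F z b c w s ≤ layerSup F z b c w s' + d := by
    intro s s' hss
    refine ciSup_le fun q => ?_
    have h1 := le_ciSup (bddAbove_layer (F := F) (z := z) hb hc hw s') q
    refine le_trans ?_ (add_le_add h1 le_rfl)
    rw [← sub_le_iff_le_add', ← Finset.sum_sub_distrib, Finset.sum_eq_single i]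
    · rw [← mul_sub]
      refine (le_abs_self _).trans ?_
      rw [abs_mul]
      refine (mul_le_of_le_one_left (abs_nonneg _) (hw i)).trans (hd _ _ _ ?_ _ ?_)
      · simpa using layerClass_eq_zero_or_one q _
      · simpa using layerClass_eq_zero_or_one q _
    · intro j _ hj
      rw [hss j hj, sub_self]
    · simp
  rw [abs_le]
  have h1 := key (Function.update s i x) s fun j hj => Function.update_of_ne hj _ _
  have h2 := key s (Function.update s i x) fun j hj => (Function.update_of_ne hj _ _).symm
  constructor <;> linarith

variable [MeasurableSpace 𝒳] {P : Measure (Unit4 𝒳)}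

lemma measurable_feat : Measurable (Unit4.feat : Unit4 𝒳 → 𝒳) := measurable_fst

/-- The samples on which some function of the class produces a given nonzero pattern. -/
lemma nullMeasurableSet_pattern [IsProbabilityMeasure P] (hF : IsPredictionClass P F)
    (hz : z ∈ Set.Icc (0 : ℝ) 1) (pat : Fin m → Bool) (hpat : ∃ i, pat i = true) :
    NullMeasurableSet {x : Fin m → 𝒳 | ∃ f ∈ F, ∀ i, thr f (x i) z = if pat i then 1 else 0}
      (Measure.pi fun _ => P.map Unit4.feat) := by
  classical
  have hmpos : (0 : ℝ) < m := by
    obtain ⟨i, _⟩ := hpat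
    exact_mod_cast i.pos
  have : Nonempty F := hF.nonempty.to_subtype
  -- These weights detect the pattern: `k`, the number of its ones, is attained exactly by the
  -- pattern itself. A missing one loses `1` and a superfluous one loses `1/(2m)`, so every other
  -- pattern stays below `k` by at least `1/(2m)`.
  set w : Fin m → ℝ := fun i => if pat i then 1 else -(1 / (2 * m)) with hw
  set k : ℝ := ∑ i, if pat i then (1 : ℝ) else 0 with hk
  have hk1 : 1 ≤ k := by
    obtain ⟨i, hi⟩ := hpat
    rw [hk]
    refine le_trans ?_ (Finset.single_le_sum (f := fun i => if pat i then (1 : ℝ) else 0)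
      (fun j _ => by split_ifs <;> norm_num) (Finset.mem_univ i))
    simp [hi]
  have hH : ∀ (f : F) (x : Fin m → 𝒳) (i : Fin m), |thr (f : 𝒳 → ℝ) (x i) z| ≤ 1 :=
    fun f x i => abs_thr_le_one _ _ _
  have hsup := hF.measurable_sup m w z hz
  have hset : {x : Fin m → 𝒳 | ∃ f ∈ F, ∀ i, thr f (x i) z = if pat i then 1 else 0}
      = {x | k ≤ ⨆ f : F, |∑ i, w i * thr (f : 𝒳 → ℝ) (x i) z|} := by
    ext x
    simp only [Set.mem_ofPred_eq]
    constructor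
    · rintro ⟨f, hf, hfx⟩
      refine le_trans ?_ (le_ciSup (bddAbove_abs_sum (fun f i => hH f x i) w) ⟨f, hf⟩)
      refine le_trans (le_of_eq ?_) (le_abs_self _)
      refine Finset.sum_congr rfl fun i _ => ?_
      rw [hfx i, hw]
      by_cases h : pat i <;> simp [h]
    · intro hx
      by_contra hno
      push Not at hno
      have hstrict : ∀ f : F, |∑ i, w i * thr (f : 𝒳 → ℝ) (x i) z| ≤ k - 1 / (2 * m) := by
        intro f
        obtain ⟨j, hj⟩ := hno f f.2
        have hterm : ∀ i, w i * thr (f : 𝒳 → ℝ) (x i) z ≤ if pat i then 1 else 0 := by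
          intro i
          rcases thr_eq_zero_or_one (f : 𝒳 → ℝ) (x i) z with h | h <;> rw [h, hw] <;>
            by_cases hp : pat i <;> simp [hp]
        have hterm' : ∀ i, -(1 / (2 * m)) ≤ w i * thr (f : 𝒳 → ℝ) (x i) z := by
          intro i
          have : (0 : ℝ) ≤ 1 / (2 * m) := by positivity
          rcases thr_eq_zero_or_one (f : 𝒳 → ℝ) (x i) z with h | h
          · rw [h, mul_zero]
            linarith
          · rw [h, mul_one, hw]
            dsimp only
            split_ifs <;> linarith
        rw [abs_le]
        constructor
        -- Negative sums never fall below `-1/2`, so the absolute value cannot reach `k ≥ 1` from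
        -- that side. This is where the pattern must be nonzero.
        · have h1 : ∑ _i : Fin m, (-(1 / (2 * m)) : ℝ) ≤ ∑ i, w i * thr (f : 𝒳 → ℝ) (x i) z :=
            Finset.sum_le_sum fun i _ => hterm' i
          have h2 : ∑ _i : Fin m, (-(1 / (2 * m)) : ℝ) = -(1 / 2) := by
            simp; field_simp
          have h3 : (1 : ℝ) / (2 * m) ≤ 1 / 2 := by
            have : (1 : ℝ) ≤ m := by
              obtain ⟨i, _⟩ := hpat
              exact_mod_cast i.pos
            gcongr
            linarith
          linarith
        · have hjlt : w j * thr (f : 𝒳 → ℝ) (x j) z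
              ≤ (if pat j then 1 else 0) - 1 / (2 * m) := by
            have h3 : (1 : ℝ) / (2 * m) ≤ 1 := by
              have : (1 : ℝ) ≤ m := by
                obtain ⟨i, _⟩ := hpat
                exact_mod_cast i.pos
              rw [div_le_one (by positivity)]
              linarith
            rcases thr_eq_zero_or_one (f : 𝒳 → ℝ) (x j) z with h | h <;> rw [h] at hj ⊢ <;>
              rw [hw] <;> by_cases hp : pat j <;> simp [hp] at hj ⊢
            · simp at h3; linarith
          rw [hk, ← Finset.add_sum_erase _ _ (Finset.mem_univ j),
            ← Finset.add_sum_erase Finset.univ (fun i => if pat i then (1 : ℝ) else 0)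
              (Finset.mem_univ j)]
          have := Finset.sum_le_sum fun i (_ : i ∈ Finset.univ.erase j) => hterm i
          linarith
      have h4 : ⨆ f : F, |∑ i, w i * thr (f : 𝒳 → ℝ) (x i) z| ≤ k - 1 / (2 * m) := ciSup_le hstrict
      have h5 : (0 : ℝ) < 1 / (2 * m) := by positivity
      linarith
  rw [hset]
  exact nullMeasurableSet_le aemeasurable_const hsup

/-- Suprema over the class with data-dependent weights are almost everywhere measurable. -/
lemma aemeasurable_layerSup [IsProbabilityMeasure P] (hF : IsPredictionClass P F)
    (hz : z ∈ Set.Icc (0 : ℝ) 1) (hbm : Measurable b) (hcm : Measurable c) {bd : ℝ}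
    (hb : ∀ o, |b o| ≤ bd) (hc : ∀ o, |c o| ≤ 1) {w : Fin m → ℝ} (hw : ∀ i, |w i| ≤ 1) :
    AEMeasurable (layerSup F z b c w) (Measure.pi fun _ => P) := by
  classical
  set A : (Fin m → Bool) → Set (Fin m → Unit4 𝒳) := fun pat =>
    {s | (∃ i, pat i = true) ∧ ∃ f ∈ F, ∀ i, thr f (s i).feat z = if pat i then 1 else 0} with hA
  have hAm : ∀ pat, NullMeasurableSet (A pat) (Measure.pi fun _ => P) := by
    intro pat
    by_cases hpat : ∃ i, pat i = true
    · have hmp : MeasurePreserving (fun (s : Fin m → Unit4 𝒳) i => (s i).feat)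
          (Measure.pi fun _ => P) (Measure.pi fun _ => P.map Unit4.feat) := by
        have : IsProbabilityMeasure (P.map (Unit4.feat : Unit4 𝒳 → 𝒳)) :=
          Measure.isProbabilityMeasure_map measurable_feat.aemeasurable
        exact measurePreserving_pi _ _ fun _ => measurable_feat.measurePreserving P
      have := (nullMeasurableSet_pattern hF hz pat hpat).preimage hmp.quasiMeasurePreserving
      convert this using 1
      ext s
      simp [hA, hpat]
    · have : A pat = ∅ := by
        ext s
        simp only [hA, Set.mem_ofPred_eq, Set.mem_empty_iff_false, iff_false]
        exact fun h => hpat h.1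
      rw [this]
      exact nullMeasurableSet_empty
  set T : (Fin m → Bool) → (Fin m → Unit4 𝒳) → ℝ := fun pat s =>
    ∑ i, w i * (b (s i) + c (s i) * if pat i then 1 else 0) with hT
  have hTm : ∀ pat, Measurable (T pat) := by
    intro pat
    refine Finset.measurable_sum _ fun i _ => ?_
    exact ((hbm.comp (measurable_pi_apply i)).add
      ((hcm.comp (measurable_pi_apply i)).mul_const _)).const_mul _
  -- Where a pattern is not realized its value is replaced by that of the zero classifier, so the
  -- supremum becomes a finite maximum of a.e. measurable functions.
  set V : (Fin m → Bool) → (Fin m → Unit4 𝒳) → ℝ := fun pat s =>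
    T (fun _ => false) s + (A pat).indicator (fun s => T pat s - T (fun _ => false) s) s with hV
  have hVm : ∀ pat, AEMeasurable (V pat) (Measure.pi fun _ => P) := fun pat =>
    (hTm _).aemeasurable.add (((hTm _).sub (hTm _)).aemeasurable.indicator₀ (hAm pat))
  have heq : layerSup F z b c w = fun s => ⨆ pat, V pat s := by
    funext s
    have hbdd : BddAbove (Set.range fun pat => V pat s) := Set.finite_range _ |>.bddAbove
    refine le_antisymm (ciSup_le fun q => ?_) (ciSup_le fun pat => ?_)
    · cases q with
      | none =>
        refine le_trans (le_of_eq ?_) (le_ciSup hbdd fun _ => false)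
        simp [hV, hA, hT, layerClass]
      | some f =>
        set pat : Fin m → Bool := fun i => decide (thr (f : 𝒳 → ℝ) (s i).feat z = 1) with hpat
        have hval : ∀ i, thr (f : 𝒳 → ℝ) (s i).feat z = if pat i then 1 else 0 := by
          intro i
          rcases thr_eq_zero_or_one (f : 𝒳 → ℝ) (s i).feat z with h | h <;> simp [hpat, h]
        have hTv : ∑ i, w i * (b (s i) + c (s i) * layerClass F z (some f) (s i).feat) = T pat s := by
          refine Finset.sum_congr rfl fun i _ => ?_
          rw [layerClass, hval i]
        refine le_trans (le_of_eq ?_) (le_ciSup hbdd pat)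
        rw [hTv]
        by_cases hex : ∃ i, pat i = true
        · have hmem : s ∈ A pat := ⟨hex, f, f.2, hval⟩
          simp only [hV, Set.indicator_of_mem hmem]
          ring
        · have hfalse : pat = fun _ => false := by
            funext i
            simpa using fun h => hex ⟨i, h⟩
          have hmem : s ∉ A pat := fun h => hex h.1
          simp only [hV, Set.indicator_of_notMem hmem]
          rw [hfalse, add_zero]
    · have hle := le_ciSup (bddAbove_layer (F := F) (z := z) hb hc hw s)
      by_cases hmem : s ∈ A pat
      · obtain ⟨-, f, hf, hfv⟩ := id hmem
        refine le_trans (le_of_eq ?_) (hle (some ⟨f, hf⟩))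
        simp only [hV, Set.indicator_of_mem hmem, hT, layerClass, hfv]
        ring
      · refine le_trans (le_of_eq ?_) (hle none)
        simp [hV, Set.indicator_of_notMem hmem, hT, layerClass]
  rw [heq]
  exact AEMeasurable.iSup hVm

end LayerSup

/-! ### Symmetrization and uniform deviations -/

section Symmetrization

variable {n : ℕ}

/-- The permutation of a doubled sample that swaps the `i`-th pair when `σ i` is false. -/
def swapPerm (σ : Fin n → Bool) : Equiv.Perm (Fin (n + n)) :=
  finSumFinEquiv.permCongr (Function.Involutive.toPerm
    (Sum.elim (fun i => if σ i then Sum.inl i else Sum.inr i)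
      (fun i => if σ i then Sum.inr i else Sum.inl i) : Fin n ⊕ Fin n → Fin n ⊕ Fin n)
    (by rintro (i | i) <;> cases h : σ i <;> simp [h]))

/-- The weights of the difference of the sums over the two halves of a doubled sample,
with random signs. -/
def ghostWeight (σ : Fin n → Bool) : Fin (n + n) → ℝ :=
  Fin.append (fun i => boolSign (σ i)) (fun i => -boolSign (σ i))

lemma swapPerm_castAdd (σ : Fin n → Bool) (j : Fin n) :
    swapPerm σ (Fin.castAdd n j) = if σ j then Fin.castAdd n j else Fin.natAdd n j := by
  rw [swapPerm, Equiv.permCongr_apply, finSumFinEquiv_symm_apply_castAdd]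
  change finSumFinEquiv (if σ j then Sum.inl j else Sum.inr j) = _
  split_ifs
  · exact finSumFinEquiv_apply_left j
  · exact finSumFinEquiv_apply_right j

lemma swapPerm_natAdd (σ : Fin n → Bool) (j : Fin n) :
    swapPerm σ (Fin.natAdd n j) = if σ j then Fin.natAdd n j else Fin.castAdd n j := by
  rw [swapPerm, Equiv.permCongr_apply, finSumFinEquiv_symm_apply_natAdd]
  change finSumFinEquiv (if σ j then Sum.inr j else Sum.inl j) = _
  split_ifs
  · exact finSumFinEquiv_apply_right j
  · exact finSumFinEquiv_apply_left j

lemma ghostWeight_swapPerm (σ : Fin n → Bool) (i : Fin (n + n)) :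
    ghostWeight σ (swapPerm σ i) = ghostWeight (fun _ => true) i := by
  refine Fin.addCases (fun j => ?_) (fun j => ?_) i
  · rw [swapPerm_castAdd]
    cases h : σ j <;> simp only [ghostWeight, if_true, Bool.false_eq_true, if_false,
      Fin.append_left, Fin.append_right, h, boolSign, neg_neg]
  · rw [swapPerm_natAdd]
    cases h : σ j <;> simp only [ghostWeight, if_true, Bool.false_eq_true, if_false,
      Fin.append_left, Fin.append_right, h, boolSign]

lemma abs_ghostWeight_le (σ : Fin n → Bool) (i : Fin (n + n)) : |ghostWeight σ i| ≤ 1 := by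
  refine Fin.addCases (fun j => ?_) (fun j => ?_) i
  · rw [ghostWeight, Fin.append_left, abs_boolSign]
  · rw [ghostWeight, Fin.append_right, abs_neg, abs_boolSign]

variable {𝒳 : Type*} {F : Set (𝒳 → ℝ)} {z : ℝ} {b c : Unit4 𝒳 → ℝ}

/-- Random signs amount to swapping units between the sample and its ghost copy. As swaps preserve
the product law, all sign choices have the same mean. -/
lemma layerSup_comp_swapPerm (σ : Fin n → Bool) (s : Fin (n + n) → Unit4 𝒳) :
    layerSup F z b c (ghostWeight fun _ => true) (s ∘ swapPerm σ)
      = layerSup F z b c (ghostWeight σ) s := by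
  unfold layerSup
  refine iSup_congr fun q => ?_
  conv_rhs => rw [← Equiv.sum_comp (swapPerm σ)]
  refine Finset.sum_congr rfl fun i _ => ?_
  rw [ghostWeight_swapPerm]
  rfl

variable {R : ℝ}

/-- The supremum splits over the two halves, and contraction by the weights `c` and `-c` bounds each
by `n R` on average over the signs. The intercepts cancel because each sign averages to zero. -/
lemma sum_layerSup_ghostWeight_le (hF : F.Nonempty) (hn : 1 ≤ n) (hz : z ∈ Set.Icc (0 : ℝ) 1)
    (hc : ∀ o, |c o| ≤ 1) (hR : rademacher (thrClass F) n ≤ R) (s : Fin (n + n) → Unit4 𝒳) :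
    ∑ σ : Fin n → Bool, layerSup F z b c (ghostWeight σ) s ≤ 2 ^ n * (2 * n * R) := by
  set s₁ : Fin n → Unit4 𝒳 := fun i => s (Fin.castAdd n i) with hs₁
  set s₂ : Fin n → Unit4 𝒳 := fun i => s (Fin.natAdd n i) with hs₂
  have hbddc : ∀ (x : Fin n → Unit4 𝒳) (c' : Fin n → ℝ), (∀ i, |c' i| ≤ 1) → ∀ σ : Fin n → Bool,
      BddAbove (Set.range fun q : Option F =>
        ∑ i, boolSign (σ i) * c' i * layerClass F z q (x i).feat) := by
    intro x c' hc' σ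
    refine ⟨∑ _i : Fin n, 1, ?_⟩
    rintro _ ⟨q, rfl⟩
    refine Finset.sum_le_sum fun i _ => (le_abs_self _).trans ?_
    rw [abs_mul, abs_mul, abs_boolSign, one_mul]
    exact mul_le_one₀ (hc' i) (abs_nonneg _) (abs_layerClass_le_one _ _)
  have h1 : ∀ i, |c (s₁ i)| ≤ 1 := fun i => hc _
  have h2 : ∀ i, |-c (s₂ i)| ≤ 1 := fun i => by rw [abs_neg]; exact hc _
  have hle : ∀ σ : Fin n → Bool, layerSup F z b c (ghostWeight σ) s ≤
      ∑ i, boolSign (σ i) * (b (s₁ i) - b (s₂ i))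
      + ((⨆ q : Option F, ∑ i, boolSign (σ i) * c (s₁ i) * layerClass F z q (s₁ i).feat)
      + ⨆ q : Option F, ∑ i, boolSign (σ i) * -c (s₂ i) * layerClass F z q (s₂ i).feat) := by
    intro σ
    refine ciSup_le fun q => ?_
    have e1 := le_ciSup (hbddc s₁ (fun i => c (s₁ i)) h1 σ) q
    have e2 := le_ciSup (hbddc s₂ (fun i => -c (s₂ i)) h2 σ) q
    refine le_trans (le_of_eq ?_) (add_le_add le_rfl (add_le_add e1 e2))
    rw [Fin.sum_univ_add]
    simp only [ghostWeight, Fin.append_left, Fin.append_right, ← Finset.sum_add_distrib, hs₁, hs₂]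
    exact Finset.sum_congr rfl fun i _ => by ring
  have hzero : ∑ σ : Fin n → Bool, ∑ i, boolSign (σ i) * (b (s₁ i) - b (s₂ i)) = 0 := by
    rw [Finset.sum_comm]
    refine Finset.sum_eq_zero fun i _ => ?_
    rw [← Finset.sum_mul, sum_boolSign_mul, zero_mul]
  have hnR : 2 ^ n * ((n : ℝ) * rademacher (thrClass F) n) ≤ 2 ^ n * (n * R) := by gcongr
  have k1 := (sum_iSup_layerClass_le hF hn hz (fun i => (s₁ i).feat) _ h1).trans hnR
  have k2 := (sum_iSup_layerClass_le hF hn hz (fun i => (s₂ i).feat) _ h2).trans hnR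
  refine (Finset.sum_le_sum fun σ _ => hle σ).trans ?_
  rw [Finset.sum_add_distrib, hzero, Finset.sum_add_distrib]
  linarith

variable [MeasurableSpace 𝒳] {P : Measure (Unit4 𝒳)} [IsProbabilityMeasure P] {bd : ℝ}

/-- All `2 ^ n` sign vectors give the same integral, so it equals the integral of their average, to
which the pointwise Rademacher bound applies. -/
lemma integral_layerSup_le (hF : IsPredictionClass P F) (hn : 1 ≤ n) (hz : z ∈ Set.Icc (0 : ℝ) 1)
    (hbm : Measurable b) (hcm : Measurable c) (hb : ∀ o, |b o| ≤ bd) (hc : ∀ o, |c o| ≤ 1)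
    (hR : rademacher (thrClass F) n ≤ R) :
    ∫ s, layerSup F z b c (ghostWeight fun _ : Fin n => true) s ∂(Measure.pi fun _ => P)
      ≤ 2 * n * R := by
  have hm : ∀ σ : Fin n → Bool,
      AEMeasurable (layerSup F z b c (ghostWeight σ)) (Measure.pi fun _ => P) := fun σ =>
    aemeasurable_layerSup hF hz hbm hcm hb hc (abs_ghostWeight_le σ)
  have hint : ∀ σ : Fin n → Bool,
      Integrable (layerSup F z b c (ghostWeight σ)) (Measure.pi fun _ => P) := fun σ =>
    Integrable.of_bound (hm σ).aestronglyMeasurable _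
      (Filter.Eventually.of_forall fun s => abs_layerSup_le hb hc (abs_ghostWeight_le σ) s)
  have heq : ∀ σ : Fin n → Bool,
      ∫ s, layerSup F z b c (ghostWeight σ) s ∂(Measure.pi fun _ => P)
      = ∫ s, layerSup F z b c (ghostWeight fun _ : Fin n => true) s ∂(Measure.pi fun _ => P) := by
    intro σ
    have hmp := measurePreserving_comp_perm P (swapPerm σ)
    have h := integral_map hmp.aemeasurable
      (f := layerSup F z b c (ghostWeight fun _ : Fin n => true))
      (by rw [hmp.map_eq]; exact (hm _).aestronglyMeasurable)
    rw [hmp.map_eq] at h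
    rw [h]
    exact integral_congr_ae (Filter.Eventually.of_forall fun s => (layerSup_comp_swapPerm σ s).symm)
  have hsum : ∑ σ : Fin n → Bool,
      ∫ s, layerSup F z b c (ghostWeight σ) s ∂(Measure.pi fun _ => P) ≤ 2 ^ n * (2 * n * R) := by
    rw [← integral_finsetSum _ fun σ _ => hint σ]
    refine (integral_mono (integrable_finsetSum _ fun σ _ => hint σ) (integrable_const _)
      fun s => sum_layerSup_ghostWeight_le hF.nonempty hn hz hc hR s).trans ?_
    simp
  simp only [heq, Finset.sum_const, Finset.card_univ, Fintype.card_pi, Fintype.card_bool,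
    Finset.prod_const, Fintype.card_fin, nsmul_eq_mul] at hsum
  push_cast at hsum
  exact le_of_mul_le_mul_left hsum (by positivity)

/-- Exponential moments of the symmetrized supremum at one level. -/
lemma lintegral_exp_layerSup_le (hF : IsPredictionClass P F) (hn : 1 ≤ n)
    (hz : z ∈ Set.Icc (0 : ℝ) 1) (hbm : Measurable b) (hcm : Measurable c)
    (hb : ∀ o, |b o| ≤ bd) (hc : ∀ o, |c o| ≤ 1)
    (hd : ∀ o o', ∀ v ∈ ({0, 1} : Set ℝ), ∀ v' ∈ ({0, 1} : Set ℝ),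
      |(b o + c o * v) - (b o' + c o' * v')| ≤ 2)
    (hR : rademacher (thrClass F) n ≤ R) {lam : ℝ} (hlam : 0 ≤ lam) :
    ∫⁻ s, ENNReal.ofReal (Real.exp (lam * layerSup F z b c (ghostWeight fun _ : Fin n => true) s))
        ∂(Measure.pi fun _ => P)
      ≤ ENNReal.ofReal (Real.exp (lam * (2 * n * R) + n * lam ^ 2)) := by
  set G := layerSup F z b c (ghostWeight fun _ : Fin n => true) with hG
  have hw := abs_ghostWeight_le fun _ : Fin n => true
  have hm : AEMeasurable G (Measure.pi fun _ => P) := aemeasurable_layerSup hF hz hbm hcm hb hc hw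
  have hGb := fun s => abs_layerSup_le (F := F) (z := z) hb hc hw s
  have hmc := integral_exp_sub_mean_le_of_bounded_differences P 2 lam _ G _ hGb hm
    (layerSup_update_sub_le hb hc hw hd)
  have hmean := integral_layerSup_le hF hn hz hbm hcm hb hc hR
  rw [← hG] at hmean
  set E := ∫ s, G s ∂(Measure.pi fun _ => P) with hE
  have hint : Integrable (fun s => Real.exp (lam * G s)) (Measure.pi fun _ => P) := by
    refine Integrable.of_bound (C := Real.exp (lam * (((n + n : ℕ) : ℝ) * (bd + 1))))
      (by fun_prop) (Filter.Eventually.of_forall fun s => ?_)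
    rw [Real.norm_eq_abs, Real.abs_exp]
    exact Real.exp_le_exp.2 (mul_le_mul_of_nonneg_left ((le_abs_self _).trans (hGb s)) hlam)
  rw [← ofReal_integral_eq_lintegral_ofReal hint
    (Filter.Eventually.of_forall fun s => (Real.exp_pos _).le)]
  apply ENNReal.ofReal_le_ofReal
  have hsplit : ∀ s, Real.exp (lam * G s) = Real.exp (lam * (G s - E)) * Real.exp (lam * E) :=
    fun s => by rw [← Real.exp_add]; congr 1; ring
  simp_rw [hsplit]
  rw [integral_mul_const]
  -- With `2n` coordinates and differences at most `2`, McDiarmid's exponent is `2n · 4 λ² / 8 = n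
  -- λ²`.
  calc _ ≤ Real.exp ((n + n : ℕ) * (lam ^ 2 * 2 ^ 2 / 8)) * Real.exp (lam * E) :=
        mul_le_mul_of_nonneg_right hmc (Real.exp_pos _).le
    _ = Real.exp (lam * E + n * lam ^ 2) := by
        rw [← Real.exp_add]; congr 1; push_cast; ring
    _ ≤ _ := Real.exp_le_exp.2 (by gcongr)

end Symmetrization

/-! ### One-sided uniform deviations of layered processes -/

section Deviation

variable {𝒳 : Type*}

/-- The process `N⁻¹ ∑ⱼ (bⱼ + cⱼ h_f(·, j/N))`. -/
noncomputable def layered (N : ℕ) (b c : ℕ → Unit4 𝒳 → ℝ) (f : 𝒳 → ℝ) (o : Unit4 𝒳) : ℝ :=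
  (∑ j ∈ Finset.Icc 1 N, (b j o + c j o * thr f o.feat ((j : ℝ) / N))) / N

lemma abs_layered_le {N : ℕ} (hN : 1 ≤ N) {b c : ℕ → Unit4 𝒳 → ℝ} {bd : ℝ}
    (hb : ∀ j o, |b j o| ≤ bd) (hc : ∀ j o, |c j o| ≤ 1) (f : 𝒳 → ℝ) (o : Unit4 𝒳) :
    |layered N b c f o| ≤ bd + 1 := by
  have hNpos : (0 : ℝ) < N := by exact_mod_cast hN
  rw [layered, abs_div, abs_of_pos hNpos, div_le_iff₀ hNpos]
  refine (Finset.abs_sum_le_sum_abs _ _).trans ?_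
  calc _ ≤ ∑ _j ∈ Finset.Icc 1 N, (bd + 1) := Finset.sum_le_sum fun j _ => by
        refine (abs_add_le _ _).trans (add_le_add (hb _ _) ?_)
        rw [abs_mul]
        exact mul_le_one₀ (hc _ _) (abs_nonneg _) (abs_thr_le_one _ _ _)
    _ = _ := by rw [Finset.sum_const, Nat.card_Icc, nsmul_eq_mul, Nat.add_sub_cancel, mul_comm]

variable [MeasurableSpace 𝒳] {P : Measure (Unit4 𝒳)} {F : Set (𝒳 → ℝ)}

lemma measurable_thr {f : 𝒳 → ℝ} (hf : Measurable f) (z : ℝ) : Measurable fun x => thr f x z :=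
  Measurable.ite (measurableSet_le measurable_const hf) measurable_const measurable_const

lemma measurable_layered {N : ℕ} {b c : ℕ → Unit4 𝒳 → ℝ} (hb : ∀ j, Measurable (b j))
    (hc : ∀ j, Measurable (c j)) {f : 𝒳 → ℝ} (hf : Measurable f) :
    Measurable (layered N b c f) := by
  refine (Finset.measurable_sum _ fun j _ => ?_).div_const _
  exact (hb j).add ((hc j).mul ((measurable_thr hf _).comp measurable_feat))

/-- Uniform deviation of sample means from expectations, with the constant of McDiarmid's
inequality for a doubled sample. -/
theorem measure_exists_deviation_le [IsProbabilityMeasure P] (hF : IsPredictionClass P F)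
    {n N : ℕ} (hn : 1 ≤ n) (hN : 1 ≤ N) {b c : ℕ → Unit4 𝒳 → ℝ} {bd R L : ℝ}
    (hbm : ∀ j, Measurable (b j)) (hcm : ∀ j, Measurable (c j))
    (hb : ∀ j o, |b j o| ≤ bd) (hc : ∀ j o, |c j o| ≤ 1)
    (hd : ∀ j o o', ∀ v ∈ ({0, 1} : Set ℝ), ∀ v' ∈ ({0, 1} : Set ℝ),
      |(b j o + c j o * v) - (b j o' + c j o' * v')| ≤ 2)
    (hR : rademacher (thrClass F) n ≤ R) (hL : 0 ≤ L) :
    (Measure.pi fun _ : Fin n => P)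
      {s | ∃ f ∈ F, 2 * R + 2 * √(L / n) <
        (∑ i, layered N b c f (s i)) / n - ∫ o, layered N b c f o ∂P}
      ≤ ENNReal.ofReal (Real.exp (-L)) := by
  have hnpos : (0 : ℝ) < n := by exact_mod_cast hn
  have hNpos : (0 : ℝ) < N := by exact_mod_cast hN
  set π := Measure.pi fun _ : Fin n => P with hπ
  -- This choice balances Chernoff's bound: `λ · 2nR + nλ² - λ n (2R + 2λ) = -nλ² = -L`.
  set lam : ℝ := √(L / n) with hlam
  have hlam0 : 0 ≤ lam := Real.sqrt_nonneg _
  have hlamsq : n * lam ^ 2 = L := by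
    rw [hlam, Real.sq_sqrt (by positivity), mul_div_cancel₀ _ hnpos.ne']
  set w : Fin (n + n) → ℝ := ghostWeight fun _ => true with hw
  have hwle : ∀ i, |w i| ≤ 1 := abs_ghostWeight_le _
  set g : ℕ → (Fin (n + n) → Unit4 𝒳) → ENNReal := fun j s =>
    ENNReal.ofReal (Real.exp (lam * layerSup F ((j : ℝ) / N) (b j) (c j) w s)) with hg
  have hz : ∀ j ∈ Finset.Icc 1 N, (j : ℝ) / N ∈ Set.Icc (0 : ℝ) 1 := by
    intro j hj
    refine ⟨by positivity, ?_⟩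
    rw [div_le_one hNpos]
    exact_mod_cast (Finset.mem_Icc.1 hj).2
  have hgm : ∀ j ∈ Finset.Icc 1 N, AEMeasurable (g j) (Measure.pi fun _ => P) := by
    intro j hj
    have := aemeasurable_layerSup hF (hz j hj) (hbm j) (hcm j) (hb j) (hc j) hwle
    exact (this.const_mul lam).exp.ennreal_ofReal
  -- The exponentials, not the suprema, are averaged over levels. Every level has the same moment
  -- bound, so `N` does not enter.
  set Ψ : (Fin n → Unit4 𝒳) × (Fin n → Unit4 𝒳) → ENNReal := fun q =>
    (∑ j ∈ Finset.Icc 1 N, g j (Fin.append q.1 q.2)) / N with hΨ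
  have hmp := measurePreserving_append P n
  have hgm' : ∀ j ∈ Finset.Icc 1 N,
      AEMeasurable (fun q : (Fin n → Unit4 𝒳) × (Fin n → Unit4 𝒳) => g j (Fin.append q.1 q.2))
        (π.prod π) :=
    fun j hj => (hgm j hj).comp_quasiMeasurePreserving hmp.quasiMeasurePreserving
  have hΨm : AEMeasurable Ψ (π.prod π) :=
    (Finset.aemeasurable_fun_sum _ hgm').div_const _
  have hΨint : ∫⁻ q, Ψ q ∂(π.prod π) ≤ ENNReal.ofReal (Real.exp (lam * (2 * n * R) + n * lam ^ 2)) := by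
    simp only [hΨ, div_eq_mul_inv]
    rw [lintegral_mul_const' _ _ (by simp; omega), lintegral_finsetSum' _ hgm']
    have hj : ∀ j ∈ Finset.Icc 1 N, ∫⁻ q, g j (Fin.append q.1 q.2) ∂(π.prod π)
        ≤ ENNReal.ofReal (Real.exp (lam * (2 * n * R) + n * lam ^ 2)) := by
      intro j hj
      have h1 : ∫⁻ q, g j (Fin.append q.1 q.2) ∂(π.prod π)
          = ∫⁻ s, g j s ∂(Measure.pi fun _ => P) := by
        rw [← hmp.map_eq, lintegral_map' (by rw [hmp.map_eq]; exact hgm j hj) hmp.aemeasurable]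
      rw [h1]
      exact lintegral_exp_layerSup_le hF hn (hz j hj) (hbm j) (hcm j) (hb j) (hc j) (hd j) hR hlam0
    calc _ ≤ (∑ _j ∈ Finset.Icc 1 N,
          ENNReal.ofReal (Real.exp (lam * (2 * n * R) + n * lam ^ 2))) * (N : ENNReal)⁻¹ := by
          gcongr with j hj'
          exact hj j hj'
      _ = _ := by
          rw [Finset.sum_const, Nat.card_Icc, nsmul_eq_mul, Nat.add_sub_cancel, mul_right_comm,
            ENNReal.mul_inv_cancel (by simp; omega) (by simp), one_mul]
  set a : ℝ := 2 * R + 2 * lam with ha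
  -- The possibly nonmeasurable deviation event is enclosed in a superlevel set of a partial
  -- integral of `Ψ`, to which Markov's inequality applies.
  have hsub : {s | ∃ f ∈ F, a < (∑ i, layered N b c f (s i)) / n - ∫ o, layered N b c f o ∂P}
      ⊆ {s | ENNReal.ofReal (Real.exp (lam * (n * a))) ≤ ∫⁻ t, Ψ (s, t) ∂π} := by
    rintro s ⟨f, hf, hfs⟩
    have hYm : Measurable (layered N b c f) := measurable_layered hbm hcm (hF.measurable f hf)
    have hYb := abs_layered_le hN hb hc f
    set Y := layered N b c f with hY
    set Z : (Fin n → Unit4 𝒳) → ℝ := fun t => ∑ i, Y (s i) - ∑ i, Y (t i) with hZ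
    have hYint : Integrable Y P :=
      Integrable.of_bound hYm.aestronglyMeasurable _ (Filter.Eventually.of_forall hYb)
    have hYi : ∀ i : Fin n, Integrable (fun t : Fin n → Unit4 𝒳 => Y (t i)) π := fun i =>
      (measurePreserving_eval (fun _ : Fin n => P) i).integrable_comp_of_integrable hYint
    have hYmean : ∀ i : Fin n, ∫ t, Y (t i) ∂π = ∫ o, Y o ∂P := by
      intro i
      have hev := measurePreserving_eval (fun _ : Fin n => P) i
      conv_rhs => rw [← hev.map_eq, integral_map hev.aemeasurable
        (by rw [hev.map_eq]; exact hYm.aestronglyMeasurable)]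
    have hZint : Integrable Z π :=
      (integrable_const _).sub (integrable_finsetSum _ fun i _ => hYi i)
    have hZmean : ∫ t, Z t ∂π = ∑ i, Y (s i) - n * ∫ o, Y o ∂P := by
      rw [hZ, integral_sub (integrable_const _) (integrable_finsetSum _ fun i _ => hYi i),
        integral_finsetSum _ fun i _ => hYi i]
      simp [hYmean]
    have hZm : Measurable Z := by
      refine measurable_const.sub (Finset.measurable_sum _ fun i _ => ?_)
      exact hYm.comp (measurable_pi_apply i)
    have hZb : ∀ t, |Z t| ≤ n * (bd + 1) + n * (bd + 1) := by
      have hs : ∀ t : Fin n → Unit4 𝒳, |∑ i, Y (t i)| ≤ n * (bd + 1) := fun t =>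
        (Finset.abs_sum_le_sum_abs _ _).trans <| by
          calc _ ≤ ∑ _i : Fin n, (bd + 1) := Finset.sum_le_sum fun i _ => hYb _
            _ = _ := by rw [Finset.sum_const, Finset.card_univ, Fintype.card_fin, nsmul_eq_mul]
      exact fun t => (abs_sub _ _).trans (add_le_add (hs _) (hs _))
    have hexpint : Integrable (fun t => Real.exp (lam * Z t)) π := by
      refine Integrable.of_bound (C := Real.exp (lam * (n * (bd + 1) + n * (bd + 1))))
        (by fun_prop) (Filter.Eventually.of_forall fun t => ?_)
      rw [Real.norm_eq_abs, Real.abs_exp]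
      exact Real.exp_le_exp.2 (mul_le_mul_of_nonneg_left ((le_abs_self _).trans (hZb t)) hlam0)
    -- Jensen over the ghost sample replaces the expectation by a ghost mean inside the exponential.
    have hjensen : Real.exp (lam * ∫ t, Z t ∂π) ≤ ∫ t, Real.exp (lam * Z t) ∂π := by
      rw [← integral_const_mul]
      exact convexOn_exp.map_integral_le Real.continuous_exp.continuousOn isClosed_univ
        (by simp) (hZint.const_mul _) hexpint
    have hmono : Real.exp (lam * (n * a)) ≤ Real.exp (lam * ∫ t, Z t ∂π) := by
      apply Real.exp_le_exp.2
      rw [hZmean]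
      refine mul_le_mul_of_nonneg_left ?_ hlam0
      have h1 := mul_le_mul_of_nonneg_left hfs.le hnpos.le
      have h2 : (n : ℝ) * ((∑ i, Y (s i)) / n - ∫ o, Y o ∂P) = ∑ i, Y (s i) - n * ∫ o, Y o ∂P := by
        field_simp
      linarith
    refine (ENNReal.ofReal_le_ofReal (hmono.trans hjensen)).trans ?_
    rw [ofReal_integral_eq_lintegral_ofReal hexpint
      (Filter.Eventually.of_forall fun s => (Real.exp_pos _).le)]
    refine lintegral_mono fun t => ?_
    set D : ℕ → ℝ := fun j => lam * layerSup F ((j : ℝ) / N) (b j) (c j) w (Fin.append s t) with hD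
    have hcard : ∑ _j ∈ Finset.Icc 1 N, (1 / N : ℝ) = 1 := by
      rw [Finset.sum_const, Nat.card_Icc, nsmul_eq_mul, Nat.add_sub_cancel,
        mul_one_div_cancel hNpos.ne']
    have h1 : lam * Z t ≤ ∑ j ∈ Finset.Icc 1 N, (1 / N : ℝ) • D j := by
      have hterm : Z t = ∑ j ∈ Finset.Icc 1 N, (1 / N : ℝ) * ∑ i, w i *
          (b j (Fin.append s t i) + c j (Fin.append s t i)
            * layerClass F ((j : ℝ) / N) (some ⟨f, hf⟩) (Fin.append s t i).feat) := by
        simp only [Fin.sum_univ_add, hw, ghostWeight, Fin.append_left, Fin.append_right, boolSign,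
          if_true, one_mul, neg_mul, layerClass, Finset.sum_neg_distrib, ← sub_eq_add_neg, hZ, hY,
          layered, ← Finset.sum_div]
        rw [Finset.sum_comm, Finset.sum_comm (s := Finset.univ)]
        rw [← sub_div, ← Finset.sum_sub_distrib, Finset.sum_div]
        exact Finset.sum_congr rfl fun j _ => by ring
      rw [hterm, Finset.mul_sum]
      refine Finset.sum_le_sum fun j _ => ?_
      rw [hD, smul_eq_mul, mul_left_comm]
      refine mul_le_mul_of_nonneg_left (mul_le_mul_of_nonneg_left ?_ hlam0) (by positivity)
      exact le_ciSup (bddAbove_layer (F := F) (z := (j : ℝ) / N) (hb j) (hc j) hwle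
        (Fin.append s t)) (some ⟨f, hf⟩)
    have h2 : Real.exp (lam * Z t) ≤ ∑ j ∈ Finset.Icc 1 N, (1 / N : ℝ) • Real.exp (D j) :=
      (Real.exp_le_exp.2 h1).trans
        (convexOn_exp.map_sum_le (fun _ _ => by positivity) hcard fun _ _ => Set.mem_univ _)
    refine (ENNReal.ofReal_le_ofReal h2).trans (le_of_eq ?_)
    simp only [smul_eq_mul, ← Finset.mul_sum]
    rw [ENNReal.ofReal_mul (by positivity), ENNReal.ofReal_sum_of_nonneg
      (fun _ _ => (Real.exp_pos _).le), one_div, ENNReal.ofReal_inv_of_pos hNpos,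
      ENNReal.ofReal_natCast, mul_comm]
    rfl
  refine (measure_mono hsub).trans ?_
  have hmarkov := mul_meas_ge_le_lintegral₀ (hΨm.lintegral_prod_right')
    (ENNReal.ofReal (Real.exp (lam * (n * a))))
  rw [← lintegral_prod _ hΨm] at hmarkov
  have hpos := Real.exp_pos (lam * (n * a))
  rw [mul_comm, ← ENNReal.le_div_iff_mul_le (Or.inl (by simpa using hpos))
    (Or.inl ENNReal.ofReal_ne_top)] at hmarkov
  refine hmarkov.trans ((ENNReal.div_le_div_right hΨint _).trans (le_of_eq ?_))
  rw [← ENNReal.ofReal_div_of_pos hpos, ← Real.exp_sub]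
  congr 2
  rw [ha]
  linear_combination (-1 : ℝ) * hlamsq

end Deviation

/-! ### Identification -/

section Identification

variable {𝒳 : Type*}

lemma GroupEvent.toSet_eq (e : GroupEvent) :
    (e.toSet : Set (Unit4 𝒳)) = Unit4.out ⁻¹' e.label.outcomes ∩ e.attrSet := by
  ext o
  exact and_comm

/-- The weight of a conditioning event as a function of the unit. -/
noncomputable def popWeight (μ : 𝒳 → ℝ) (e : GroupEvent) (o : Unit4 𝒳) : ℝ :=
  obsWeight e (o.feat, o.attr, μ o.feat)

lemma popWeight_eq_indicator (μ : 𝒳 → ℝ) (e : GroupEvent) :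
    popWeight μ e = e.attrSet.indicator fun o : Unit4 𝒳 => e.label.weight (μ o.feat) := by
  funext o
  simp only [popWeight, obsWeight, GroupEvent.attrSet, Set.indicator_apply, Set.mem_ofPred_eq]

variable [MeasurableSpace 𝒳]

lemma measurable_attr : Measurable (Unit4.attr : Unit4 𝒳 → Fin 2) := measurable_fst.comp measurable_snd

lemma measurable_out : Measurable (Unit4.out : Unit4 𝒳 → ℝ) :=
  measurable_snd.comp (measurable_snd.comp measurable_snd)

lemma sigmaFeat_le : sigmaFeat 𝒳 ≤ (inferInstance : MeasurableSpace (Unit4 𝒳)) :=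
  measurable_feat.comap_le

lemma measurable_sigmaFeat {φ : 𝒳 → ℝ} (hφ : Measurable φ) :
    Measurable[sigmaFeat 𝒳] fun o : Unit4 𝒳 => φ o.feat :=
  hφ.comp (comap_measurable _)

lemma GroupEvent.measurableSet_attrSet (e : GroupEvent) :
    MeasurableSet (e.attrSet : Set (Unit4 𝒳)) :=
  measurable_attr (MeasurableSet.of_discrete (s := {a : Fin 2 | a ∈ e.attrs}))

lemma LabelCond.measurableSet_outcomes (c : LabelCond) : MeasurableSet c.outcomes := by
  cases c
  · exact MeasurableSet.univ
  · exact measurableSet_singleton _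
  · exact measurableSet_singleton _

lemma GroupEvent.measurableSet_toSet (e : GroupEvent) : MeasurableSet (e.toSet : Set (Unit4 𝒳)) := by
  rw [e.toSet_eq]
  exact (measurable_out e.label.measurableSet_outcomes).inter e.measurableSet_attrSet

lemma LabelCond.measurable_weight (c : LabelCond) : Measurable c.weight := by
  cases c
  · exact measurable_const
  · exact measurable_id
  · exact measurable_const.sub measurable_id

lemma LabelCond.weight_mem (c : LabelCond) {m : ℝ} (hm : m ∈ Set.Icc (0 : ℝ) 1) :
    c.weight m ∈ Set.Icc (0 : ℝ) 1 := by
  cases c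
  · exact ⟨zero_le_one, le_rfl⟩
  · exact hm
  · exact ⟨sub_nonneg.2 hm.2, by change 1 - m ≤ 1; linarith [hm.1]⟩

variable {P : Measure (Unit4 𝒳)} [IsProbabilityMeasure P]

/-- Conditional expectations given the features integrate against functions of the features. -/
lemma integral_mul_condExp_feat {φ : 𝒳 → ℝ} (hφ : Measurable φ) {bd : ℝ} (hb : ∀ x, |φ x| ≤ bd)
    {Z : Unit4 𝒳 → ℝ} (hZ : Integrable Z P) :
    ∫ o, φ o.feat * (P[Z | sigmaFeat 𝒳]) o ∂P = ∫ o, φ o.feat * Z o ∂P := by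
  have h := condExp_stronglyMeasurable_mul_of_bound (μ := P) sigmaFeat_le
    (measurable_sigmaFeat hφ).stronglyMeasurable hZ bd
    (Filter.Eventually.of_forall fun o => hb o.feat)
  have h2 := integral_congr_ae h
  rw [integral_condExp sigmaFeat_le] at h2
  exact h2.symm

/-- Conditional probability of the outcome restriction. -/
lemma condProb_outcomes {μ : 𝒳 → ℝ} (hS : SelectiveLabels P μ) (c : LabelCond)
    (hbin : c ≠ .free → ∀ᵐ o ∂P, o.out = 0 ∨ o.out = 1) :
    P⟦Unit4.out ⁻¹' c.outcomes | sigmaFeat 𝒳⟧ =ᵐ[P] fun o => c.weight (μ o.feat) := by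
  have hint : Integrable (Unit4.out : Unit4 𝒳 → ℝ) P :=
    Integrable.of_mem_Icc 0 1 measurable_out.aemeasurable hS.out_mem
  cases c with
  | free =>
    have : (Unit4.out ⁻¹' LabelCond.free.outcomes).indicator (fun _ : Unit4 𝒳 => (1 : ℝ))
        = fun _ => 1 := by
      funext o
      simp [LabelCond.outcomes]
    rw [this, condExp_const sigmaFeat_le]
    rfl
  | pos =>
    have h1 : (Unit4.out ⁻¹' LabelCond.pos.outcomes).indicator (fun _ : Unit4 𝒳 => (1 : ℝ))
        =ᵐ[P] Unit4.out := by
      filter_upwards [hbin (by simp)] with o ho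
      rcases ho with ho | ho <;> simp [LabelCond.outcomes, ho]
    exact (condExp_congr_ae h1).trans hS.reg_eq.symm
  | neg =>
    have h1 : (Unit4.out ⁻¹' LabelCond.neg.outcomes).indicator (fun _ : Unit4 𝒳 => (1 : ℝ))
        =ᵐ[P] (fun _ => (1 : ℝ)) - Unit4.out := by
      filter_upwards [hbin (by simp)] with o ho
      rcases ho with ho | ho <;> simp [LabelCond.outcomes, ho]
    refine (condExp_congr_ae h1).trans
      ((condExp_sub (integrable_const _) hint _).trans ?_)
    rw [condExp_const sigmaFeat_le]
    filter_upwards [hS.reg_eq] with o ho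
    simp [LabelCond.weight, ← ho]

/-- Integrals over a conditioning event, expressed through the outcome regression. -/
lemma setIntegral_toSet {μ : 𝒳 → ℝ} (hS : SelectiveLabels P μ) (e : GroupEvent)
    (hbin : e.label ≠ .free → (∀ᵐ o ∂P, o.out = 0 ∨ o.out = 1) ∧
      CondIndepGivenFeat P Unit4.out Unit4.attr)
    {φ : 𝒳 → ℝ} (hφ : Measurable φ) {bd : ℝ} (hb : ∀ x, |φ x| ≤ bd) :
    ∫ o in e.toSet, φ o.feat ∂P
      = ∫ o in e.attrSet, φ o.feat * e.label.weight (μ o.feat) ∂P := by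
  have hA := e.measurableSet_attrSet (𝒳 := 𝒳)
  have hw : ∀ x, |e.label.weight (μ x)| ≤ 1 := fun x => by
    have := e.label.weight_mem (hS.reg_mem x)
    rw [abs_of_nonneg this.1]
    exact this.2
  -- Given the features, the outcome restriction and the attribute factorize, and the outcome factor
  -- is the weight of the regression. Without a restriction the factor is `1` and no independence is
  -- needed.
  have hind : P⟦e.toSet | sigmaFeat 𝒳⟧ =ᵐ[P]
      fun o => e.label.weight (μ o.feat) * (P⟦e.attrSet | sigmaFeat 𝒳⟧) o := by
    by_cases hfree : e.label = .free
    · have : (e.toSet : Set (Unit4 𝒳)) = e.attrSet := by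
        rw [e.toSet_eq, hfree]
        simp [LabelCond.outcomes]
      rw [this, hfree]
      simp [LabelCond.weight]
    · obtain ⟨h1, h2⟩ := hbin hfree
      have h3 := h2 e.label.outcomes {a : Fin 2 | a ∈ e.attrs} e.label.measurableSet_outcomes
        MeasurableSet.of_discrete
      rw [e.toSet_eq]
      refine h3.trans ?_
      filter_upwards [condProb_outcomes hS e.label fun _ => h1] with o ho
      rw [Pi.mul_apply, ho]
      rfl
  have hone : ∀ s : Set (Unit4 𝒳), MeasurableSet s →
      Integrable (s.indicator fun _ : Unit4 𝒳 => (1 : ℝ)) P := fun s hs =>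
    (integrable_const 1).indicator hs
  have hset : ∀ (s : Set (Unit4 𝒳)) (ψ : 𝒳 → ℝ), MeasurableSet s →
      ∫ o in s, ψ o.feat ∂P = ∫ o, ψ o.feat * s.indicator (fun _ => (1 : ℝ)) o ∂P := by
    intro s ψ hs
    rw [← integral_indicator hs]
    refine integral_congr_ae (Filter.Eventually.of_forall fun o => ?_)
    by_cases ho : o ∈ s <;> simp [ho]
  have hψm : Measurable fun x => φ x * e.label.weight (μ x) :=
    hφ.mul (e.label.measurable_weight.comp hS.measurable_reg)
  have hψb : ∀ x, |φ x * e.label.weight (μ x)| ≤ bd := fun x => by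
    rw [abs_mul]
    exact (mul_le_of_le_one_right (abs_nonneg _) (hw x)).trans (hb x)
  rw [hset _ φ e.measurableSet_toSet, hset _ (fun x => φ x * e.label.weight (μ x)) hA,
    ← integral_mul_condExp_feat hφ hb (hone _ e.measurableSet_toSet),
    ← integral_mul_condExp_feat hψm hψb (hone _ hA)]
  refine integral_congr_ae ?_
  filter_upwards [hind] with o ho
  rw [ho, mul_assoc]

lemma integral_cond_eq {Ω : Type*} [MeasurableSpace Ω] (P : Measure Ω) (s : Set Ω) (g : Ω → ℝ) :
    ∫ o, g o ∂(P[|s]) = (P.real s)⁻¹ * ∫ o in s, g o ∂P := by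
  rw [ProbabilityTheory.cond, integral_smul_measure, ENNReal.toReal_inv, smul_eq_mul]
  rfl

/-- Unnormalized identification: the numerators and denominators of the empirical group means are
sample means of such weights, so their limits are integrals over the true event. -/
lemma integral_popWeight_mul {μ : 𝒳 → ℝ} (hS : SelectiveLabels P μ) (e : GroupEvent)
    (hbin : e.label ≠ .free → (∀ᵐ o ∂P, o.out = 0 ∨ o.out = 1) ∧
      CondIndepGivenFeat P Unit4.out Unit4.attr)
    {φ : 𝒳 → ℝ} (hφ : Measurable φ) {bd : ℝ} (hb : ∀ x, |φ x| ≤ bd) :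
    ∫ o, popWeight μ e o * φ o.feat ∂P = ∫ o in e.toSet, φ o.feat ∂P := by
  rw [setIntegral_toSet hS e hbin hφ hb, ← integral_indicator e.measurableSet_attrSet,
    popWeight_eq_indicator]
  refine integral_congr_ae (Filter.Eventually.of_forall fun o => ?_)
  by_cases ho : o ∈ e.attrSet <;> simp [ho, mul_comm]

lemma integral_popWeight {μ : 𝒳 → ℝ} (hS : SelectiveLabels P μ) (e : GroupEvent)
    (hbin : e.label ≠ .free → (∀ᵐ o ∂P, o.out = 0 ∨ o.out = 1) ∧
      CondIndepGivenFeat P Unit4.out Unit4.attr) :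
    ∫ o, popWeight μ e o ∂P = P.real e.toSet := by
  have := integral_popWeight_mul hS e hbin (φ := fun _ => 1) measurable_const (bd := 1) (by simp)
  simpa using this

/-- The numerator and the denominator carry the same factor `1 / P(A ∈ attrs)`, which cancels. What
remains is the ratio of the unnormalized identities for `f` and for `1`. -/
theorem identification {μ : 𝒳 → ℝ} (hS : SelectiveLabels P μ) (e : GroupEvent)
    (hbin : e.label ≠ .free → (∀ᵐ o ∂P, o.out = 0 ∨ o.out = 1) ∧
      CondIndepGivenFeat P Unit4.out Unit4.attr)
    (hpos : P e.toSet ≠ 0) {f : 𝒳 → ℝ} (hf : Measurable f) {bd : ℝ} (hb : ∀ x, |f x| ≤ bd) :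
    0 < ∫ o, e.label.weight (μ o.feat) ∂(P[|e.attrSet]) ∧
      ∫ o, f o.feat ∂(P[|e.toSet]) =
        (∫ o, f o.feat * e.label.weight (μ o.feat) ∂(P[|e.attrSet])) /
          ∫ o, e.label.weight (μ o.feat) ∂(P[|e.attrSet]) := by
  have hpos' : 0 < P.real e.toSet := ENNReal.toReal_pos hpos (measure_ne_top _ _)
  have hApos : 0 < P.real (e.attrSet : Set (Unit4 𝒳)) :=
    hpos'.trans_le (measureReal_mono fun o ho => ho.1)
  have h1 : ∫ o in e.attrSet, e.label.weight (μ o.feat) ∂P = P.real e.toSet := by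
    have := setIntegral_toSet hS e hbin (φ := fun _ => 1) measurable_const (bd := 1) (by simp)
    simpa using this.symm
  rw [integral_cond_eq, integral_cond_eq, integral_cond_eq, h1, setIntegral_toSet hS e hbin hf hb]
  refine ⟨by positivity, ?_⟩
  field_simp

end Identification

/-! ### Losses -/

section Loss

/-- The projection of the real line onto the unit interval. -/
def clampUnit (y : ℝ) : ℝ := max 0 (min y 1)

lemma clampUnit_mem (y : ℝ) : clampUnit y ∈ Set.Icc (0 : ℝ) 1 :=
  ⟨le_max_left _ _, max_le zero_le_one (min_le_right _ _)⟩

lemma clampUnit_of_mem {y : ℝ} (hy : y ∈ Set.Icc (0 : ℝ) 1) : clampUnit y = y := by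
  rw [clampUnit, min_eq_left hy.2, max_eq_right hy.1]

variable {l : ℝ → ℝ → ℝ}

/-- The loss is controlled on the unit square only. Composing it with the projection onto the square
extends the Lipschitz bound globally, which is the source of all measurability statements about
losses. -/
lemma IsLoss.continuous_clamp (hl : IsLoss l) :
    Continuous fun q : ℝ × ℝ => l (clampUnit q.1) (clampUnit q.2) := by
  have hcl : Continuous clampUnit := by unfold clampUnit; fun_prop
  rw [Metric.continuous_iff]
  intro q ε hε
  have h1 : Continuous fun r : ℝ × ℝ =>
      |clampUnit r.1 - clampUnit q.1| + |clampUnit r.2 - clampUnit q.2| := by fun_prop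
  obtain ⟨δ, hδ, h2⟩ := Metric.continuous_iff.1 h1 q ε hε
  refine ⟨δ, hδ, fun r hr => ?_⟩
  have h3 := h2 r hr
  rw [Real.dist_eq] at h3 ⊢
  simp only [sub_self, abs_zero, add_zero, sub_zero] at h3
  refine lt_of_le_of_lt (hl.lipschitz _ (clampUnit_mem _) _ (clampUnit_mem _) _ (clampUnit_mem _)
    _ (clampUnit_mem _)) (lt_of_abs_lt h3)

lemma IsLoss.measurable_comp (hl : IsLoss l) {Ω : Type*} [MeasurableSpace Ω] {Y U : Ω → ℝ} (hY : Measurable Y)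
    (hU : Measurable U) (hYm : ∀ o, Y o ∈ Set.Icc (0 : ℝ) 1) (hUm : ∀ o, U o ∈ Set.Icc (0 : ℝ) 1) :
    Measurable fun o => l (Y o) (U o) := by
  have h := hl.continuous_clamp.measurable.comp (hY.prodMk hU)
  convert h using 2 with o
  simp [clampUnit_of_mem (hYm o), clampUnit_of_mem (hUm o)]

lemma IsLoss.aemeasurable_comp (hl : IsLoss l) {Ω : Type*} [MeasurableSpace Ω] {P : Measure Ω} {Y U : Ω → ℝ}
    (hY : Measurable Y) (hU : Measurable U) (hYm : ∀ᵐ o ∂P, Y o ∈ Set.Icc (0 : ℝ) 1)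
    (hUm : ∀ o, U o ∈ Set.Icc (0 : ℝ) 1) :
    AEMeasurable (fun o => l (Y o) (U o)) P := by
  have h := hl.continuous_clamp.measurable.comp (hY.prodMk hU)
  refine h.aemeasurable.congr ?_
  filter_upwards [hYm] with o ho
  simp [clampUnit_of_mem ho, clampUnit_of_mem (hUm o)]

lemma IsLoss.integrable_comp (hl : IsLoss l) {Ω : Type*} [MeasurableSpace Ω] {P : Measure Ω}
    [IsProbabilityMeasure P] {Y U : Ω → ℝ}
    (hY : Measurable Y) (hU : Measurable U) (hYm : ∀ᵐ o ∂P, Y o ∈ Set.Icc (0 : ℝ) 1)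
    (hUm : ∀ o, U o ∈ Set.Icc (0 : ℝ) 1) :
    Integrable (fun o => l (Y o) (U o)) P :=
  Integrable.of_mem_Icc 0 1 (hl.aemeasurable_comp hY hU hYm hUm) <| by
    filter_upwards [hYm] with o ho
    exact hl.mem _ ho _ (hUm o)

variable {𝒳 : Type*} [MeasurableSpace 𝒳] {P : Measure (Unit4 𝒳)} [IsProbabilityMeasure P]
  {μ : 𝒳 → ℝ}

lemma lossReg_mem (hl : IsLoss l) (hS : SelectiveLabels P μ) {f : 𝒳 → ℝ} (hf : Measurable f)
    (hfm : ∀ x, f x ∈ Set.Icc (0 : ℝ) 1) : lossReg P μ l f ∈ Set.Icc (0 : ℝ) 1 := by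
  have hint := hl.integrable_comp (P := P) (hS.measurable_reg.comp measurable_feat)
    (hf.comp measurable_feat) (Filter.Eventually.of_forall fun o => hS.reg_mem o.feat)
    fun o => hfm o.feat
  have hmem := fun o : Unit4 𝒳 => hl.mem _ (hS.reg_mem o.feat) _ (hfm o.feat)
  refine ⟨integral_nonneg fun o => (hmem o).1, ?_⟩
  have := integral_mono hint (integrable_const (1 : ℝ)) fun o => (hmem o).2
  simpa [lossReg] using this

lemma loss_mem (hl : IsLoss l) (hS : SelectiveLabels P μ) {f : 𝒳 → ℝ} (hf : Measurable f)
    (hfm : ∀ x, f x ∈ Set.Icc (0 : ℝ) 1) : loss P l f ∈ Set.Icc (0 : ℝ) 1 := by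
  have hint := hl.integrable_comp (P := P) measurable_out
    (hf.comp measurable_feat) hS.out_mem fun o => hfm o.feat
  have hmem : ∀ᵐ o ∂P, l o.out (f o.feat) ∈ Set.Icc (0 : ℝ) 1 := by
    filter_upwards [hS.out_mem] with o ho
    exact hl.mem _ ho _ (hfm o.feat)
  refine ⟨integral_nonneg_of_ae (hmem.mono fun o ho => ho.1), ?_⟩
  have := integral_mono_ae hint (integrable_const (1 : ℝ)) (hmem.mono fun o ho => ho.2)
  simpa [loss] using this

/-- Conditional Jensen on a set determined by the features, at a fixed prediction. -/
lemma setIntegral_loss_le (hl : IsLoss l) (hS : SelectiveLabels P μ) {u : ℝ} (hu : u ∈ Set.Icc (0 : ℝ) 1)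
    (hconv : ConvexOn ℝ (Set.Icc (0 : ℝ) 1) fun y => l y u) {s : Set (Unit4 𝒳)}
    (hs : MeasurableSet[sigmaFeat 𝒳] s) :
    ∫ o in s, l (μ o.feat) u ∂P ≤ ∫ o in s, l o.out u ∂P := by
  have hint : Integrable (Unit4.out : Unit4 𝒳 → ℝ) P :=
    Integrable.of_mem_Icc 0 1 measurable_out.aemeasurable hS.out_mem
  have hint1 := hl.integrable_comp (P := P) (U := fun _ => u) measurable_out measurable_const
    hS.out_mem fun _ => hu
  have hint2 := hl.integrable_comp (P := P) (U := fun _ => u)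
    (hS.measurable_reg.comp measurable_feat) measurable_const
    (Filter.Eventually.of_forall fun o => hS.reg_mem o.feat) fun _ => hu
  have hcont : ContinuousOn (fun y => l y u) (Set.Icc (0 : ℝ) 1) := by
    have h : Continuous fun y : ℝ => l (clampUnit y) (clampUnit u) :=
      hl.continuous_clamp.comp (by fun_prop : Continuous fun y : ℝ => (y, u))
    refine h.continuousOn.congr fun y hy => ?_
    simp only [clampUnit_of_mem hy, clampUnit_of_mem hu]
  have hj := hconv.map_condExp_le (μ := P) sigmaFeat_le hcont.lowerSemicontinuousOn hS.out_mem
    isClosed_Icc hint hint1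
  have h1 := setIntegral_condExp (μ := P) sigmaFeat_le (f := (fun y => l y u) ∘ Unit4.out) hint1 hs
  refine le_trans ?_ h1.le
  refine setIntegral_mono_ae hint2.integrableOn integrable_condExp.integrableOn ?_
  filter_upwards [hj, hS.reg_eq] with o ho ho'
  refine le_trans (le_of_eq ?_) ho
  simp only [Function.comp_apply, ← ho']

/-- Jensen needs a fixed prediction, so `f` is rounded down to multiples of `1/K`. The level sets
depend on the features only and Jensen holds on each; the Lipschitz property costs `1/K` on either
side, and `K` is arbitrary. -/
theorem lossReg_le_loss (hl : IsLoss l) (hS : SelectiveLabels P μ)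
    (hconv : ∀ u ∈ Set.Icc (0 : ℝ) 1, ConvexOn ℝ (Set.Icc (0 : ℝ) 1) fun y => l y u)
    {f : 𝒳 → ℝ} (hf : Measurable f) (hfm : ∀ x, f x ∈ Set.Icc (0 : ℝ) 1) :
    lossReg P μ l f ≤ loss P l f := by
  have key : ∀ K : ℕ, 1 ≤ K → lossReg P μ l f ≤ loss P l f + 2 / K := by
    intro K hK
    have hKpos : (0 : ℝ) < K := by exact_mod_cast hK
    set k : Unit4 𝒳 → ℕ := fun o => ⌊(K : ℝ) * f o.feat⌋₊ with hk
    set u : Unit4 𝒳 → ℝ := fun o => (k o : ℝ) / K with hu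
    have hkK : ∀ o, k o ≤ K := fun o => by
      refine Nat.floor_le_of_le ?_
      exact mul_le_of_le_one_right hKpos.le (hfm o.feat).2
    have hkm : Measurable[sigmaFeat 𝒳] k :=
      Nat.measurable_floor.comp (measurable_sigmaFeat (measurable_const.mul hf))
    have hum : Measurable u :=
      ((measurable_from_top (f := fun i : ℕ => (i : ℝ))).comp (hkm.mono sigmaFeat_le le_rfl)).div_const _
    have hgrid : ∀ i ≤ K, (i : ℝ) / K ∈ Set.Icc (0 : ℝ) 1 := fun i hi =>
      ⟨by positivity, by rw [div_le_one hKpos]; exact_mod_cast hi⟩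
    have hu01 : ∀ o, u o ∈ Set.Icc (0 : ℝ) 1 := fun o => hgrid _ (hkK o)
    have hclose : ∀ o, |u o - f o.feat| ≤ 1 / K := by
      intro o
      have h0 : 0 ≤ (K : ℝ) * f o.feat := mul_nonneg hKpos.le (hfm o.feat).1
      have h1 : (k o : ℝ) ≤ K * f o.feat := Nat.floor_le h0
      have h2 : (K : ℝ) * f o.feat < k o + 1 := Nat.lt_floor_add_one _
      have h3 : u o - f o.feat = (k o - K * f o.feat) / K := by rw [hu]; field_simp
      rw [h3, abs_div, abs_of_pos hKpos]
      gcongr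
      rw [abs_le]
      constructor <;> linarith
    have hreg01 : ∀ᵐ o ∂P, μ (Unit4.feat o) ∈ Set.Icc (0 : ℝ) 1 :=
      Filter.Eventually.of_forall fun o => hS.reg_mem o.feat
    have hregm := hS.measurable_reg.comp (measurable_feat (𝒳 := 𝒳))
    have i1 := hl.integrable_comp (P := P) hregm (hf.comp measurable_feat) hreg01 fun o => hfm o.feat
    have i2 := hl.integrable_comp (P := P) hregm hum hreg01 hu01
    have i3 := hl.integrable_comp (P := P) measurable_out hum hS.out_mem hu01
    have i4 := hl.integrable_comp (P := P) measurable_out (hf.comp measurable_feat) hS.out_mem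
      fun o => hfm o.feat
    have hstep1 : lossReg P μ l f ≤ ∫ o, l (μ o.feat) (u o) ∂P + 1 / K := by
      have := integral_mono i1 (i2.add (integrable_const (1 / (K : ℝ)))) fun o => by
        have h := hl.lipschitz _ (hS.reg_mem o.feat) _ (hfm o.feat) _ (hS.reg_mem o.feat) _ (hu01 o)
        rw [sub_self, abs_zero, zero_add, abs_sub_comm (f o.feat)] at h
        have := (abs_le.1 (h.trans (hclose o))).2
        simp only [Pi.add_apply, Function.comp_apply]
        linarith
      rw [integral_add' i2 (integrable_const _)] at this
      simpa [lossReg] using this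
    have hstep3 : ∫ o, l o.out (u o) ∂P ≤ loss P l f + 1 / K := by
      have := integral_mono_ae i3 (i4.add (integrable_const (1 / (K : ℝ)))) (by
        filter_upwards [hS.out_mem] with o ho
        have h := hl.lipschitz _ ho _ (hu01 o) _ ho _ (hfm o.feat)
        rw [sub_self, abs_zero, zero_add] at h
        have := (abs_le.1 (h.trans (hclose o))).2
        simp only [Pi.add_apply, Function.comp_apply]
        linarith)
      rw [integral_add' i4 (integrable_const _)] at this
      simpa [loss] using this
    have hdecomp : ∀ Y : Unit4 𝒳 → ℝ, Integrable (fun o => l (Y o) (u o)) P →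
        ∫ o, l (Y o) (u o) ∂P
          = ∑ i ∈ Finset.range (K + 1), ∫ o in k ⁻¹' {i}, l (Y o) ((i : ℝ) / K) ∂P := by
      intro Y hY
      have hmeas : ∀ i : ℕ, MeasurableSet (k ⁻¹' {i}) := fun i =>
        (hkm.mono sigmaFeat_le le_rfl) (measurableSet_singleton i)
      have h1 : ∀ i : ℕ, ∫ o in k ⁻¹' {i}, l (Y o) ((i : ℝ) / K) ∂P
          = ∫ o in k ⁻¹' {i}, l (Y o) (u o) ∂P := fun i =>
        setIntegral_congr_fun (hmeas i) fun o (ho : k o = i) => by simp only [hu, ho]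
      simp only [h1]
      rw [← integral_biUnion_finset _ (fun i _ => hmeas i)
        (fun i _ j _ hij => Set.disjoint_left.2 fun o (h : k o = i) (h' : k o = j) =>
          hij (h.symm.trans h')) fun i _ => hY.integrableOn]
      have : ⋃ i ∈ Finset.range (K + 1), k ⁻¹' {i} = Set.univ := by
        ext o
        simp only [Set.mem_iUnion, Set.mem_univ, iff_true]
        exact ⟨k o, Finset.mem_range.2 (Nat.lt_succ_of_le (hkK o)), rfl⟩
      rw [this, setIntegral_univ]
    have hstep2 : ∫ o, l (μ o.feat) (u o) ∂P ≤ ∫ o, l o.out (u o) ∂P := by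
      rw [hdecomp (fun o => μ o.feat) i2, hdecomp _ i3]
      refine Finset.sum_le_sum fun i hi => ?_
      have hi' := hgrid i (Nat.le_of_lt_succ (Finset.mem_range.1 hi))
      exact setIntegral_loss_le hl hS hi' (hconv _ hi') (hkm (measurableSet_singleton i))
    have : (2 : ℝ) / K = 1 / K + 1 / K := by ring
    linarith
  refine le_of_forall_pos_le_add fun ε hε => ?_
  obtain ⟨K, hK⟩ := exists_nat_gt (2 / ε)
  have hKpos : (0 : ℝ) < K := (by positivity : (0 : ℝ) < 2 / ε).trans hK
  refine (key K (by exact_mod_cast hKpos)).trans (add_le_add le_rfl ?_)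
  rw [div_le_iff₀ hKpos]
  rw [div_lt_iff₀ hε] at hK
  linarith

end Loss

/-! ### Discretization -/

section Discretization

variable {N : ℕ} {T : Finset ℝ}

lemma roundOut_mem_set (hT : IsHalfCover N T) {y : ℝ} (hy : y ∈ Set.Icc (0 : ℝ) 1) :
    roundOut N T y ∈ {t : ℝ | t ∈ T ∧ |y - t| ≤ 1 / (2 * (N : ℝ))} := by
  obtain ⟨t, ht, h⟩ := hT.2 y hy
  exact Set.Nonempty.csInf_mem ⟨t, ht, h⟩ (T.finite_toSet.subset fun t ht => ht.1)

lemma roundOut_mem (hT : IsHalfCover N T) {y : ℝ} (hy : y ∈ Set.Icc (0 : ℝ) 1) :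
    roundOut N T y ∈ Set.Icc (0 : ℝ) 1 := hT.1 _ (roundOut_mem_set hT hy).1

lemma abs_sub_roundOut_le (hT : IsHalfCover N T) {y : ℝ} (hy : y ∈ Set.Icc (0 : ℝ) 1) :
    |y - roundOut N T y| ≤ 1 / (2 * (N : ℝ)) := (roundOut_mem_set hT hy).2

lemma measurable_roundOut_comp (hT : IsHalfCover N T) {Ω : Type*} [MeasurableSpace Ω] {Y : Ω → ℝ}
    (hY : Measurable Y) (hYm : ∀ o, Y o ∈ Set.Icc (0 : ℝ) 1) :
    Measurable fun o => roundOut N T (Y o) := by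
  have hne : Nonempty T := by
    obtain ⟨t, ht, -⟩ := hT.2 0 (by simp)
    exact ⟨⟨t, ht⟩⟩
  -- A minimum over the whole finite cover: the default `2` exceeds every cover point, so points
  -- that are too far away never attain it.
  have heq : (fun o => roundOut N T (Y o))
      = fun o => ⨅ t : T, if |Y o - t| ≤ 1 / (2 * (N : ℝ)) then (t : ℝ) else 2 := by
    funext o
    have hfin : (Set.range fun t : T => if |Y o - t| ≤ 1 / (2 * (N : ℝ)) then (t : ℝ) else 2).Finite :=
      Set.finite_range _
    refine le_antisymm (le_ciInf fun t => ?_) ?_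
    · split_ifs with h
      · exact csInf_le (T.finite_toSet.subset fun t ht => ht.1 :
          {t : ℝ | t ∈ T ∧ |Y o - t| ≤ 1 / (2 * (N : ℝ))}.Finite).bddBelow ⟨t.2, h⟩
      · linarith [(roundOut_mem hT (hYm o)).2]
    · refine (ciInf_le hfin.bddBelow ⟨_, (roundOut_mem_set hT (hYm o)).1⟩).trans ?_
      rw [if_pos (roundOut_mem_set hT (hYm o)).2]
  rw [heq]
  refine Measurable.iInf fun t => Measurable.ite ?_ measurable_const measurable_const
  exact measurableSet_le (by fun_prop) measurable_const

variable {𝒳 : Type*}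

lemma thr_grid (hN : 1 ≤ N) {f : 𝒳 → ℝ} (x : 𝒳) (hx : f x ∈ Set.Icc (0 : ℝ) 1) (j : ℕ) :
    thr f x ((j : ℝ) / N) = if j ≤ ⌊(N : ℝ) * f x⌋₊ then 1 else 0 := by
  have hNpos : (0 : ℝ) < N := by exact_mod_cast hN
  unfold thr
  congr 1
  rw [Nat.le_floor_iff (mul_nonneg hNpos.le hx.1), div_le_iff₀ hNpos, mul_comm]

lemma sum_telescope (a : ℕ → ℝ) {J : ℕ} (hJ : J ≤ N) :
    ∑ j ∈ Finset.Icc 1 N, (a j - a (j - 1)) * (if j ≤ J then 1 else 0) = a J - a 0 := by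
  have h1 : ∀ K : ℕ, ∑ j ∈ Finset.Icc 1 K, (a j - a (j - 1)) = a K - a 0 := by
    intro K
    induction K with
    | zero => simp
    | succ K ih => rw [Finset.sum_Icc_succ_top (by omega), ih]; simp
  simp only [mul_ite, mul_one, mul_zero]
  rw [← Finset.sum_filter, ← h1 J]
  congr 1
  ext j
  simp only [Finset.mem_filter, Finset.mem_Icc]
  omega

lemma gridThr_eq (hN : 1 ≤ N) {f : 𝒳 → ℝ} (x : 𝒳) (hx : f x ∈ Set.Icc (0 : ℝ) 1) :
    gridThr N f x = (⌊(N : ℝ) * f x⌋₊ : ℝ) / N := by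
  have hle : ⌊(N : ℝ) * f x⌋₊ ≤ N :=
    Nat.floor_le_of_le (mul_le_of_le_one_right (Nat.cast_nonneg N) hx.2)
  have h := sum_telescope (fun j => (j : ℝ)) hle
  rw [Nat.cast_zero, sub_zero] at h
  rw [gridThr, ← h]
  congr 1
  refine Finset.sum_congr rfl fun j hj => ?_
  have hj1 := (Finset.mem_Icc.1 hj).1
  rw [thr_grid hN x hx, Nat.cast_sub hj1]
  simp

lemma gridThr_mem (hN : 1 ≤ N) {f : 𝒳 → ℝ} (x : 𝒳) (hx : f x ∈ Set.Icc (0 : ℝ) 1) :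
    gridThr N f x ∈ Set.Icc (0 : ℝ) 1 ∧ |gridThr N f x - f x| ≤ 1 / N := by
  have hNpos : (0 : ℝ) < N := by exact_mod_cast hN
  have h0 : 0 ≤ (N : ℝ) * f x := mul_nonneg hNpos.le hx.1
  have h1 := Nat.floor_le h0
  have h2 := Nat.lt_floor_add_one ((N : ℝ) * f x)
  rw [gridThr_eq hN x hx]
  refine ⟨⟨by positivity, ?_⟩, ?_⟩
  · rw [div_le_one hNpos]
    nlinarith [hx.2]
  · have h3 : (⌊(N : ℝ) * f x⌋₊ : ℝ) / N - f x = (⌊(N : ℝ) * f x⌋₊ - N * f x) / N := by field_simp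
    rw [h3, abs_div, abs_of_pos hNpos]
    gcongr
    rw [abs_le]
    constructor <;> linarith

variable {l : ℝ → ℝ → ℝ}

/-- The loss at the midpoints of the grid. -/
noncomputable def midLoss (l : ℝ → ℝ → ℝ) (N : ℕ) (y : ℝ) (j : ℕ) : ℝ :=
  l y (min ((j : ℝ) / N + 1 / (2 * N)) 1)

lemma midpoint_mem (N j : ℕ) : min ((j : ℝ) / N + 1 / (2 * N)) 1 ∈ Set.Icc (0 : ℝ) 1 :=
  ⟨le_min (by positivity) zero_le_one, min_le_right _ _⟩

lemma midLoss_zero (hN : 1 ≤ N) (y : ℝ) : midLoss l N y 0 = l y (1 / (2 * (N : ℝ))) := by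
  have hN1 : (1 : ℝ) ≤ N := by exact_mod_cast hN
  rw [midLoss, Nat.cast_zero, zero_div, zero_add, min_eq_left]
  rw [div_le_one (by positivity)]
  linarith

lemma midLoss_top (hN : 1 ≤ N) (y : ℝ) : midLoss l N y N = l y 1 := by
  have hNpos : (0 : ℝ) < N := by exact_mod_cast hN
  rw [midLoss, div_self hNpos.ne', min_eq_right]
  have : (0 : ℝ) ≤ 1 / (2 * N) := by positivity
  linarith

lemma costFun_eq_midLoss (hN : 1 ≤ N) (y : ℝ) {j : ℕ} (hj : j ∈ Finset.Icc 1 N) :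
    costFun l N y ((j : ℝ) / N) = N * (midLoss l N y j - midLoss l N y (j - 1)) := by
  obtain ⟨hj1, hjN⟩ := Finset.mem_Icc.1 hj
  have hNpos : (0 : ℝ) < N := by exact_mod_cast hN
  have h1 : ((j - 1 : ℕ) : ℝ) / N + 1 / (2 * N) = (j : ℝ) / N - 1 / (2 * N) := by
    rw [Nat.cast_sub hj1]
    field_simp
    push_cast
    ring
  have h2 : (j : ℝ) / N - 1 / (2 * N) ≤ 1 := by
    have h3 : (j : ℝ) / N ≤ 1 := by rw [div_le_one hNpos]; exact_mod_cast hjN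
    have h4 : (0 : ℝ) ≤ 1 / (2 * N) := by positivity
    linarith
  rw [costFun, midLoss, midLoss, h1, min_eq_left h2]

/-- The factor `N` offsets the step `1/N` between consecutive midpoints, and truncation at `1` does
not increase distances. -/
lemma abs_costFun_le (hl : IsLoss l) (hN : 1 ≤ N) {y : ℝ} (hy : y ∈ Set.Icc (0 : ℝ) 1) {j : ℕ}
    (hj : j ∈ Finset.Icc 1 N) : |costFun l N y ((j : ℝ) / N)| ≤ 1 := by
  have hj1 := (Finset.mem_Icc.1 hj).1
  have hNpos : (0 : ℝ) < N := by exact_mod_cast hN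
  rw [costFun_eq_midLoss hN y hj, abs_mul, abs_of_pos hNpos, midLoss, midLoss]
  have h := hl.lipschitz y hy _ (midpoint_mem N j) y hy _ (midpoint_mem N (j - 1))
  rw [sub_self, abs_zero, zero_add] at h
  have h2 : |min ((j : ℝ) / N + 1 / (2 * N)) 1 - min (((j - 1 : ℕ) : ℝ) / N + 1 / (2 * N)) 1|
      ≤ 1 / N := by
    refine (abs_min_sub_min_le_max _ _ _ _).trans ?_
    rw [sub_self, abs_zero, Nat.cast_sub hj1]
    refine max_le (le_of_eq ?_) (by positivity)
    have : (j : ℝ) / N + 1 / (2 * N) - (((j : ℝ) - (1 : ℕ)) / N + 1 / (2 * N)) = 1 / N := by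
      push_cast
      ring
    rw [this, abs_of_pos (by positivity)]
  calc _ ≤ (N : ℝ) * (1 / N) := mul_le_mul_of_nonneg_left (h.trans h2) hNpos.le
    _ = 1 := mul_one_div_cancel hNpos.ne'

/-- Costs are `N` times increments of the midpoint loss, and the classifier keeps exactly the first
`⌊N f(x)⌋` of them, so the sum telescopes. -/
lemma sum_costFun_mul_thr (hN : 1 ≤ N) (y : ℝ) {f : 𝒳 → ℝ} (x : 𝒳)
    (hx : f x ∈ Set.Icc (0 : ℝ) 1) :
    (∑ j ∈ Finset.Icc 1 N, costFun l N y ((j : ℝ) / N) * thr f x ((j : ℝ) / N)) / N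
      = midLoss l N y ⌊(N : ℝ) * f x⌋₊ - l y (1 / (2 * (N : ℝ))) := by
  have hNpos : (0 : ℝ) < N := by exact_mod_cast hN
  have hle : ⌊(N : ℝ) * f x⌋₊ ≤ N :=
    Nat.floor_le_of_le (mul_le_of_le_one_right (Nat.cast_nonneg N) hx.2)
  rw [← midLoss_zero (l := l) hN, ← sum_telescope (midLoss l N y) hle, div_eq_iff hNpos.ne', Finset.sum_mul]
  refine Finset.sum_congr rfl fun j hj => ?_
  rw [costFun_eq_midLoss hN y hj, thr_grid hN x hx]
  ring

/-- The same telescoping with all increments kept; this is the mean slope needed to undo the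
centring in `lossBase`. -/
lemma sum_costFun (hN : 1 ≤ N) (y : ℝ) :
    (∑ j ∈ Finset.Icc 1 N, costFun l N y ((j : ℝ) / N)) / N
      = l y 1 - l y (1 / (2 * (N : ℝ))) := by
  have hNpos : (0 : ℝ) < N := by exact_mod_cast hN
  rw [← midLoss_zero (l := l) hN, ← midLoss_top (l := l) hN, ← sum_telescope (midLoss l N y) le_rfl,
    div_eq_iff hNpos.ne', Finset.sum_mul]
  refine Finset.sum_congr rfl fun j hj => ?_
  rw [costFun_eq_midLoss hN y hj, if_pos (Finset.mem_Icc.1 hj).2]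
  ring

/-- The rounded loss is within `1/N` of the loss. -/
lemma abs_midLoss_sub_le (hl : IsLoss l) (hN : 1 ≤ N) (hT : IsHalfCover N T) {y u : ℝ}
    (hy : y ∈ Set.Icc (0 : ℝ) 1) (hu : u ∈ Set.Icc (0 : ℝ) 1) :
    |midLoss l N (roundOut N T y) ⌊(N : ℝ) * u⌋₊ - l y u| ≤ 1 / N := by
  have hNpos : (0 : ℝ) < N := by exact_mod_cast hN
  have h0 : 0 ≤ (N : ℝ) * u := mul_nonneg hNpos.le hu.1
  have h1 := Nat.floor_le h0
  have h2 := (Nat.lt_floor_add_one ((N : ℝ) * u)).le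
  set J := ⌊(N : ℝ) * u⌋₊ with hJ
  have h3 : (J : ℝ) / N ≤ u := by rw [div_le_iff₀ hNpos]; linarith
  have h4 : u ≤ (J : ℝ) / N + 1 / N := by
    rw [← add_div, le_div_iff₀ hNpos]; linarith
  -- Half of the error comes from rounding the outcome, half from moving the prediction to the
  -- midpoint of its cell.
  have hhalf : (1 : ℝ) / N = 1 / (2 * N) + 1 / (2 * N) := by field_simp; norm_num
  have hpos : (0 : ℝ) ≤ 1 / (2 * N) := by positivity
  have h5 : |min ((J : ℝ) / N + 1 / (2 * N)) 1 - u| ≤ 1 / (2 * N) := by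
    rw [abs_le]
    constructor
    · have : u - 1 / (2 * N) ≤ min ((J : ℝ) / N + 1 / (2 * N)) 1 :=
        le_min (by linarith) (by linarith [hu.2])
      linarith
    · have := min_le_left ((J : ℝ) / N + 1 / (2 * N)) 1
      linarith
  have h6 := abs_sub_roundOut_le hT hy
  rw [abs_sub_comm] at h6
  have h7 := hl.lipschitz _ (roundOut_mem hT hy) _ (midpoint_mem N J) _ hy _ hu
  rw [midLoss, hhalf]
  linarith

end Discretization

/-! ### The empirical processes of the algorithm -/

section Processes

variable {𝒳 : Type*} {N : ℕ} {T : Finset ℝ} {l : ℝ → ℝ → ℝ} {μ : 𝒳 → ℝ}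

/-- Slopes of the loss process. -/
noncomputable def lossSlope (l : ℝ → ℝ → ℝ) (N : ℕ) (T : Finset ℝ) (μ : 𝒳 → ℝ) (j : ℕ)
    (o : Unit4 𝒳) : ℝ :=
  if j ∈ Finset.Icc 1 N then costFun l N (roundOut N T (μ o.feat)) ((j : ℝ) / N) else 0

/-- Intercepts of the loss process, centered so that its layers have range at most two. -/
noncomputable def lossBase (l : ℝ → ℝ → ℝ) (N : ℕ) (T : Finset ℝ) (μ : 𝒳 → ℝ) (j : ℕ)
    (o : Unit4 𝒳) : ℝ :=
  (l (roundOut N T (μ o.feat)) (1 / (2 * (N : ℝ))) + l (roundOut N T (μ o.feat)) 1) / 2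
    - lossSlope l N T μ j o / 2

lemma halfGrid_mem (hN : 1 ≤ N) : (1 : ℝ) / (2 * N) ∈ Set.Icc (0 : ℝ) 1 := by
  have hN1 : (1 : ℝ) ≤ N := by exact_mod_cast hN
  exact ⟨by positivity, by rw [div_le_one (by positivity)]; linarith⟩

lemma abs_lossSlope_le (hl : IsLoss l) (hN : 1 ≤ N) (hT : IsHalfCover N T)
    (hμ : ∀ x, μ x ∈ Set.Icc (0 : ℝ) 1) (j : ℕ) (o : Unit4 𝒳) : |lossSlope l N T μ j o| ≤ 1 := by
  unfold lossSlope
  split_ifs with hj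
  · exact abs_costFun_le hl hN (roundOut_mem hT (hμ _)) hj
  · simp

/-- The mean of two losses lies in `[0,1]`, and subtracting half the slope leaves a perturbation of
at most `1/2` for either value of `v`. This yields the difference bound `2` used in McDiarmid's
inequality; the uncentred intercept `l(y, α/2)` would only give `3`. -/
lemma lossBase_add_mem (hl : IsLoss l) (hN : 1 ≤ N) (hT : IsHalfCover N T)
    (hμ : ∀ x, μ x ∈ Set.Icc (0 : ℝ) 1) (j : ℕ) (o : Unit4 𝒳) {v : ℝ} (hv : v ∈ ({0, 1} : Set ℝ)) :
    lossBase l N T μ j o + lossSlope l N T μ j o * v ∈ Set.Icc (-(1 / 2) : ℝ) (3 / 2) := by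
  obtain ⟨h1, h2⟩ := abs_le.1 (abs_lossSlope_le hl hN hT hμ j o)
  have hr := roundOut_mem hT (hμ o.feat)
  obtain ⟨h3, h4⟩ := hl.mem _ hr _ (halfGrid_mem hN)
  obtain ⟨h5, h6⟩ := hl.mem _ hr 1 (by simp)
  unfold lossBase
  rcases hv with rfl | rfl <;> constructor <;> linarith

/-- On average over levels the subtracted half slopes equal `(l(y,1) - l(y,α/2)) / 2`, which turns
the centred intercept back into `l(y,α/2)`; the threshold part telescopes. -/
lemma layered_loss (hN : 1 ≤ N) {f : 𝒳 → ℝ} (o : Unit4 𝒳) (hf : f o.feat ∈ Set.Icc (0 : ℝ) 1) :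
    layered N (lossBase l N T μ) (lossSlope l N T μ) f o
      = midLoss l N (roundOut N T (μ o.feat)) ⌊(N : ℝ) * f o.feat⌋₊ := by
  have hNpos : (0 : ℝ) < N := by exact_mod_cast hN
  set y := roundOut N T (μ o.feat) with hy
  have h1 := sum_costFun_mul_thr (l := l) hN y o.feat hf
  have h2 := sum_costFun (l := l) hN y
  have h3 : ∑ j ∈ Finset.Icc 1 N, (lossBase l N T μ j o + lossSlope l N T μ j o *
      thr f o.feat ((j : ℝ) / N)) = ∑ j ∈ Finset.Icc 1 N,
      ((l y (1 / (2 * (N : ℝ))) + l y 1) / 2 - costFun l N y ((j : ℝ) / N) / 2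
        + costFun l N y ((j : ℝ) / N) * thr f o.feat ((j : ℝ) / N)) :=
    Finset.sum_congr rfl fun j hj => by rw [lossBase, lossSlope, if_pos hj]
  rw [layered, h3, Finset.sum_add_distrib, Finset.sum_sub_distrib, add_div, h1, sub_div,
    Finset.sum_const, Nat.card_Icc, nsmul_eq_mul, Nat.add_sub_cancel,
    mul_div_cancel_left₀ _ hNpos.ne', ← Finset.sum_div, div_right_comm, h2]
  ring

lemma empCost_add_empConst {n : ℕ} (hN : 1 ≤ N) {f : 𝒳 → ℝ} (hf : ∀ x, f x ∈ Set.Icc (0 : ℝ) 1)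
    (s : Fin n → Unit4 𝒳) :
    empCost l N T (oracleData μ s) f + empConst l N T (oracleData μ s)
      = (∑ i, layered N (lossBase l N T μ) (lossSlope l N T μ) f (s i)) / n := by
  rw [empCost, empConst, ← add_div, ← Finset.sum_add_distrib]
  congr 1
  refine Finset.sum_congr rfl fun i _ => ?_
  rw [layered_loss hN (s i) (hf _)]
  change _ / _ + l (roundOut N T (μ (s i).feat)) _ = _
  have h := sum_costFun_mul_thr (l := l) hN (roundOut N T (μ (s i).feat)) (s i).feat (hf _)
  change (∑ j ∈ Finset.Icc 1 N, costFun l N (roundOut N T (μ (s i).feat)) ((j : ℝ) / N) *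
    thr f (s i).feat ((j : ℝ) / N)) / N + _ = _
  rw [h]
  ring

lemma abs_empCost_le {n : ℕ} (hl : IsLoss l) (hn : 1 ≤ n) (hN : 1 ≤ N) (hT : IsHalfCover N T)
    (hμ : ∀ x, μ x ∈ Set.Icc (0 : ℝ) 1) {f : 𝒳 → ℝ} (hf : ∀ x, f x ∈ Set.Icc (0 : ℝ) 1)
    (s : Fin n → Unit4 𝒳) : |empCost l N T (oracleData μ s) f| ≤ 1 := by
  have hnpos : (0 : ℝ) < n := by exact_mod_cast hn
  rw [empCost, abs_div, abs_of_pos hnpos, div_le_one hnpos]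
  refine (Finset.abs_sum_le_sum_abs _ _).trans ?_
  calc _ ≤ ∑ _i : Fin n, (1 : ℝ) := Finset.sum_le_sum fun i _ => by
        have h := sum_costFun_mul_thr (l := l) hN (roundOut N T (μ (s i).feat)) (s i).feat (hf _)
        change |(∑ j ∈ Finset.Icc 1 N, costFun l N (roundOut N T (μ (s i).feat)) ((j : ℝ) / N) *
          thr f (s i).feat ((j : ℝ) / N)) / N| ≤ 1
        rw [h]
        have hr := roundOut_mem hT (hμ (s i).feat)
        obtain ⟨h1, h2⟩ := hl.mem _ hr _ (midpoint_mem N ⌊(N : ℝ) * f (s i).feat⌋₊)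
        obtain ⟨h3, h4⟩ := hl.mem _ hr _ (halfGrid_mem hN)
        rw [midLoss, abs_le]
        constructor <;> linarith
    _ = n := by simp

lemma empConst_mem {n : ℕ} (hl : IsLoss l) (hn : 1 ≤ n) (hN : 1 ≤ N) (hT : IsHalfCover N T)
    (hμ : ∀ x, μ x ∈ Set.Icc (0 : ℝ) 1) (s : Fin n → Unit4 𝒳) :
    empConst l N T (oracleData μ s) ∈ Set.Icc (0 : ℝ) 1 := by
  have hnpos : (0 : ℝ) < n := by exact_mod_cast hn
  have h : ∀ i, l (roundOut N T (oracleData μ s i).2.2) (1 / (2 * (N : ℝ))) ∈ Set.Icc (0 : ℝ) 1 :=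
    fun i => hl.mem _ (roundOut_mem hT (hμ _)) _ (halfGrid_mem hN)
  rw [empConst]
  refine ⟨div_nonneg (Finset.sum_nonneg fun i _ => (h i).1) hnpos.le, ?_⟩
  rw [div_le_one hnpos]
  calc _ ≤ ∑ _i : Fin n, (1 : ℝ) := Finset.sum_le_sum fun i _ => (h i).2
    _ = n := by simp

lemma layered_mul_left (r : ℝ) (b c : ℕ → Unit4 𝒳 → ℝ) (f : 𝒳 → ℝ) (o : Unit4 𝒳) :
    layered N (fun j o => r * b j o) (fun j o => r * c j o) f o = r * layered N b c f o := by
  rw [layered, layered, ← mul_div_assoc, Finset.mul_sum]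
  congr 1
  exact Finset.sum_congr rfl fun j _ => by ring

/-- Numerators of group means are layered processes without intercept and denominators are those
without slope, so one deviation theorem serves both. -/
lemma layered_zero_base (w : Unit4 𝒳 → ℝ) (f : 𝒳 → ℝ) (o : Unit4 𝒳) :
    layered N (fun _ _ => 0) (fun _ => w) f o = w o * gridThr N f o.feat := by
  rw [layered, gridThr, ← mul_div_assoc, Finset.mul_sum]
  congr 1
  exact Finset.sum_congr rfl fun j _ => by ring

lemma layered_zero_slope (hN : 1 ≤ N) (w : Unit4 𝒳 → ℝ) (f : 𝒳 → ℝ) (o : Unit4 𝒳) :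
    layered N (fun _ => w) (fun _ _ => 0) f o = w o := by
  have hNpos : (0 : ℝ) < N := by exact_mod_cast hN
  rw [layered]
  simp only [zero_mul, add_zero]
  rw [Finset.sum_const, Nat.card_Icc, nsmul_eq_mul, Nat.add_sub_cancel,
    mul_div_cancel_left₀ _ hNpos.ne']

lemma popWeight_mem (hμ : ∀ x, μ x ∈ Set.Icc (0 : ℝ) 1) (e : GroupEvent) (o : Unit4 𝒳) :
    popWeight μ e o ∈ Set.Icc (0 : ℝ) 1 := by
  unfold popWeight obsWeight
  split_ifs
  · exact e.label.weight_mem (hμ _)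
  · simp

variable [MeasurableSpace 𝒳]

lemma measurable_popWeight (hμ : Measurable μ) (e : GroupEvent) : Measurable (popWeight μ e) := by
  rw [popWeight_eq_indicator]
  exact (e.label.measurable_weight.comp (hμ.comp measurable_feat)).indicator e.measurableSet_attrSet

lemma measurable_lossSlope (hl : IsLoss l) (hN : 1 ≤ N) (hT : IsHalfCover N T)
    (hμm : Measurable μ) (hμ : ∀ x, μ x ∈ Set.Icc (0 : ℝ) 1) (j : ℕ) :
    Measurable (lossSlope l N T μ j) := by
  unfold lossSlope
  split_ifs with hj
  · simp only [costFun_eq_midLoss hN _ hj, midLoss]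
    have hr := measurable_roundOut_comp hT (hμm.comp (measurable_feat (𝒳 := 𝒳))) fun o => hμ o.feat
    have h := fun i : ℕ => hl.measurable_comp (U := fun _ => min ((i : ℝ) / N + 1 / (2 * N)) 1)
      hr measurable_const (fun o => roundOut_mem hT (hμ o.feat)) fun _ => midpoint_mem N i
    exact ((h j).sub (h (j - 1))).const_mul _
  · exact measurable_const

lemma measurable_lossBase (hl : IsLoss l) (hN : 1 ≤ N) (hT : IsHalfCover N T)
    (hμm : Measurable μ) (hμ : ∀ x, μ x ∈ Set.Icc (0 : ℝ) 1) (j : ℕ) :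
    Measurable (lossBase l N T μ j) := by
  have hr := measurable_roundOut_comp hT (hμm.comp (measurable_feat (𝒳 := 𝒳))) fun o => hμ o.feat
  have h := fun (u : ℝ) (hu : u ∈ Set.Icc (0 : ℝ) 1) => hl.measurable_comp (U := fun _ => u)
      hr measurable_const (fun o => roundOut_mem hT (hμ o.feat)) fun _ => hu
  exact (((h _ (halfGrid_mem hN)).add (h 1 (by simp))).div_const _).sub
    ((measurable_lossSlope hl hN hT hμm hμ j).div_const _)

variable {P : Measure (Unit4 𝒳)} [IsProbabilityMeasure P]

/-- The expectation of the loss process is the loss, up to the discretization error. -/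
lemma abs_integral_layered_loss_sub_le (hl : IsLoss l) (hN : 1 ≤ N) (hT : IsHalfCover N T)
    (hμm : Measurable μ) (hμ : ∀ x, μ x ∈ Set.Icc (0 : ℝ) 1) {f : 𝒳 → ℝ} (hfm : Measurable f)
    (hf : ∀ x, f x ∈ Set.Icc (0 : ℝ) 1) :
    |∫ o, layered N (lossBase l N T μ) (lossSlope l N T μ) f o ∂P - lossReg P μ l f| ≤ 1 / N := by
  have i1 : Integrable (fun o => layered N (lossBase l N T μ) (lossSlope l N T μ) f o) P := by
    refine Integrable.of_mem_Icc 0 1 (measurable_layered (measurable_lossBase hl hN hT hμm hμ)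
      (measurable_lossSlope hl hN hT hμm hμ) hfm).aemeasurable
      (Filter.Eventually.of_forall fun o => ?_)
    rw [layered_loss hN o (hf _)]
    exact hl.mem _ (roundOut_mem hT (hμ _)) _ (midpoint_mem _ _)
  have i2 := hl.integrable_comp (P := P) (hμm.comp measurable_feat) (hfm.comp measurable_feat)
    (Filter.Eventually.of_forall fun o => hμ o.feat) fun o => hf o.feat
  simp only [Function.comp_apply] at i2
  rw [lossReg, ← integral_sub i1 i2]
  have := norm_integral_le_of_norm_le_const (μ := P) (C := 1 / (N : ℝ))
    (f := fun o => layered N (lossBase l N T μ) (lossSlope l N T μ) f o - l (μ o.feat) (f o.feat))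
    (Filter.Eventually.of_forall fun o => by
      rw [layered_loss hN o (hf _)]
      exact abs_midLoss_sub_le hl hN hT (hμ _) (hf _))
  simpa only [Real.norm_eq_abs, probReal_univ, mul_one] using this

lemma measurable_gridThr {f : 𝒳 → ℝ} (hf : Measurable f) : Measurable (gridThr N f) :=
  (Finset.measurable_sum _ fun _ _ => measurable_thr hf _).div_const _

lemma abs_integral_gridThr_sub_le (hN : 1 ≤ N) (hμm : Measurable μ)
    (hμ : ∀ x, μ x ∈ Set.Icc (0 : ℝ) 1) (e : GroupEvent) {f : 𝒳 → ℝ} (hfm : Measurable f)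
    (hf : ∀ x, f x ∈ Set.Icc (0 : ℝ) 1) :
    |∫ o, popWeight μ e o * gridThr N f o.feat ∂P - ∫ o, popWeight μ e o * f o.feat ∂P|
      ≤ 1 / N := by
  have hw := popWeight_mem hμ e
  have hint : ∀ g : 𝒳 → ℝ, Measurable g → (∀ x, g x ∈ Set.Icc (0 : ℝ) 1) →
      Integrable (fun o => popWeight μ e o * g o.feat) P := fun g hg hg1 =>
    Integrable.of_mem_Icc 0 1
      ((measurable_popWeight hμm e).mul (hg.comp measurable_feat)).aemeasurable
      (Filter.Eventually.of_forall fun o => ⟨mul_nonneg (hw o).1 (hg1 _).1,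
        mul_le_one₀ (hw o).2 (hg1 _).1 (hg1 _).2⟩)
  rw [← integral_sub (hint _ (measurable_gridThr hfm) fun x => (gridThr_mem hN x (hf x)).1)
    (hint _ hfm hf)]
  have := norm_integral_le_of_norm_le_const (μ := P) (C := 1 / (N : ℝ))
    (f := fun o => popWeight μ e o * gridThr N f o.feat - popWeight μ e o * f o.feat)
    (Filter.Eventually.of_forall fun o => by
      rw [Real.norm_eq_abs, ← mul_sub, abs_mul, abs_of_nonneg (hw o).1]
      exact (mul_le_of_le_one_left (abs_nonneg _) (hw o).2).trans (gridThr_mem hN _ (hf _)).2)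
  simpa only [Real.norm_eq_abs, probReal_univ, mul_one] using this

end Processes

/-! ### Samples on which all empirical processes are close to their expectations -/

section GoodSample

variable {𝒳 : Type*} [MeasurableSpace 𝒳]

/-- Uniform closeness of the sample means used by the algorithm to the expectations, with
radius `r₁` for overestimated losses and `r₂` otherwise. -/
structure GoodSample (P : Measure (Unit4 𝒳)) (μ : 𝒳 → ℝ) (l : ℝ → ℝ → ℝ) (F : Set (𝒳 → ℝ))
    (ev : Fin 2 → GroupEvent) (N : ℕ) (T : Finset ℝ) (r₁ r₂ : ℝ) {n : ℕ}
    (s : Fin n → Unit4 𝒳) : Prop where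
  loss_upper : ∀ f ∈ F, (∑ i, layered N (lossBase l N T μ) (lossSlope l N T μ) f (s i)) / n
    - ∫ o, layered N (lossBase l N T μ) (lossSlope l N T μ) f o ∂P ≤ r₁
  loss_lower : ∀ f ∈ F, ∫ o, layered N (lossBase l N T μ) (lossSlope l N T μ) f o ∂P
    - (∑ i, layered N (lossBase l N T μ) (lossSlope l N T μ) f (s i)) / n ≤ r₂
  num : ∀ a, ∀ f ∈ F, |(∑ i, popWeight μ (ev a) (s i) * gridThr N f (s i).feat) / n
    - ∫ o, popWeight μ (ev a) o * gridThr N f o.feat ∂P| ≤ r₂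
  den : ∀ a, |(∑ i, popWeight μ (ev a) (s i)) / n - ∫ o, popWeight μ (ev a) o ∂P| ≤ r₂

variable {P : Measure (Unit4 𝒳)} [IsProbabilityMeasure P] {μ : 𝒳 → ℝ} {l : ℝ → ℝ → ℝ}
  {F : Set (𝒳 → ℝ)} {n N : ℕ} {T : Finset ℝ} {R : ℝ}

lemma measure_loss_deviation_le (hl : IsLoss l) (hF : IsPredictionClass P F) (hn : 1 ≤ n)
    (hN : 1 ≤ N) (hT : IsHalfCover N T) (hμm : Measurable μ) (hμ : ∀ x, μ x ∈ Set.Icc (0 : ℝ) 1)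
    (hR : rademacher (thrClass F) n ≤ R) {L : ℝ} (hL : 0 ≤ L) (t : Bool) :
    (Measure.pi fun _ : Fin n => P) {s | ∃ f ∈ F, 2 * R + 2 * √(L / n) <
      boolSign t * ((∑ i, layered N (lossBase l N T μ) (lossSlope l N T μ) f (s i)) / n
        - ∫ o, layered N (lossBase l N T μ) (lossSlope l N T μ) f o ∂P)}
      ≤ ENNReal.ofReal (Real.exp (-L)) := by
  have hslope := abs_lossSlope_le hl hN hT hμ
  have hmem := fun (j : ℕ) (o : Unit4 𝒳) (v : ℝ) (hv : v ∈ ({0, 1} : Set ℝ)) =>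
    lossBase_add_mem hl hN hT hμ j o hv
  have h := measure_exists_deviation_le hF hn hN (R := R) (L := L) (bd := 2)
    (b := fun j o => boolSign t * lossBase l N T μ j o)
    (c := fun j o => boolSign t * lossSlope l N T μ j o)
    (fun j => (measurable_lossBase hl hN hT hμm hμ j).const_mul _)
    (fun j => (measurable_lossSlope hl hN hT hμm hμ j).const_mul _)
    (fun j o => by
      obtain ⟨h1, h2⟩ := hmem j o 0 (by simp)
      rw [abs_mul, abs_boolSign, one_mul, abs_le]
      constructor <;> linarith)
    (fun j o => by rw [abs_mul, abs_boolSign, one_mul]; exact hslope j o)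
    (fun j o o' v hv v' hv' => by
      obtain ⟨h1, h2⟩ := hmem j o v hv
      obtain ⟨h3, h4⟩ := hmem j o' v' hv'
      rw [mul_assoc, mul_assoc, ← mul_add, ← mul_add, ← mul_sub, abs_mul, abs_boolSign, one_mul,
        abs_le]
      constructor <;> linarith) hR hL
  simpa only [layered_mul_left, ← Finset.mul_sum, integral_const_mul, mul_div_assoc, ← mul_sub]
    using h

lemma measure_weight_deviation_le (hF : IsPredictionClass P F) (hn : 1 ≤ n) (hN : 1 ≤ N)
    {w w' : Unit4 𝒳 → ℝ} (hw : Measurable w) (hw' : Measurable w')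
    (hwm : ∀ o, w o ∈ Set.Icc (0 : ℝ) 1) (hwm' : ∀ o, w' o ∈ Set.Icc (0 : ℝ) 1)
    (hR : rademacher (thrClass F) n ≤ R) {L : ℝ} (hL : 0 ≤ L) (t : Bool) :
    (Measure.pi fun _ : Fin n => P) {s | ∃ f ∈ F, 2 * R + 2 * √(L / n) <
      boolSign t * ((∑ i, layered N (fun _ => w) (fun _ => w') f (s i)) / n
        - ∫ o, layered N (fun _ => w) (fun _ => w') f o ∂P)}
      ≤ ENNReal.ofReal (Real.exp (-L)) := by
  have h := measure_exists_deviation_le hF hn hN (R := R) (L := L) (bd := 1)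
    (b := fun _ o => boolSign t * w o) (c := fun _ o => boolSign t * w' o)
    (fun _ => hw.const_mul _) (fun _ => hw'.const_mul _)
    (fun _ o => by
      rw [abs_mul, abs_boolSign, one_mul, abs_of_nonneg (hwm o).1]
      exact (hwm o).2)
    (fun _ o => by
      rw [abs_mul, abs_boolSign, one_mul, abs_of_nonneg (hwm' o).1]
      exact (hwm' o).2)
    (fun _ o o' v hv v' hv' => by
      have hv1 : ∀ {u x : ℝ}, u ∈ ({0, 1} : Set ℝ) → x ∈ Set.Icc (0 : ℝ) 1 →
          x * u ∈ Set.Icc (0 : ℝ) 1 := by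
        rintro u x (rfl | rfl) hx
        · simp
        · simpa using hx
      obtain ⟨h1, h2⟩ := hv1 hv (hwm' o)
      obtain ⟨h3, h4⟩ := hv1 hv' (hwm' o')
      obtain ⟨h5, h6⟩ := hwm o
      obtain ⟨h7, h8⟩ := hwm o'
      rw [mul_assoc, mul_assoc, ← mul_add, ← mul_add, ← mul_sub, abs_mul, abs_boolSign, one_mul,
        abs_le]
      constructor <;> linarith) hR hL
  have hlay : ∀ f o, layered N (fun _ o => boolSign t * w o) (fun _ o => boolSign t * w' o) f o
      = boolSign t * layered N (fun _ => w) (fun _ => w') f o := fun f o =>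
    layered_mul_left (boolSign t) (fun _ => w) (fun _ => w') f o
  simpa only [hlay, ← Finset.mul_sum, integral_const_mul, mul_div_assoc, ← mul_sub] using h

/-- A union bound over ten one-sided events. Overestimated losses get the larger share `δ/8`, since
only that radius has to fit into the tolerance, which is calibrated with `ln(8/δ)`. -/
theorem measure_not_goodSample_le (hl : IsLoss l) (hF : IsPredictionClass P F)
    (ev : Fin 2 → GroupEvent) (hn : 1 ≤ n)
    (hN : 1 ≤ N) (hT : IsHalfCover N T) (hμm : Measurable μ) (hμ : ∀ x, μ x ∈ Set.Icc (0 : ℝ) 1)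
    (hR : rademacher (thrClass F) n ≤ R) {δ : ℝ} (hδ0 : 0 < δ) (hδ1 : δ < 1) :
    (Measure.pi fun _ : Fin n => P) {s | ¬ GoodSample P μ l F ev N T
      (2 * R + 2 * √(Real.log (8 / δ) / n)) (2 * R + 2 * √(Real.log (16 / δ) / n)) s}
      ≤ ENNReal.ofReal δ := by
  set π := Measure.pi fun _ : Fin n => P with hπ
  set r₁ := 2 * R + 2 * √(Real.log (8 / δ) / n) with hr₁
  set r₂ := 2 * R + 2 * √(Real.log (16 / δ) / n) with hr₂
  have hlog : ∀ c : ℝ, 1 ≤ c → 0 ≤ Real.log (c / δ) ∧ Real.exp (-Real.log (c / δ)) = δ / c := by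
    intro c hc
    have hcpos : 0 < c := by linarith
    refine ⟨Real.log_nonneg ?_, ?_⟩
    · rw [le_div_iff₀ hδ0]
      linarith
    · rw [← Real.log_inv, Real.exp_log (by positivity), inv_div]
  obtain ⟨hL8, hexp8⟩ := hlog 8 (by norm_num)
  obtain ⟨hL16, hexp16⟩ := hlog 16 (by norm_num)
  set A : Set (Fin n → Unit4 𝒳) := {s | ∃ f ∈ F, r₁ < boolSign true *
    ((∑ i, layered N (lossBase l N T μ) (lossSlope l N T μ) f (s i)) / n
        - ∫ o, layered N (lossBase l N T μ) (lossSlope l N T μ) f o ∂P)} with hA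
  set B : Set (Fin n → Unit4 𝒳) := {s | ∃ f ∈ F, r₂ < boolSign false *
    ((∑ i, layered N (lossBase l N T μ) (lossSlope l N T μ) f (s i)) / n
        - ∫ o, layered N (lossBase l N T μ) (lossSlope l N T μ) f o ∂P)} with hB
  -- Eight events, indexed by the group, by denominator (`true`) or numerator (`false`), and by the
  -- sign of the deviation. Together with `A` and `B` they use `11δ/16`.
  set D : Fin 2 × Bool × Bool → Set (Fin n → Unit4 𝒳) := fun q => {s | ∃ f ∈ F, r₂ <
    boolSign q.2.2 * ((∑ i, layered N (fun _ => if q.2.1 then popWeight μ (ev q.1) else 0)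
      (fun _ => if q.2.1 then 0 else popWeight μ (ev q.1)) f (s i)) / n
        - ∫ o, layered N (fun _ => if q.2.1 then popWeight μ (ev q.1) else 0)
      (fun _ => if q.2.1 then 0 else popWeight μ (ev q.1)) f o ∂P)} with hD
  have hAle : π A ≤ ENNReal.ofReal (δ / 8) := by
    have := measure_loss_deviation_le hl hF hn hN hT hμm hμ hR hL8 true
    rwa [hexp8] at this
  have hBle : π B ≤ ENNReal.ofReal (δ / 16) := by
    have := measure_loss_deviation_le hl hF hn hN hT hμm hμ hR hL16 false
    rwa [hexp16] at this
  have hDle : ∀ q, π (D q) ≤ ENNReal.ofReal (δ / 16) := by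
    intro q
    have hm := measurable_popWeight hμm (ev q.1)
    have hmem := popWeight_mem hμ (ev q.1)
    have h0 : Measurable (0 : Unit4 𝒳 → ℝ) := measurable_const
    have h01 : ∀ o, (0 : Unit4 𝒳 → ℝ) o ∈ Set.Icc (0 : ℝ) 1 := fun _ => by simp
    have := measure_weight_deviation_le (P := P) hF hn hN
      (w := if q.2.1 then popWeight μ (ev q.1) else 0)
      (w' := if q.2.1 then 0 else popWeight μ (ev q.1))
      (by split_ifs <;> assumption) (by split_ifs <;> assumption)
      (by split_ifs <;> assumption) (by split_ifs <;> assumption) hR hL16 q.2.2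
    rwa [hexp16] at this
  have hsub : {s | ¬ GoodSample P μ l F ev N T r₁ r₂ s} ⊆ A ∪ B ∪ ⋃ q, D q := by
    intro s hs
    by_contra hno
    simp only [Set.mem_union, Set.mem_iUnion, not_or, not_exists] at hno
    obtain ⟨⟨hnA, hnB⟩, hnD⟩ := hno
    simp only [hA, hB, hD, Set.mem_ofPred_eq, not_exists, not_and, not_lt] at hnA hnB hnD
    refine hs ⟨fun f hf => ?_, fun f hf => ?_, fun a f hf => ?_, fun a => ?_⟩
    · have := hnA f hf
      simpa [boolSign] using this
    · have := hnB f hf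
      simpa [boolSign] using this
    · have h1 := hnD (a, false, true) f hf
      have h2 := hnD (a, false, false) f hf
      have hz := fun o => layered_zero_base (N := N) (popWeight μ (ev a)) f o
      have hz0 : (fun _ : ℕ => (0 : Unit4 𝒳 → ℝ)) = fun _ _ => 0 := rfl
      simp only [Bool.false_eq_true, if_false, hz0, hz, boolSign, if_true, one_mul, neg_mul] at h1 h2
      rw [abs_le]
      constructor <;> linarith
    · obtain ⟨f, hf⟩ := hF.nonempty
      have h1 := hnD (a, true, true) f hf
      have h2 := hnD (a, true, false) f hf
      have hz := fun o => layered_zero_slope hN (popWeight μ (ev a)) f o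
      have hz0 : (fun _ : ℕ => (0 : Unit4 𝒳 → ℝ)) = fun _ _ => 0 := rfl
      simp only [Bool.false_eq_true, if_false, hz0, hz, boolSign, if_true, one_mul, neg_mul] at h1 h2
      rw [abs_le]
      constructor <;> linarith
  calc π {s | ¬ GoodSample P μ l F ev N T r₁ r₂ s} ≤ π (A ∪ B ∪ ⋃ q, D q) := measure_mono hsub
    _ ≤ π A + π B + ∑ q, π (D q) :=
        (measure_union_le _ _).trans (add_le_add (measure_union_le _ _) (measure_iUnion_fintype_le _ _))
    _ ≤ ENNReal.ofReal (δ / 8) + ENNReal.ofReal (δ / 16)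
        + ∑ _q : Fin 2 × Bool × Bool, ENNReal.ofReal (δ / 16) :=
        add_le_add (add_le_add hAle hBle) (Finset.sum_le_sum fun q _ => hDle q)
    _ = ENNReal.ofReal (δ / 8 + δ / 16 + 8 * (δ / 16)) := by
        rw [Finset.sum_const, Finset.card_univ, nsmul_eq_mul,
          ENNReal.ofReal_add (by positivity) (by positivity),
          ENNReal.ofReal_add (by positivity) (by positivity),
          ENNReal.ofReal_mul (by norm_num : (0 : ℝ) ≤ 8)]
        congr 2
        simp [Fintype.card_prod]
    _ ≤ ENNReal.ofReal δ := ENNReal.ofReal_le_ofReal (by linarith)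

end GoodSample

/-! ### Guarantees on good samples -/

section Guarantee

/-- With `q = Nh / Dh ∈ [0,1]`, the difference is `((Nh - Nu) - q (Dh - De)) / De`. Only the
population denominator has to stay away from zero. -/
lemma abs_ratio_sub_le {Nh Dh Nu De d₁ d₂ p : ℝ} (hN0 : 0 ≤ Nh) (hND : Nh ≤ Dh) (hp : 0 < p)
    (hpD : p ≤ De) (h1 : |Nh - Nu| ≤ d₁) (h2 : |Dh - De| ≤ d₂) :
    |Nh / Dh - Nu / De| ≤ (d₁ + d₂) / p := by
  have hDe : 0 < De := hp.trans_le hpD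
  have hDh : 0 ≤ Dh := hN0.trans hND
  have hr0 : 0 ≤ Nh / Dh := div_nonneg hN0 hDh
  have hr1 : Nh / Dh ≤ 1 := div_le_one_of_le₀ hND hDh
  have hmul : Nh / Dh * Dh = Nh := by
    -- An empty group has vanishing numerator as well, and `0 / 0 = 0` is consistent with the
    -- identity.
    rcases hDh.eq_or_lt with h | h
    · have : Nh = 0 := le_antisymm (by linarith) hN0
      rw [this]
      simp
    · exact div_mul_cancel₀ _ h.ne'
  have heq : Nh / Dh - Nu / De = ((Nh - Nu) - Nh / Dh * (Dh - De)) / De := by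
    rw [mul_sub, hmul]
    field_simp
    ring
  have hd1 : 0 ≤ d₁ := (abs_nonneg _).trans h1
  have hd2 : 0 ≤ d₂ := (abs_nonneg _).trans h2
  rw [heq, abs_div, abs_of_pos hDe]
  refine (div_le_div_of_nonneg_right ((abs_sub _ _).trans (add_le_add h1 ?_)) hDe.le).trans
    (div_le_div_of_nonneg_left (add_nonneg hd1 hd2) hp hpD)
  rw [abs_mul, abs_of_nonneg hr0]
  exact (mul_le_of_le_one_left (abs_nonneg _) hr1).trans h2

variable {𝒳 : Type*} {n N : ℕ} {T : Finset ℝ} {μ : 𝒳 → ℝ} {l : ℝ → ℝ → ℝ}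

/-- The group averages that make up the empirical disparity. -/
noncomputable def groupMean (e : GroupEvent) (N : ℕ) (μ : 𝒳 → ℝ) (s : Fin n → Unit4 𝒳)
    (f : 𝒳 → ℝ) : ℝ :=
  (∑ i, popWeight μ e (s i) * gridThr N f (s i).feat) / ∑ i, popWeight μ e (s i)

lemma empDisparity_eq (β : Fin 2 → ℝ) (ev : Fin 2 → GroupEvent) (s : Fin n → Unit4 𝒳)
    (f : 𝒳 → ℝ) :
    empDisparity β ev N (oracleData μ s) f
      = β 0 * groupMean (ev 0) N μ s f + β 1 * groupMean (ev 1) N μ s f :=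
  Fin.sum_univ_two _

lemma sum_popWeight_mul_mem (hμ : ∀ x, μ x ∈ Set.Icc (0 : ℝ) 1) (hN : 1 ≤ N) (e : GroupEvent)
    (s : Fin n → Unit4 𝒳) {f : 𝒳 → ℝ} (hf : ∀ x, f x ∈ Set.Icc (0 : ℝ) 1) :
    0 ≤ ∑ i, popWeight μ e (s i) * gridThr N f (s i).feat ∧
      ∑ i, popWeight μ e (s i) * gridThr N f (s i).feat ≤ ∑ i, popWeight μ e (s i) := by
  have hg := fun x => (gridThr_mem (N := N) hN x (hf x)).1
  have hw := popWeight_mem hμ e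
  exact ⟨Finset.sum_nonneg fun i _ => mul_nonneg (hw _).1 (hg _).1,
    Finset.sum_le_sum fun i _ => mul_le_of_le_one_right (hw _).1 (hg _).2⟩

lemma groupMean_mem (hμ : ∀ x, μ x ∈ Set.Icc (0 : ℝ) 1) (hN : 1 ≤ N) (e : GroupEvent)
    (s : Fin n → Unit4 𝒳) {f : 𝒳 → ℝ} (hf : ∀ x, f x ∈ Set.Icc (0 : ℝ) 1) :
    groupMean e N μ s f ∈ Set.Icc (0 : ℝ) 1 := by
  obtain ⟨h0, h1⟩ := sum_popWeight_mul_mem hμ hN e s hf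
  exact ⟨div_nonneg h0 (h0.trans h1), div_le_one_of_le₀ h1 (h0.trans h1)⟩

/-- The empirical disparity takes values in an interval of length `|β₀| + |β₁|`. -/
lemma empDisparity_mem (hμ : ∀ x, μ x ∈ Set.Icc (0 : ℝ) 1) (hN : 1 ≤ N) (β : Fin 2 → ℝ)
    (ev : Fin 2 → GroupEvent) (s : Fin n → Unit4 𝒳) {f : 𝒳 → ℝ}
    (hf : ∀ x, f x ∈ Set.Icc (0 : ℝ) 1) :
    empDisparity β ev N (oracleData μ s) f ∈
      Set.Icc (min (β 0) 0 + min (β 1) 0) (min (β 0) 0 + min (β 1) 0 + (|β 0| + |β 1|)) := by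
  have key : ∀ b m : ℝ, m ∈ Set.Icc (0 : ℝ) 1 → b * m ∈ Set.Icc (min b 0) (min b 0 + |b|) := by
    rintro b m ⟨h0, h1⟩
    rcases le_total 0 b with hb | hb
    · rw [min_eq_right hb, abs_of_nonneg hb]
      constructor <;> nlinarith
    · rw [min_eq_left hb, abs_of_nonpos hb]
      constructor <;> nlinarith
  rw [empDisparity_eq]
  obtain ⟨h1, h2⟩ := key (β 0) _ (groupMean_mem hμ hN (ev 0) s hf)
  obtain ⟨h3, h4⟩ := key (β 1) _ (groupMean_mem hμ hN (ev 1) s hf)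
  constructor <;> linarith

lemma abs_empDisparity_le (hμ : ∀ x, μ x ∈ Set.Icc (0 : ℝ) 1) (hN : 1 ≤ N) (β : Fin 2 → ℝ)
    (ev : Fin 2 → GroupEvent) (s : Fin n → Unit4 𝒳) {f : 𝒳 → ℝ}
    (hf : ∀ x, f x ∈ Set.Icc (0 : ℝ) 1) :
    |empDisparity β ev N (oracleData μ s) f| ≤ |β 0| + |β 1| := by
  have h : ∀ a, |β a * groupMean (ev a) N μ s f| ≤ |β a| := fun a => by
    have := groupMean_mem hμ hN (ev a) s hf
    rw [abs_mul, abs_of_nonneg this.1]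
    exact mul_le_of_le_one_right (abs_nonneg _) this.2
  rw [empDisparity_eq]
  exact (abs_add_le _ _).trans (add_le_add (h 0) (h 1))

variable {F : Set (𝒳 → ℝ)} {ev : Fin 2 → GroupEvent} {r₁ r₂ : ℝ} {s : Fin n → Unit4 𝒳}

/-- Termination of the algorithm on every sample. -/
theorem egInput_exists_stopsAt (hl : IsLoss l) (hμ : ∀ x, μ x ∈ Set.Icc (0 : ℝ) 1)
    (hF : F.Nonempty) (hFm : ∀ f ∈ F, ∀ x, f x ∈ Set.Icc (0 : ℝ) 1) (hn : 1 ≤ n) (hN : 1 ≤ N) (hT : IsHalfCover N T)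
    {β : Fin 2 → ℝ} {φ ε C' C'' B ν : ℝ} (hε : 0 ≤ ε) (hC' : 0 ≤ C') (hC'' : 0 ≤ C'') (hB : 0 < B)
    (hν : 0 < ν) {best : ℝ → F} :
    let I := egInput F β ev l N T φ ε C' C'' B ν (oracleData μ s)
    I.IsBestResponse best → ∃ t : ℕ, I.StopsAt best t ∧ (t : ℝ) + 1 ≤
      4 * (2 + ε + (C' * (n : ℝ) ^ (-φ) + C'' * (n : ℝ) ^ (-(1 / 2) : ℝ))) ^ 2 * B ^ 2 / ν ^ 2
        + 2 := by
  intro I hbest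
  set r' := 2 + ε + (C' * (n : ℝ) ^ (-φ) + C'' * (n : ℝ) ^ (-(1 / 2) : ℝ)) with hr'
  have : Nonempty F := hF.to_subtype
  have htol : I.tol = ε - empConst l N T (oracleData μ s) + C' * (n : ℝ) ^ (-φ)
      + C'' * (n : ℝ) ^ (-(1 / 2) : ℝ) := rfl
  have h1 : 0 ≤ C' * (n : ℝ) ^ (-φ) := by positivity
  have h2 : 0 ≤ C'' * (n : ℝ) ^ (-(1 / 2) : ℝ) := by positivity
  -- Of the constant `2`, one unit bounds the cost and one bounds `ĉ₀`.
  have hle : ∀ f : F, |I.cost f - I.tol| ≤ r' := fun f => by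
    obtain ⟨h3, h4⟩ := abs_le.1 (abs_empCost_le hl hn hN hT hμ (hFm f f.2) s)
    obtain ⟨h5, h6⟩ := empConst_mem hl hn hN hT hμ s
    have h7 : I.cost f = empCost l N T (oracleData μ s) f := rfl
    rw [abs_le, htol, h7]
    constructor <;> linarith
  have hbdd : BddAbove (Set.range fun f : F => |I.cost f - I.tol|) :=
    ⟨r', by rintro _ ⟨f, rfl⟩; exact hle f⟩
  exact I.exists_stopsAt hbest hB hν (r := ⨆ f : F, |I.cost f - I.tol|)
    (Real.iSup_nonneg fun f => abs_nonneg _) (le_ciSup hbdd) (ciSup_le hle) rfl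

variable [MeasurableSpace 𝒳] {P : Measure (Unit4 𝒳)} [IsProbabilityMeasure P]

/-- Ratio stability with numerator error `r₂ + 1/N`, sampling plus discretization, and denominator
error `r₂`. Groups with `β a = 0` contribute nothing, so their events may be null. -/
lemma GoodSample.abs_empDisparity_sub_le (hs : GoodSample P μ l F ev N T r₁ r₂ s)
    (hS : SelectiveLabels P μ) (hF : IsPredictionClass P F) (hn : 1 ≤ n) (hN : 1 ≤ N)
    (hbin : (∃ a, (ev a).label ≠ LabelCond.free) →
      (∀ᵐ o ∂P, o.out = 0 ∨ o.out = 1) ∧ CondIndepGivenFeat P Unit4.out Unit4.attr)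
    {β : Fin 2 → ℝ} {p : ℝ} (hp : 0 < p) (hev : ∀ a, β a ≠ 0 → p ≤ P.real (ev a).toSet)
    {f : 𝒳 → ℝ} (hf : f ∈ F) :
    |empDisparity β ev N (oracleData μ s) f - disparity P β ev f|
      ≤ (|β 0| + |β 1|) * ((2 * r₂ + 1 / N) / p) := by
  have hnpos : (0 : ℝ) < n := by exact_mod_cast hn
  have hfm := hF.measurable f hf
  have hf01 := hF.mem f hf
  have hμ := hS.reg_mem
  have hr2 : 0 ≤ r₂ := (abs_nonneg _).trans (hs.den 0)
  have hΔ : 0 ≤ (2 * r₂ + 1 / (N : ℝ)) / p := by positivity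
  have key : ∀ a, |β a * groupMean (ev a) N μ s f - β a * ∫ o, f o.feat ∂(P[|(ev a).toSet])|
      ≤ |β a| * ((2 * r₂ + 1 / N) / p) := by
    intro a
    rw [← mul_sub, abs_mul]
    by_cases hβ : β a = 0
    · simp [hβ]
    refine mul_le_mul_of_nonneg_left ?_ (abs_nonneg _)
    have hb : (ev a).label ≠ .free → (∀ᵐ o ∂P, o.out = 0 ∨ o.out = 1) ∧
        CondIndepGivenFeat P Unit4.out Unit4.attr := fun h => hbin ⟨a, h⟩
    have habs : ∀ x, |f x| ≤ 1 := fun x => by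
      rw [abs_of_nonneg (hf01 x).1]
      exact (hf01 x).2
    have hnum := integral_popWeight_mul hS (ev a) hb hfm habs
    have hden := integral_popWeight hS (ev a) hb
    have h1 : ∫ o, f o.feat ∂(P[|(ev a).toSet])
        = (∫ o, popWeight μ (ev a) o * f o.feat ∂P) / ∫ o, popWeight μ (ev a) o ∂P := by
      rw [integral_cond_eq, hnum, hden, div_eq_inv_mul]
    obtain ⟨h0, hle⟩ := sum_popWeight_mul_mem hμ hN (ev a) s hf01
    have h2 : groupMean (ev a) N μ s f
        = ((∑ i, popWeight μ (ev a) (s i) * gridThr N f (s i).feat) / n)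
          / ((∑ i, popWeight μ (ev a) (s i)) / n) := by
      rw [div_div_div_cancel_right₀ hnpos.ne']
      rfl
    rw [h1, h2]
    have h3 : 2 * r₂ + 1 / (N : ℝ) = (r₂ + 1 / N) + r₂ := by ring
    rw [h3]
    refine abs_ratio_sub_le (div_nonneg h0 hnpos.le) (div_le_div_of_nonneg_right hle hnpos.le) hp
      (by rw [hden]; exact hev a hβ) ?_ (hs.den a)
    exact (abs_sub_le _ _ _).trans (add_le_add (hs.num a f hf)
      (abs_integral_gridThr_sub_le hN hS.measurable_reg hμ (ev a) hfm hf01))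
  rw [empDisparity_eq, disparity, Fin.sum_univ_two, add_sub_add_comm, add_mul]
  exact (abs_add_le _ _).trans (add_le_add (key 0) (key 1))

/-- The algorithm's guarantees on a good sample. -/
theorem GoodSample.guarantee (hs : GoodSample P μ l F ev N T r₁ r₂ s) (hl : IsLoss l)
    (hS : SelectiveLabels P μ) (hF : IsPredictionClass P F) (hn : 1 ≤ n) (hN : 1 ≤ N)
    (hT : IsHalfCover N T)
    (hbin : (∃ a, (ev a).label ≠ LabelCond.free) →
      (∀ᵐ o ∂P, o.out = 0 ∨ o.out = 1) ∧ CondIndepGivenFeat P Unit4.out Unit4.attr)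
    {β : Fin 2 → ℝ} {p : ℝ} (hp : 0 < p) (hev : ∀ a, β a ≠ 0 → p ≤ P.real (ev a).toSet)
    {φ ε C' C'' B ν : ℝ} (hB : 0 < B)
    (hr₁ : r₁ + 1 / N ≤ C' * (n : ℝ) ^ (-φ) + C'' * (n : ℝ) ^ (-(1 / 2) : ℝ))
    {best : ℝ → F} {t : ℕ} :
    let I := egInput F β ev l N T φ ε C' C'' B ν (oracleData μ s)
    I.IsBestResponse best → I.StopsAt best t →
    (∃ Qhat : PMF F, I.returned best t = some Qhat ∧
      avg Qhat (fun f => lossReg P μ l f) ≤ ε + (C' * (n : ℝ) ^ (-φ) + C'' * (n : ℝ) ^ (-(1 / 2) : ℝ)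
        + (|β 0| + |β 1| + 2 * ν) / B + (r₂ + 1 / N)) ∧
      ∀ Q : PMF F, avg Q (fun f => lossReg P μ l f) ≤ ε →
        avg Qhat (fun f => disparity P β ev f) ≤ avg Q (fun f => disparity P β ev f)
          + (2 * ν + 2 * ((|β 0| + |β 1|) * ((2 * r₂ + 1 / N) / p)))) ∨
    (I.returned best t = none ∧ ¬ ∃ Q : PMF F, avg Q (fun f => lossReg P μ l f) ≤ ε) := by
  intro I hbest hstops
  have hμ := hS.reg_mem
  have hdisp : ∀ f : F, |I.disp f| ≤ |β 0| + |β 1| := fun f =>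
    abs_empDisparity_le hμ hN β ev s (hF.mem f f.2)
  have hcost : ∀ f : F, |I.cost f| ≤ 1 := fun f => abs_empCost_le hl hn hN hT hμ (hF.mem f f.2) s
  have htol : I.tol = ε - empConst l N T (oracleData μ s) + C' * (n : ℝ) ^ (-φ)
      + C'' * (n : ℝ) ^ (-(1 / 2) : ℝ) := rfl
  have hreg : ∀ f : F, |lossReg P μ l f| ≤ 1 := fun f => by
    have := lossReg_mem (P := P) hl hS (hF.measurable f f.2) (hF.mem f f.2)
    rw [abs_of_nonneg this.1]
    exact this.2
  set c₀ := empConst l N T (oracleData μ s) with hc₀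
  have hproc : ∀ f : F, I.cost f + c₀
      = (∑ i, layered N (lossBase l N T μ) (lossSlope l N T μ) f (s i)) / n := fun f =>
    empCost_add_empConst hN (hF.mem f f.2) s
  have hdisc := fun f : F => abs_le.1 (abs_integral_layered_loss_sub_le (P := P) hl hN hT
    hS.measurable_reg hμ (hF.measurable f f.2) (hF.mem f f.2))
  have hupper : ∀ f : F, I.cost f ≤ lossReg P μ l f + (r₁ + 1 / N - c₀) := fun f => by
    linarith [hproc f, (hdisc f).2, hs.loss_upper f f.2]
  have hlower : ∀ f : F, lossReg P μ l f ≤ I.cost f + (c₀ + r₂ + 1 / N) := fun f => by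
    linarith [hproc f, (hdisc f).1, hs.loss_lower f f.2]
  -- The slack built into the tolerance covers deviation and discretization, so population
  -- feasibility implies empirical feasibility.
  have hfeas : ∀ Q : PMF F, avg Q (fun f => lossReg P μ l f) ≤ ε → avg Q I.cost ≤ I.tol := by
    intro Q hQ
    have := avg_le_avg_add Q hcost hreg hupper
    rw [htol]
    linarith
  have hcomp := fun Q hQ => I.le_of_gap_le hbest hB.le hstops.1 hdisp hcost Q (hfeas Q hQ)
  have hrange : I.range = |β 0| + |β 1| := rfl
  have hacc : I.acc = ν := rfl
  have hbound : I.bound = B := rfl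
  -- Against a feasible `Q`, `B` times the violation is at most a difference of two empirical
  -- disparities plus `2ν`. Disparities lie in an interval of length `|β₀| + |β₁|`, so the final
  -- check passes; its failure refutes feasibility.
  have hret : ∀ Q : PMF F, avg Q (fun f => lossReg P μ l f) ≤ ε →
      avg (I.avgPrimal best t) I.cost ≤ I.tol + (I.range + 2 * I.acc) / I.bound := by
    intro Q hQ
    have h1 := (hcomp Q hQ).2
    have hmem := fun f : F => empDisparity_mem hμ hN β ev s (hF.mem f f.2)
    set m := min (β 0) 0 + min (β 1) 0
    have h2 : avg Q I.disp ≤ m + (|β 0| + |β 1|) := by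
      have := avg_mono Q hdisp (fun _ => le_rfl) fun f => (hmem f).2
      rwa [avg_const] at this
    have h3 : m ≤ avg (I.avgPrimal best t) I.disp := by
      have := avg_mono (I.avgPrimal best t) (v := fun _ => m) (fun _ => le_rfl) hdisp
        fun f => (hmem f).1
      rwa [avg_const] at this
    rw [← sub_le_iff_le_add', le_div_iff₀ (by rw [hbound]; exact hB), hrange]
    linarith
  set Δ := (|β 0| + |β 1|) * ((2 * r₂ + 1 / N) / p) with hΔ
  have hdd := fun f : F => abs_le.1 (hs.abs_empDisparity_sub_le hS hF hn hN hbin hp hev f.2)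
  have hdisp' : ∀ f : F, |disparity P β ev f| ≤ |β 0| + |β 1| + Δ := fun f => by
    have h := abs_le.1 (hdisp f)
    have h1 : I.disp f = empDisparity β ev N (oracleData μ s) f := rfl
    rw [h1] at h
    rw [abs_le]
    constructor <;> linarith [hdd f]
  by_cases hr : avg (I.avgPrimal best t) I.cost ≤ I.tol + (I.range + 2 * I.acc) / I.bound
  · left
    refine ⟨I.avgPrimal best t, by rw [EGInput.returned, if_pos hr], ?_, fun Q hQ => ?_⟩
    · have := avg_le_avg_add (I.avgPrimal best t) hreg hcost hlower
      rw [htol, hrange, hacc, hbound] at hr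
      linarith
    · have h1 := (hcomp Q hQ).1
      have h2 := avg_le_avg_add (I.avgPrimal best t) (v := fun f : F => disparity P β ev f)
        (w := I.disp) (c := Δ) hdisp' hdisp fun f => by
          change _ ≤ empDisparity β ev N (oracleData μ s) f + Δ
          linarith [(hdd f).1]
      have h3 := avg_le_avg_add Q (v := I.disp) (w := fun f : F => disparity P β ev f)
        (c := Δ) hdisp hdisp' fun f => by
          change empDisparity β ev N (oracleData μ s) f ≤ _ + Δ
          linarith [(hdd f).2]
      rw [hacc] at h1
      linarith
  · right
    exact ⟨by rw [EGInput.returned, if_neg hr], fun ⟨Q, hQ⟩ => hr (hret Q hQ)⟩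

end Guarantee

/-! ### Rates -/

section Rates

lemma neg_log_div_eight {δ : ℝ} : -Real.log (δ / 8) = Real.log (8 / δ) := by
  rw [← Real.log_inv, inv_div]

lemma rpow_neg_half_le {φ : ℝ} (hφ : φ ≤ 1 / 2) {n : ℕ} (hn : 1 ≤ n) :
    (n : ℝ) ^ (-(1 / 2) : ℝ) ≤ (n : ℝ) ^ (-φ) :=
  Real.rpow_le_rpow_of_exponent_le (by exact_mod_cast hn) (by linarith)

lemma rpow_neg_le_one {φ : ℝ} (hφ : 0 ≤ φ) {n : ℕ} (hn : 1 ≤ n) : (n : ℝ) ^ (-φ) ≤ 1 :=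
  Real.rpow_le_one_of_one_le_of_nonpos (by exact_mod_cast hn) (by linarith)

lemma sqrt_div_natCast (L : ℝ) {n : ℕ} : √(L / n) = √L * (n : ℝ) ^ (-(1 / 2) : ℝ) := by
  rw [Real.sqrt_div' _ (Nat.cast_nonneg n), Real.rpow_neg (Nat.cast_nonneg n), ← Real.sqrt_eq_rpow]
  rfl

lemma one_div_le_of_le {φ cN : ℝ} (hcN : 0 < cN) {n N : ℕ} (hn : 1 ≤ n)
    (h : cN * (n : ℝ) ^ φ ≤ N) : 1 / (N : ℝ) ≤ 1 / cN * (n : ℝ) ^ (-φ) := by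
  have hnpos : (0 : ℝ) < n := by exact_mod_cast hn
  have hpow : 0 < (n : ℝ) ^ φ := Real.rpow_pos_of_pos hnpos _
  rw [Real.rpow_neg hnpos.le, ← one_div, one_div_mul_one_div]
  exact one_div_le_one_div_of_le (by positivity) h

/-- For large samples the tolerance of the algorithm exceeds the deviation of the empirical loss. -/
lemma exists_forall_deviation_le_tolerance {φ C cN : ℝ} (hφ0 : 0 ≤ φ) (hφ : φ ≤ 1 / 2)
    (hcN : 0 < cN) :
    ∃ n₀ : ℕ, ∀ (n N : ℕ) (δ C' C'' : ℝ), n₀ ≤ n → 1 ≤ n → 1 ≤ N → cN * (n : ℝ) ^ φ ≤ N →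
      0 < δ → δ < 1 → 2 * C + 2 + √(2 * Real.log (8 * N / δ)) ≤ C' →
      √(-Real.log (δ / 8) / 2) ≤ C'' →
      2 * (C * (n : ℝ) ^ (-φ)) + 2 * √(Real.log (8 / δ) / n) + 1 / N
        ≤ C' * (n : ℝ) ^ (-φ) + C'' * (n : ℝ) ^ (-(1 / 2) : ℝ) := by
  -- For `φ = 0` the grid need not become finer, so this case is separate: then `n ^ (-φ) = 1`, and
  -- the constant `2` in `C'` absorbs `1/N`.
  have hthr : ∃ n₀ : ℕ, φ = 0 ∨ ∀ n : ℕ, n₀ ≤ n → Real.exp (200 / cN ^ 2) ≤ cN * (n : ℝ) ^ φ := by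
    rcases hφ0.eq_or_lt with h | h
    · exact ⟨0, Or.inl h.symm⟩
    · have htend : Filter.Tendsto (fun n : ℕ => cN * (n : ℝ) ^ φ) Filter.atTop Filter.atTop :=
        ((tendsto_rpow_atTop h).comp tendsto_natCast_atTop_atTop).const_mul_atTop hcN
      obtain ⟨n₀, hn₀⟩ := Filter.eventually_atTop.1
        (htend.eventually_ge_atTop (Real.exp (200 / cN ^ 2)))
      exact ⟨n₀, Or.inr hn₀⟩
  obtain ⟨n₀, hn₀⟩ := hthr
  refine ⟨n₀, fun n N δ C' C'' hnn hn hN hNlo hδ0 hδ1 hC' hC'' => ?_⟩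
  have hNpos : (0 : ℝ) < N := by exact_mod_cast hN
  have hN1 : (1 : ℝ) ≤ N := by exact_mod_cast hN
  have hnpos : (0 : ℝ) < n := by exact_mod_cast hn
  set a := (n : ℝ) ^ (-φ) with ha
  set h := (n : ℝ) ^ (-(1 / 2) : ℝ) with hh
  have ha0 : 0 < a := Real.rpow_pos_of_pos hnpos _
  have hh0 : 0 < h := Real.rpow_pos_of_pos hnpos _
  have hha : h ≤ a := rpow_neg_half_le hφ hn
  set L := Real.log (8 / δ) with hL
  set Λ := Real.log (8 * N / δ) with hΛ
  have hLΛ : L ≤ Λ := Real.log_le_log (by positivity) (by gcongr; linarith)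
  have hNΛ : Real.log N ≤ Λ := by
    refine Real.log_le_log hNpos ?_
    rw [le_div_iff₀ hδ0]
    nlinarith
  -- One twentieth of the logarithmic term of `C'` is reserved for the discretization error; `exp
  -- (200 / cN²) ≤ N` gives exactly `20 / cN ≤ √(2Λ)`.
  have hdisc : 1 / (N : ℝ) ≤ a * (2 + √(2 * Λ) / 20) := by
    have hs := Real.sqrt_nonneg (2 * Λ)
    rcases hn₀ with h0 | hbig
    · have ha1 : a = 1 := by rw [ha, h0, neg_zero, Real.rpow_zero]
      have : 1 / (N : ℝ) ≤ 1 := by rw [div_le_one hNpos]; exact hN1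
      rw [ha1]
      linarith
    · have h1 : Real.exp (200 / cN ^ 2) ≤ N := (hbig n hnn).trans hNlo
      have h2 : 200 / cN ^ 2 ≤ Λ := ((Real.le_log_iff_exp_le hNpos).2 h1).trans hNΛ
      have h3 : 20 / cN ≤ √(2 * Λ) := by
        refine Real.le_sqrt_of_sq_le ?_
        calc (20 / cN) ^ 2 = 2 * (200 / cN ^ 2) := by ring
          _ ≤ 2 * Λ := by linarith
      have h4 : 1 / cN ≤ √(2 * Λ) / 20 := by
        calc 1 / cN = 20 / cN / 20 := by ring
          _ ≤ _ := by linarith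
      refine (one_div_le_of_le hcN hn hNlo).trans ?_
      rw [mul_comm, ← ha]
      exact mul_le_mul_of_nonneg_left (by linarith) ha0.le
  -- The other nineteen twentieths give at least `1.34 √L h`, and `C''` gives at least `0.707 √L h`;
  -- together they exceed `2 √L h`.
  have hmain : 2 * (√L * h) ≤ a * (19 / 20 * √(2 * Λ)) + √(L / 2) * h := by
    have hs0 := Real.sqrt_nonneg L
    have h2 : (1.414 : ℝ) ≤ √2 := Real.le_sqrt_of_sq_le (by norm_num)
    have h3 : √2 * √L ≤ √(2 * Λ) := by
      rw [← Real.sqrt_mul (by norm_num)]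
      exact Real.sqrt_le_sqrt (by linarith)
    have h4 : √(L / 2) = √2 * √L / 2 := by
      have : L / 2 = 2 * L / 2 ^ 2 := by ring
      rw [this, Real.sqrt_div' _ (by positivity), Real.sqrt_sq (by norm_num),
        Real.sqrt_mul (by norm_num)]
    have h5 : 1.414 * √L ≤ √2 * √L := mul_le_mul_of_nonneg_right h2 hs0
    have h6 : h * (19 / 20 * (1.414 * √L)) ≤ a * (19 / 20 * √(2 * Λ)) :=
      mul_le_mul hha (by linarith) (by positivity) ha0.le
    have h7 : (0.707 * √L) * h ≤ √(L / 2) * h := by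
      rw [h4]
      exact mul_le_mul_of_nonneg_right (by linarith) hh0.le
    nlinarith [mul_nonneg hs0 hh0.le]
  rw [neg_log_div_eight] at hC''
  rw [sqrt_div_natCast]
  have h8 := mul_le_mul_of_nonneg_right hC' ha0.le
  have h9 := mul_le_mul_of_nonneg_right hC'' hh0.le
  linarith

/-- Bounds for the algorithm's tolerance. -/
lemma tolerance_le {φ C M CN : ℝ} (hφ0 : 0 ≤ φ) (hφ : φ ≤ 1 / 2) (hC : 0 < C) (hM : 1 ≤ M)
    {n N : ℕ} {δ C' C'' : ℝ} (hn : 1 ≤ n) (hN : 1 ≤ N) (hNhi : N ≤ CN * (n : ℝ) ^ φ)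
    (hδ0 : 0 < δ) (hδ1 : δ < 1)
    (hC' : C' ≤ M * (2 * C + 2 + √(2 * Real.log (8 * N / δ))))
    (hC'' : C'' ≤ M * √(-Real.log (δ / 8) / 2)) :
    C' * (n : ℝ) ^ (-φ) + C'' * (n : ℝ) ^ (-(1 / 2) : ℝ)
        ≤ M * (2 * C + 4 + √(2 * (3 + CN))) * (1 + Real.log n + Real.log (1 / δ)) * (n : ℝ) ^ (-φ) ∧
      C' * (n : ℝ) ^ (-φ) + C'' * (n : ℝ) ^ (-(1 / 2) : ℝ)
        ≤ M * (2 * C + 4 + √(2 * (3 + CN))) * √(1 + Real.log (1 / δ)) := by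
  have hnpos : (0 : ℝ) < n := by exact_mod_cast hn
  have hNpos : (0 : ℝ) < N := by exact_mod_cast hN
  have hlogn : 0 ≤ Real.log n := Real.log_natCast_nonneg n
  have hlogδ : 0 ≤ Real.log (1 / δ) := Real.log_nonneg (by rw [le_div_iff₀ hδ0]; linarith)
  set a := (n : ℝ) ^ (-φ) with ha
  set h := (n : ℝ) ^ (-(1 / 2) : ℝ) with hh
  have ha0 : 0 < a := Real.rpow_pos_of_pos hnpos _
  have hh0 : 0 < h := Real.rpow_pos_of_pos hnpos _
  have hha : h ≤ a := rpow_neg_half_le hφ hn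
  have ha1 : a ≤ 1 := rpow_neg_le_one hφ0 hn
  have hpa : (n : ℝ) ^ φ * a = 1 := by
    rw [ha, ← Real.rpow_add hnpos, add_neg_cancel, Real.rpow_zero]
  have hpow : 0 < (n : ℝ) ^ φ := Real.rpow_pos_of_pos hnpos _
  have hCN : 0 < CN := pos_of_mul_pos_left (hNpos.trans_le hNhi) hpow.le
  have hlog8 : Real.log 8 ≤ 3 := by
    have : Real.log 8 = 3 * Real.log 2 := by
      rw [← Real.log_rpow (by norm_num)]
      norm_num
    rw [this]
    linarith [Real.log_two_lt_d9]
  have hΛ : Real.log (8 * N / δ) = Real.log 8 + Real.log N + Real.log (1 / δ) := by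
    rw [mul_div_assoc, Real.log_mul (by norm_num) (by positivity), div_eq_mul_one_div,
      Real.log_mul (by positivity) (by positivity), add_assoc]
  have hL : Real.log (8 / δ) = Real.log 8 + Real.log (1 / δ) := by
    rw [div_eq_mul_one_div, Real.log_mul (by norm_num) (by positivity)]
  rw [neg_log_div_eight, hL] at hC''
  rw [hΛ] at hC'
  have hlogN0 : 0 ≤ Real.log N := Real.log_natCast_nonneg N
  have hlogN : Real.log N ≤ CN + Real.log n := by
    have h1 := Real.log_le_log hNpos hNhi
    rw [Real.log_mul hCN.ne' hpow.ne', Real.log_rpow hnpos] at h1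
    have h2 := Real.log_le_sub_one_of_pos hCN
    nlinarith
  -- The power `n ^ (-2φ)` beats `log N ≤ CN n ^ φ`; this keeps the second bound free of `log n`.
  have hlogNa : Real.log N * a ^ 2 ≤ CN := by
    have h1 : Real.log N ≤ CN * (n : ℝ) ^ φ := by
      have := Real.log_le_sub_one_of_pos hNpos
      linarith
    calc Real.log N * a ^ 2 ≤ CN * (n : ℝ) ^ φ * a ^ 2 := by gcongr
      _ = CN * a * ((n : ℝ) ^ φ * a) := by ring
      _ ≤ CN := by rw [hpa, mul_one]; exact mul_le_of_le_one_right hCN.le ha1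
  set D := Real.log (1 / δ) with hD
  set S := √(2 * (3 + CN)) with hS
  have hS0 : 0 ≤ S := Real.sqrt_nonneg _
  have hM0 : 0 ≤ M := by linarith
  set x := √(2 * (Real.log 8 + Real.log N + D)) with hx
  set y := √((Real.log 8 + D) / 2) with hy
  -- The first bound keeps the rate and allows a logarithm of `n`. The second drops the rate but has
  -- only the root of `1 + ln(1/δ)`, so that squaring it in the iteration count leaves the first
  -- power.
  constructor
  · set W := 1 + Real.log n + D with hW
    have hW1 : 1 ≤ W := by linarith
    have hWW : W ≤ W ^ 2 := le_self_pow₀ hW1 two_ne_zero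
    have hxW : x ≤ S * W := by
      refine Real.sqrt_le_iff.2 ⟨by positivity, ?_⟩
      rw [mul_pow, hS, Real.sq_sqrt (by positivity)]
      have h2 : CN ≤ CN * W := le_mul_of_one_le_right hCN.le hW1
      have h3 : (3 + CN) * W ≤ (3 + CN) * W ^ 2 := mul_le_mul_of_nonneg_left hWW (by positivity)
      rw [add_mul 3 CN W] at h3
      linarith
    have hyW : y ≤ 2 * W := by
      refine Real.sqrt_le_iff.2 ⟨by positivity, ?_⟩
      rw [mul_pow]
      linarith
    have h1 : C' * a ≤ M * (2 * C + 2 + S) * W * a := by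
      refine mul_le_mul_of_nonneg_right (hC'.trans ?_) ha0.le
      rw [mul_assoc]
      refine mul_le_mul_of_nonneg_left ?_ hM0
      have h2 : 2 * C + 2 ≤ (2 * C + 2) * W := le_mul_of_one_le_right (by positivity) hW1
      rw [add_mul (2 * C + 2) S W]
      linarith
    have h2 : C'' * h ≤ M * 2 * W * a := by
      calc C'' * h ≤ M * (2 * W) * h :=
            mul_le_mul_of_nonneg_right (hC''.trans (mul_le_mul_of_nonneg_left hyW hM0)) hh0.le
        _ ≤ M * (2 * W) * a := mul_le_mul_of_nonneg_left hha (by positivity)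
        _ = _ := by ring
    calc _ ≤ M * (2 * C + 2 + S) * W * a + M * 2 * W * a := add_le_add h1 h2
      _ = _ := by ring
  · set Λ := 1 + D with hΛ'
    have hΛ1 : 1 ≤ Λ := by linarith
    have hq1 : 1 ≤ √Λ := Real.one_le_sqrt.2 hΛ1
    have hxa : x * a ≤ S * √Λ := by
      rw [hx, hS, ← Real.sqrt_mul (by positivity), ← Real.sqrt_sq ha0.le,
        ← Real.sqrt_mul (by
          have : 0 ≤ Real.log 8 := Real.log_nonneg (by norm_num)
          positivity)]
      refine Real.sqrt_le_sqrt ?_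
      have ha2 : a ^ 2 ≤ 1 := pow_le_one₀ ha0.le ha1
      have h3 : (Real.log 8 + D) * a ^ 2 ≤ 3 + D := by
        have h8 : 0 ≤ Real.log 8 := Real.log_nonneg (by norm_num)
        calc (Real.log 8 + D) * a ^ 2 ≤ Real.log 8 + D :=
              mul_le_of_le_one_right (by positivity) ha2
          _ ≤ _ := by linarith
      nlinarith [mul_nonneg hCN.le hlogδ]
    have hyh : y * h ≤ 2 * √Λ := by
      have h1 : y ≤ 2 * √Λ := by
        refine Real.sqrt_le_iff.2 ⟨by positivity, ?_⟩
        rw [mul_pow, Real.sq_sqrt (by positivity)]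
        linarith
      exact (mul_le_of_le_one_right (Real.sqrt_nonneg _) (hha.trans ha1)).trans h1
    have h1 : C' * a ≤ M * ((2 * C + 2 + S) * √Λ) := by
      calc C' * a ≤ M * (2 * C + 2 + x) * a := mul_le_mul_of_nonneg_right hC' ha0.le
        _ = M * ((2 * C + 2) * a + x * a) := by ring
        _ ≤ _ := by
          refine mul_le_mul_of_nonneg_left ?_ hM0
          have : (2 * C + 2) * a ≤ (2 * C + 2) * √Λ :=
            mul_le_mul_of_nonneg_left (ha1.trans hq1) (by positivity)
          linarith
    have h2 : C'' * h ≤ M * (2 * √Λ) := by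
      calc C'' * h ≤ M * y * h := mul_le_mul_of_nonneg_right hC'' hh0.le
        _ = M * (y * h) := by ring
        _ ≤ _ := mul_le_mul_of_nonneg_left hyh hM0
    calc _ ≤ M * ((2 * C + 2 + S) * √Λ) + M * (2 * √Λ) := add_le_add h1 h2
      _ = _ := by ring

lemma radius_le {φ C : ℝ} (hφ : φ ≤ 1 / 2) (hC : 0 < C) {n : ℕ} (hn : 1 ≤ n) {δ : ℝ} (hδ0 : 0 < δ)
    (hδ1 : δ < 1) :
    2 * (C * (n : ℝ) ^ (-φ)) + 2 * √(Real.log (16 / δ) / n)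
      ≤ (2 * C + 4) * (1 + Real.log n + Real.log (1 / δ)) * (n : ℝ) ^ (-φ) := by
  have hnpos : (0 : ℝ) < n := by exact_mod_cast hn
  have hlogn : 0 ≤ Real.log n := Real.log_natCast_nonneg n
  have hlogδ : 0 ≤ Real.log (1 / δ) := Real.log_nonneg (by rw [le_div_iff₀ hδ0]; linarith)
  have hlog16 : Real.log 16 ≤ 3 := by
    have : Real.log 16 = 4 * Real.log 2 := by
      rw [← Real.log_rpow (by norm_num)]
      norm_num
    rw [this]
    linarith [Real.log_two_lt_d9]
  have hL : Real.log (16 / δ) = Real.log 16 + Real.log (1 / δ) := by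
    rw [div_eq_mul_one_div, Real.log_mul (by norm_num) (by positivity)]
  set W := 1 + Real.log n + Real.log (1 / δ) with hW
  have hW1 : 1 ≤ W := by linarith
  have ha0 : 0 < (n : ℝ) ^ (-φ) := Real.rpow_pos_of_pos hnpos _
  have h1 : √(Real.log (16 / δ)) ≤ 2 * W := by
    refine Real.sqrt_le_iff.2 ⟨by positivity, ?_⟩
    rw [hL]
    nlinarith
  have h2 : √(Real.log (16 / δ) / n) ≤ 2 * W * (n : ℝ) ^ (-φ) := by
    rw [sqrt_div_natCast]
    exact mul_le_mul h1 (rpow_neg_half_le hφ hn) (Real.rpow_nonneg hnpos.le _) (by positivity)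
  have h3 : C * (n : ℝ) ^ (-φ) ≤ C * W * (n : ℝ) ^ (-φ) :=
    mul_le_mul_of_nonneg_right (le_mul_of_one_le_right hC.le hW1) ha0.le
  calc _ ≤ 2 * (C * W * (n : ℝ) ^ (-φ)) + 2 * (2 * W * (n : ℝ) ^ (-φ)) := by linarith
    _ = _ := by ring

/-- The deviation bounds hold in terms of `n`; passing to group sizes only weakens them, as the
exponent is nonpositive. -/
lemma groupCount_rpow_le {𝒳 : Type*} {φ : ℝ} (hφ0 : 0 ≤ φ) {n : ℕ} (hn : 1 ≤ n) (e : GroupEvent)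
    (s : Fin n → Unit4 𝒳) : (n : ℝ) ^ (-φ) ≤ (max (groupCount e s : ℝ) 1) ^ (-φ) := by
  refine Real.rpow_le_rpow_of_nonpos (by positivity) (max_le ?_ ?_) (by linarith)
  · have : groupCount e s ≤ n := (Finset.card_le_univ _).trans (by simp)
    exact_mod_cast this
  · exact_mod_cast hn

end Rates

/-! ### The main theorem -/

theorem theorem2 {𝒳 : Type*} [MeasurableSpace 𝒳]
    (β : Fin 2 → ℝ) (φ C M ε p cν cB cN CN : ℝ)
    (hφ0 : 0 ≤ φ) (hφ : φ ≤ 1 / 2) (hC : 0 < C) (hM : 1 ≤ M) (hε : 0 ≤ ε) (hp : 0 < p)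
    (hcν : 0 < cν) (hcB : 0 < cB) (hcN : 0 < cN) :
    -- constants that depend only on the numbers above
    ∃ (K : ℝ) (k n₀ : ℕ),
      ∀ (P : Measure (Unit4 𝒳)) [IsProbabilityMeasure P] (μ : 𝒳 → ℝ) (l : ℝ → ℝ → ℝ)
        (F : Set (𝒳 → ℝ)) (ev : Fin 2 → GroupEvent),
        SelectiveLabels P μ → IsLoss l → IsPredictionClass P F →
        -- complexity of the class of threshold classifiers
        (∀ m : ℕ, 1 ≤ m → rademacher (thrClass F) m ≤ C * (m : ℝ) ^ (-φ)) →
        -- events that involve `Y*`: the outcome is binary and `Y* ⊥ A | X`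
        ((∃ a, (ev a).label ≠ LabelCond.free) →
          (∀ᵐ o ∂P, o.out = 0 ∨ o.out = 1) ∧ CondIndepGivenFeat P Unit4.out Unit4.attr) →
        -- the relevant conditioning events have positive probability
        (∀ a, β a ≠ 0 → p ≤ P.real (ev a).toSet) →
        -- identification of the disparities
        (∀ a, P (ev a).toSet ≠ 0 → ∀ f ∈ F,
          0 < ∫ o, (ev a).label.weight (μ o.feat) ∂(P[|(ev a).attrSet]) ∧
          ∫ o, f o.feat ∂(P[|(ev a).toSet]) =
            (∫ o, f o.feat * (ev a).label.weight (μ o.feat) ∂(P[|(ev a).attrSet])) /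
              ∫ o, (ev a).label.weight (μ o.feat) ∂(P[|(ev a).attrSet])) ∧
        -- for losses convex in the outcome, feasibility for `loss` implies it for `loss_μ`
        ((∀ u ∈ Set.Icc (0 : ℝ) 1, ConvexOn ℝ (Set.Icc (0 : ℝ) 1) fun y => l y u) →
          ∀ Q : PMF F, avg Q (fun f => lossReg P μ l f) ≤ avg Q (fun f => loss P l f)) ∧
        -- the algorithm, run on the oracle data `(Xᵢ, Aᵢ, μ(Xᵢ))`
        ∀ (n N : ℕ) (T : Finset ℝ) (δ C' C'' : ℝ),
          1 ≤ n → 1 ≤ N → cN * (n : ℝ) ^ φ ≤ N → N ≤ CN * (n : ℝ) ^ φ → IsHalfCover N T →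
          0 < δ → δ < 1 →
          2 * C + 2 + √(2 * Real.log (8 * N / δ)) ≤ C' →
          C' ≤ M * (2 * C + 2 + √(2 * Real.log (8 * N / δ))) →
          √(-Real.log (δ / 8) / 2) ≤ C'' →
          C'' ≤ M * √(-Real.log (δ / 8) / 2) →
          ∀ I : (Fin n → Unit4 𝒳) → EGInput F,
          (∀ s, I s = egInput F β ev l N T φ ε C' C'' (cB * (n : ℝ) ^ φ) (cν * (n : ℝ) ^ (-φ))
            (oracleData μ s)) →
          -- number of iterations, on every sample
          (∀ (s : Fin n → Unit4 𝒳) (best : ℝ → F), (I s).IsBestResponse best →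
            ∃ t : ℕ, (I s).StopsAt best t ∧
              (t : ℝ) + 1 ≤ K * (1 + Real.log (1 / δ)) * (n : ℝ) ^ (4 * φ)) ∧
          -- guarantees, outside a set of samples of (outer) probability at most `δ`
          (n₀ ≤ n →
            (Measure.pi fun _ : Fin n => P)
              {s | ¬ ∀ (best : ℝ → F) (t : ℕ),
                (I s).IsBestResponse best → (I s).StopsAt best t →
                (∃ Qhat : PMF F, (I s).returned best t = some Qhat ∧
                  avg Qhat (fun f => lossReg P μ l f) ≤ ε + polylog K k n δ * (n : ℝ) ^ (-φ) ∧
                  ∀ Q : PMF F, avg Q (fun f => lossReg P μ l f) ≤ ε →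
                    avg Qhat (fun f => disparity P β ev f) ≤
                      avg Q (fun f => disparity P β ev f)
                        + polylog K k n δ * (max (groupCount (ev 0) s : ℝ) 1) ^ (-φ)
                        + polylog K k n δ * (max (groupCount (ev 1) s : ℝ) 1) ^ (-φ)) ∨
                ((I s).returned best t = none ∧
                  ¬ ∃ Q : PMF F, avg Q (fun f => lossReg P μ l f) ≤ ε)}
              ≤ ENNReal.ofReal δ) := by
  obtain ⟨n₀, hn₀⟩ := exists_forall_deviation_le_tolerance (C := C) hφ0 hφ hcN
  set S := M * (2 * C + 4 + √(2 * (3 + CN))) with hS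
  -- `K₁`, `K₂` and `K₃` serve the iteration count, the loss and the disparity. All are nonnegative,
  -- so their sum works throughout, with a single power of the logarithmic factor.
  set K₁ := 4 * (2 + ε + S) ^ 2 * (cB / cν) ^ 2 + 2 with hK₁
  set K₂ := S + (|β 0| + |β 1| + 2 * cν) / cB + (2 * C + 4) + 1 / cN with hK₂
  set K₃ := 2 * cν + 2 * ((|β 0| + |β 1|) * ((2 * (2 * C + 4) + 1 / cN) / p)) with hK₃
  have hM0 : 0 < M := by linarith
  have hS0 : 0 ≤ S := by positivity
  have hK₁0 : 0 ≤ K₁ := by positivity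
  have hK₂0 : 0 ≤ K₂ := by positivity
  have hK₃0 : 0 ≤ K₃ := by positivity
  refine ⟨K₁ + K₂ + K₃, 1, n₀, ?_⟩
  intro P _ μ l F ev hSL hl hF hrad hbin hev
  have habs : ∀ f ∈ F, ∀ x, |f x| ≤ 1 := fun f hf x => by
    rw [abs_of_nonneg (hF.mem f hf x).1]
    exact (hF.mem f hf x).2
  refine ⟨fun a ha f hf => identification hSL (ev a) (fun h => hbin ⟨a, h⟩) ha
    (hF.measurable f hf) (habs f hf), fun hconv Q => ?_, ?_⟩
  · have h1 : ∀ f : F, |lossReg P μ l f| ≤ 1 := fun f => by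
      have := lossReg_mem (P := P) hl hSL (hF.measurable f f.2) (hF.mem f f.2)
      rw [abs_of_nonneg this.1]
      exact this.2
    have h2 : ∀ f : F, |loss P l f| ≤ 1 := fun f => by
      have := loss_mem (P := P) hl hSL (hF.measurable f f.2) (hF.mem f f.2)
      rw [abs_of_nonneg this.1]
      exact this.2
    exact avg_mono Q h1 h2 fun f => lossReg_le_loss hl hSL hconv (hF.measurable f f.2) (hF.mem f f.2)
  intro n N T δ C' C'' hn hN hNlo hNhi hT hδ0 hδ1 hC'lo hC'hi hC''lo hC''hi I hI
  obtain rfl : I = fun s => egInput F β ev l N T φ ε C' C'' (cB * (n : ℝ) ^ φ)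
    (cν * (n : ℝ) ^ (-φ)) (oracleData μ s) := funext hI
  have hnpos : (0 : ℝ) < n := by exact_mod_cast hn
  have hpow : 0 < (n : ℝ) ^ φ := Real.rpow_pos_of_pos hnpos _
  have ha0 : 0 < (n : ℝ) ^ (-φ) := Real.rpow_pos_of_pos hnpos _
  have ha1 : (n : ℝ) ^ (-φ) ≤ 1 := rpow_neg_le_one hφ0 hn
  have hlogn : 0 ≤ Real.log n := Real.log_natCast_nonneg n
  have hlogδ : 0 ≤ Real.log (1 / δ) := Real.log_nonneg (by rw [le_div_iff₀ hδ0]; linarith)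
  have hC'0 : 0 ≤ C' := le_trans (by positivity) hC'lo
  have hC''0 : 0 ≤ C'' := le_trans (by positivity) hC''lo
  obtain ⟨htol₁, htol₂⟩ := tolerance_le hφ0 hφ hC hM hn hN hNhi hδ0 hδ1 hC'hi hC''hi
  rw [← hS] at htol₁ htol₂
  set tol := C' * (n : ℝ) ^ (-φ) + C'' * (n : ℝ) ^ (-(1 / 2) : ℝ) with htol
  have htol0 : 0 ≤ tol := by positivity
  set a := (n : ℝ) ^ (-φ) with ha
  have hainv : (n : ℝ) ^ φ = 1 / a := by rw [ha, Real.rpow_neg hnpos.le, one_div, inv_inv]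
  refine ⟨fun s best hbest => ?_, fun hnn => ?_⟩
  · obtain ⟨t, ht, hle⟩ := egInput_exists_stopsAt (β := β) (φ := φ) (s := s) hl hSL.reg_mem
      hF.nonempty hF.mem hn hN hT hε hC'0 hC''0 (mul_pos hcB hpow) (mul_pos hcν ha0) hbest
    refine ⟨t, ht, hle.trans ?_⟩
    rw [← htol]
    set Λ := 1 + Real.log (1 / δ) with hΛ
    have hΛ1 : 1 ≤ Λ := by linarith
    have hq1 : 1 ≤ √Λ := Real.one_le_sqrt.2 hΛ1
    have hr : 2 + ε + tol ≤ (2 + ε + S) * √Λ := by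
      have h1 : 2 + ε ≤ (2 + ε) * √Λ := le_mul_of_one_le_right (by linarith) hq1
      rw [add_mul (2 + ε) S]
      linarith
    have hr2 : (2 + ε + tol) ^ 2 ≤ (2 + ε + S) ^ 2 * Λ := by
      calc (2 + ε + tol) ^ 2 ≤ ((2 + ε + S) * √Λ) ^ 2 := by gcongr
        _ = _ := by rw [mul_pow, Real.sq_sqrt (by positivity)]
    have hp4 : (n : ℝ) ^ (4 * φ) = (1 / a) ^ 4 := by
      rw [← hainv, ← Real.rpow_natCast, ← Real.rpow_mul hnpos.le]
      congr 1
      push_cast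
      ring
    have hp41 : 1 ≤ (1 / a) ^ 4 := one_le_pow₀ (by rw [le_div_iff₀ ha0]; linarith)
    have heq : 4 * (2 + ε + tol) ^ 2 * (cB * (n : ℝ) ^ φ) ^ 2 / (cν * a) ^ 2
        = 4 * (2 + ε + tol) ^ 2 * (cB / cν) ^ 2 * (1 / a) ^ 4 := by
      rw [hainv]
      field_simp
    have hfirst : 4 * (2 + ε + tol) ^ 2 * (cB / cν) ^ 2 * (1 / a) ^ 4
        ≤ 4 * ((2 + ε + S) ^ 2 * Λ) * (cB / cν) ^ 2 * (1 / a) ^ 4 := by gcongr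
    have hsecond : 2 ≤ 2 * (Λ * (1 / a) ^ 4) := by
      have := one_le_mul_of_one_le_of_one_le hΛ1 hp41
      linarith
    rw [heq, hp4]
    calc _ ≤ 4 * ((2 + ε + S) ^ 2 * Λ) * (cB / cν) ^ 2 * (1 / a) ^ 4 + 2 * (Λ * (1 / a) ^ 4) :=
          add_le_add hfirst hsecond
      _ = K₁ * Λ * (1 / a) ^ 4 := by rw [hK₁]; ring
      _ ≤ (K₁ + K₂ + K₃) * Λ * (1 / a) ^ 4 := by
        gcongr
        linarith
  · have hgood := measure_not_goodSample_le (P := P) hl hF ev hn hN hT hSL.measurable_reg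
      hSL.reg_mem (hrad n hn) hδ0 hδ1
    -- Monotonicity of outer measure suffices: failure of the guarantee implies a bad sample, and
    -- neither set needs to be measurable.
    refine (measure_mono fun s hs => ?_).trans hgood
    intro hsg
    refine hs fun best t hbest hstops => ?_
    have hdev := hn₀ n N δ C' C'' hnn hn hN hNlo hδ0 hδ1 hC'lo hC''lo
    have hrad2 := radius_le hφ hC hn hδ0 hδ1
    have hdisc := one_div_le_of_le hcN hn hNlo
    rw [← ha] at hrad2 hdisc
    set r₂ := 2 * (C * a) + 2 * √(Real.log (16 / δ) / n) with hr₂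
    set W := 1 + Real.log n + Real.log (1 / δ) with hW
    have hW1 : 1 ≤ W := by linarith
    have haW : a ≤ W * a := le_mul_of_one_le_left ha0.le hW1
    have hdisc' : 1 / (N : ℝ) ≤ 1 / cN * (W * a) :=
      hdisc.trans (mul_le_mul_of_nonneg_left haW (by positivity))
    have hpoly : polylog (K₁ + K₂ + K₃) 1 n δ = (K₁ + K₂ + K₃) * W := by
      rw [polylog, pow_one]
    have hdual : (|β 0| + |β 1| + 2 * (cν * a)) / (cB * (n : ℝ) ^ φ)
        ≤ (|β 0| + |β 1| + 2 * cν) / cB * (W * a) := by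
      have h1 : (|β 0| + |β 1| + 2 * (cν * a)) / (cB * (n : ℝ) ^ φ)
          = (|β 0| + |β 1| + 2 * (cν * a)) / cB * a := by
        rw [hainv]
        field_simp
      rw [h1]
      refine mul_le_mul (div_le_div_of_nonneg_right ?_ hcB.le) haW ha0.le (by positivity)
      have := mul_le_of_le_one_right hcν.le ha1
      linarith
    have hbound₂ : tol + (|β 0| + |β 1| + 2 * (cν * a)) / (cB * (n : ℝ) ^ φ) + (r₂ + 1 / N)
        ≤ (K₁ + K₂ + K₃) * W * a := by
      calc _ ≤ S * W * a + (|β 0| + |β 1| + 2 * cν) / cB * (W * a)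
            + ((2 * C + 4) * W * a + 1 / cN * (W * a)) :=
            add_le_add (add_le_add htol₁ hdual) (add_le_add hrad2 hdisc')
        _ = K₂ * W * a := by rw [hK₂]; ring
        _ ≤ _ := by
          gcongr
          linarith
    have hbound₃ : 2 * (cν * a) + 2 * ((|β 0| + |β 1|) * ((2 * r₂ + 1 / N) / p))
        ≤ (K₁ + K₂ + K₃) * W * a := by
      calc _ ≤ 2 * (cν * (W * a)) + 2 * ((|β 0| + |β 1|) *
            ((2 * ((2 * C + 4) * W * a) + 1 / cN * (W * a)) / p)) := by gcongr
        _ = K₃ * W * a := by rw [hK₃]; ring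
        _ ≤ _ := by
          gcongr
          linarith
    have hmain := hsg.guarantee (φ := φ) (ε := ε) hl hSL hF hn hN hT hbin hp hev
      (mul_pos hcB hpow) hdev hbest hstops
    have hpoly0 : 0 ≤ (K₁ + K₂ + K₃) * W := by positivity
    rcases hmain with ⟨Qhat, hret, hloss, hdisp⟩ | hnone
    · left
      rw [hpoly]
      refine ⟨Qhat, hret, hloss.trans (add_le_add le_rfl hbound₂), fun Q hQ => ?_⟩
      -- The whole bound is charged to group `0`; the term of group `1` is only needed to be
      -- nonnegative.
      have h0 := mul_le_mul_of_nonneg_left (groupCount_rpow_le hφ0 hn (ev 0) s) hpoly0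
      have h1 : 0 ≤ (K₁ + K₂ + K₃) * W * (max (groupCount (ev 1) s : ℝ) 1) ^ (-φ) := by positivity
      have h2 := hdisp Q hQ
      linarith
    · exact Or.inr hnone
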